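/- **Definitions.** Let $F$ be a real vector space with a symmetric bilinear form $I$ of signature $(l,2,0)$ ($l$ positive, $2$ zero, $0$ negative squares). For non-isotropic $\alpha\in F$ put $\alpha^\vee=2\alpha/I(\alpha,\alpha)$ and $w_\alpha(\lambda)=\lambda-I(\lambda,\alpha^\vee)\alpha$. An *elliptic root system* in $(F,I)$ is a non-empty discrete subset $R\subset F$ such that the root lattice $Q(R)=\mathbb Z R$ is a full lattice in $F$; $I(\alpha,\alpha)\ne 0$ and $w_\alpha(R)=R$ for all $\alpha\in R$; $I(\alpha^\vee,\beta)\in\mathbb Z$ for all $\alpha,\beta\in R$; and $R$ is not the union of two non-empty mutually orthogonal subsets. A *marking* is a line $G\subset\operatorname{rad}(I)$ such that $G\cap Q(R)$ is full in $G$; then $(R,G)$ is a *marked elliptic root system* in signature $(l,2,0)$, and $R/G$ denotes the image of $R$ in $F/G$. $R$ is *reduced* if $2\alpha,\tfrac12\alpha\notin R$ for all $\alpha\in R$. An isomorphism $(R,G)\cong(R',G')$ is a linear isomorphism $F\to F'$ carrying $R$ onto $R'$ and $G$ onto $G'$; an isomorphism of quotients $R/G$, or of a quotient with $R(X_l)$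 below, is a linear isomorphism of the ambient spaces carrying roots onto roots. **Standard models.** Let $\varepsilon_1,\dots,\varepsilon_l,a,b$ be the standard basis of $\mathbb R^{l+2}$, with $I(\varepsilon_i,\varepsilon_j)=\delta_{ij}$ and $a,b$ spanning the radical. Let $BC_l$ have short roots $\pm\varepsilon_i$, middle roots $\pm(\varepsilon_i\pm\varepsilon_j)$ $(i<j)$ and long roots $\pm2\varepsilon_i$; denote these sets by $\Delta_s,\Delta_m,\Delta_l$. The affine root systems $R(X_l)$ in $\mathbb R^l\oplus\mathbb Rb$ are $$R(X_l)=(\Delta_s+\mathbb Zb)\cup(\Delta_m+\mu\mathbb Zb)\cup(\Delta_l+\nu\mathbb Zb),$$ with $(\mu,\nu)=(1,1),(2,4),(1,2),(2,2)$ for $X_l=BCC_l,\ C^\vee BC_l,\ BB_l^\vee,\ C^\vee C_l$ respectively. For $S,M,E\subset\Lambda=\mathbb Za\oplus\mathbb Zb$ put $$R(S,M,E)=(\Delta_s+S)\cup(\Delta_m+M)\cup(\Delta_l+E),$$ always with marking $G=\mathbb Ra$. Write $[i,j]=i\mathbb Za+j\mathbb Zb$, $L_{i,j}^{s_1,s_2}=\{s_2ma+s_1nb\mid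 (m-i)(n-j)\text{ even}\}$ and $L_{i,j}=L_{i,j}^{1,1}$. The list consists of the following $35$ types, where $p\in\{0,1\}$ and $l\ge 1$ unless otherwise stated. *Classical types* ($16$), for each of the four $X_l$ (with $l\ge2$ whenever $X_l=BB_l^\vee$, and with $l\ge 2$ for $X_l^{(2)}(1)$): - $X_l^{(1)}$: $([1,1],[1,\mu],[1,\nu])$ - $X_l^{(2)}(1)$: $([1,1],[1,\mu],[2,\nu])$ - $X_l^{(2)}(2)$: $([1,1],[2,\mu],[2,\nu])$ - $X_l^{(4)}$: $([1,1],[2,\mu],[4,\nu])$ *Listed under $BCC_l$:* - $BCC_l^{(1)*_0}$: $(\Lambda,\Lambda,L_{0,0})$ - $BCC_l^{(1)*_{0'}}$: $(\Lambda,\Lambda,L_{0,1})$ - $BCC_l^{(2)*_p}$: $(\Lambda,[2,1],L_{p,p}^{1,2})$ *Listed under $C^\vee BC_l$:* - $C^\vee BC_l^{(2)*_p}$: $(L_{p,p},2\Lambda,[2,4])$ - $C^\vee BC_l^{(4)*_0}$: $(L_{0,0},2\Lambda,4\Lambda)$ - $C^\vee BC_l^{(4)*_{0'}}$: $(L_{0,1},2\Lambda,4\Lambda)$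 *Listed under $BB_l^\vee$, only for $l=2$:* - $BB_2^{\vee(2)*}$: $(\Lambda,L_{0,0},2\Lambda)$ *Listed under $C^\vee C_l$:* - $C^\vee C_l^{(1)*_p}$: $(\Lambda,[1,2],L_{p,p}^{2,1})$ - $C^\vee C_l^{(2)*_s}$: $(L_{0,0},2\Lambda,2\Lambda)$ - $C^\vee C_l^{(2)*_l}$: $(\Lambda,2\Lambda,L_{0,0}^{2,2})$ - $C^\vee C_l^{(2)*_0}$: $(L_{0,0},2\Lambda,L_{0,0}^{2,2})$ - $C^\vee C_l^{(2)*_1}$: $(L_{0,0},2\Lambda,L_{1,1}^{2,2})$ - $C^\vee C_l^{(2)*_{1'}}$: $(L_{0,0},2\Lambda,L_{1,0}^{2,2})$ - $C^\vee C_l^{(2)\diamond}$: $(\Lambda,[1,2],\{ma+2nb\mid m-n\text{ even}\})$ - $C^\vee C_l^{(4)*_p}$: $(L_{p,p},2\Lambda,[4,2])$ **Theorem.** For every $l$, each of the listed types occurring in rank $l$ is a non-reduced marked elliptic root system in signature $(l,2,0)$ whose quotient $R/G$ is isomorphic to the affine root system $R(X_l)$ under which it is listed. Conversely, every non-reduced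 marked elliptic root system $(R,G)$ in signature $(l,2,0)$ is isomorphic to exactly one of the listed types occurring in rank $l$, by an isomorphism that respects the forms up to a positive factor, and $R/G$ is isomorphic to the corresponding $R(X_l)$. Uniqueness holds even among arbitrary linear isomorphisms of pairs. -/

import Mathlib

namespace MERS

/-! ### Generalized root systems, markings, isomorphisms -/

section General

variable {F : Type*} [NormedAddCommGroup F] [NormedSpace ℝ F]
variable {F' : Type*} [NormedAddCommGroup F'] [NormedSpace ℝ F']

/-- The bilinear form `I` has signature `(p, z, n)`: in a suitable basis of `F` its Gram matrix is
diagonal with `p` entries `1`, `z` entries `0` and `n` entries `-1`. -/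
def HasSignature (I : LinearMap.BilinForm ℝ F) (p z n : ℕ) : Prop :=
  ∃ e : Module.Basis (Fin p ⊕ Fin z ⊕ Fin n) ℝ F,
    (∀ i j, i ≠ j → I (e i) (e j) = 0) ∧
    (∀ i, I (e (Sum.inl i)) (e (Sum.inl i)) = 1) ∧
    (∀ i, I (e (Sum.inr (Sum.inl i))) (e (Sum.inr (Sum.inl i))) = 0) ∧
    (∀ i, I (e (Sum.inr (Sum.inr i))) (e (Sum.inr (Sum.inr i))) = -1)

/-- `α^∨ = 2 α / I(α, α)`, used for non-isotropic `α` only. -/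
noncomputable def coroot (I : LinearMap.BilinForm ℝ F) (α : F) : F := (2 / I α α) • α

/-- `w_α(x) = x - I(x, α^∨) α`. -/
noncomputable def refl (I : LinearMap.BilinForm ℝ F) (α x : F) : F := x - I x (coroot I α) • α

/-- The root lattice `Q(R)`. -/
def rootLattice (R : Set F) : Submodule ℤ F := Submodule.span ℤ R

/-- Generalized root systems belonging to `(F, I)`. The space `F` is finite-dimensional in all uses,
so its topology does not depend on the norm. -/
structure IsGeneralizedRootSystem (I : LinearMap.BilinForm ℝ F) (R : Set F) : Prop where
  nonempty : R.Nonempty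
  discrete : DiscreteTopology R
  lattice_discrete : DiscreteTopology (rootLattice R)
  lattice_full : Submodule.span ℝ (rootLattice R : Set F) = ⊤
  nonisotropic : ∀ α ∈ R, I α α ≠ 0
  integral : ∀ α ∈ R, ∀ β ∈ R, ∃ k : ℤ, I (coroot I α) β = k
  refl_image : ∀ α ∈ R, refl I α '' R = R
  irreducible : ∀ R₁ R₂ : Set F, R₁ ∪ R₂ = R → (∀ α ∈ R₁, ∀ β ∈ R₂, I α β = 0) →
    R₁ = ∅ ∨ R₂ = ∅

/-- A (one-dimensional) marking of `R`: a line `G` in the radical of `I` in which `G ∩ Q(R)`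
is full. -/
structure IsMarking (I : LinearMap.BilinForm ℝ F) (R : Set F) (G : Submodule ℝ F) : Prop where
  le_rad : G ≤ LinearMap.ker I
  finrank_eq : Module.finrank ℝ G = 1
  full : Submodule.span ℝ ((G : Set F) ∩ (rootLattice R : Set F)) = G

/-- `(R, G)` is a marked elliptic root system belonging to `F` with the symmetric bilinear form `I`
of signature `(l, 2, 0)`. -/
structure IsMarkedElliptic (l : ℕ) (I : LinearMap.BilinForm ℝ F) (R : Set F)
    (G : Submodule ℝ F) : Prop where
  symm : ∀ x y, I x y = I y x
  signature : HasSignature I l 2 0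
  rootSystem : IsGeneralizedRootSystem I R
  marking : IsMarking I R G

/-- `R` is reduced: for `α ∈ R` neither `2α` nor `α/2` belongs to `R`. -/
def IsReduced (R : Set F) : Prop :=
  ∀ α ∈ R, (2 : ℝ) • α ∉ R ∧ (1 / 2 : ℝ) • α ∉ R

/-- Isomorphism of pairs `(R, G)`: a linear isomorphism of the ambient spaces that carries `R` onto
`R'` and `G` onto `G'`. -/
def MarkedIso (R : Set F) (G : Submodule ℝ F) (R' : Set F') (G' : Submodule ℝ F') : Prop :=
  ∃ e : F ≃ₗ[ℝ] F', e '' R = R' ∧ e '' (G : Set F) = (G' : Set F')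

/-- Isomorphism of pairs `(R, G)` that moreover respects the forms up to a positive factor. -/
def MarkedSimilar (I : LinearMap.BilinForm ℝ F) (R : Set F) (G : Submodule ℝ F)
    (I' : LinearMap.BilinForm ℝ F') (R' : Set F') (G' : Submodule ℝ F') : Prop :=
  ∃ e : F ≃ₗ[ℝ] F', e '' R = R' ∧ e '' (G : Set F) = (G' : Set F') ∧
    ∃ c : ℝ, 0 < c ∧ ∀ x y, I' (e x) (e y) = c * I x y

/-- The quotient root system `R/G`: the image of `R` in `F/G`. -/
def quotientRoots (R : Set F) (G : Submodule ℝ F) : Set (F ⧸ G) := G.mkQ '' R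

end General

/-! ### The finite root system `BC_l` -/

/-- The short roots `±ε_i` of `BC_l`. -/
def shortBC (l : ℕ) : Set (Fin l → ℝ) :=
  {v | ∃ i, v = Pi.single i 1 ∨ v = -Pi.single i 1}

/-- The middle length roots `±(ε_i ± ε_j)`, `i < j`, of `BC_l`. -/
def middleBC (l : ℕ) : Set (Fin l → ℝ) :=
  {v | ∃ i j, i < j ∧
    (v = Pi.single i 1 + Pi.single j 1 ∨ v = -(Pi.single i 1 + Pi.single j 1) ∨
     v = Pi.single i 1 - Pi.single j 1 ∨ v = -(Pi.single i 1 - Pi.single j 1))}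

/-- The long roots `±2ε_i` of `BC_l`. -/
def longBC (l : ℕ) : Set (Fin l → ℝ) :=
  {v | ∃ i, v = (2 : ℝ) • Pi.single i 1 ∨ v = -((2 : ℝ) • Pi.single i 1)}

/-! ### The four non-reduced affine root systems -/

/-- The names `BCC_l`, `C^∨BC_l`, `BB_l^∨`, `C^∨C_l`. -/
inductive AffineType
  | BCC
  | CvBC
  | BBv
  | CvC

/-- The middle roots of `R(X_l)` are `R(BC_l)_m + (X.middle) ℤ b`. -/
def AffineType.middle : AffineType → ℤ
  | .BCC => 1
  | .CvBC => 2
  | .BBv => 1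
  | .CvC => 2

/-- The long roots of `R(X_l)` are `R(BC_l)_l + (X.long) ℤ b`. -/
def AffineType.long : AffineType → ℤ
  | .BCC => 1
  | .CvBC => 4
  | .BBv => 2
  | .CvC => 2

/-- `R(X_l)` in `ℝ^l ⊕ ℝ b`; the short roots are `R(BC_l)_s + ℤ b`. -/
def AffineType.roots (X : AffineType) (l : ℕ) : Set ((Fin l → ℝ) × ℝ) :=
  {v | v.1 ∈ shortBC l ∧ ∃ n : ℤ, v.2 = n} ∪
  {v | v.1 ∈ middleBC l ∧ ∃ n : ℤ, X.middle ∣ n ∧ v.2 = n} ∪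
  {v | v.1 ∈ longBC l ∧ ∃ n : ℤ, X.long ∣ n ∧ v.2 = n}

/-! ### The standard space `ℝ^l ⊕ ℝ a ⊕ ℝ b` -/

/-- `(x, (p, q))` stands for `∑ x_i ε_i + p a + q b`. -/
abbrev Space (l : ℕ) : Type := (Fin l → ℝ) × (ℝ × ℝ)

/-- The form with `I(ε_i, ε_j) = δ_{ij}` and radical `ℝ a ⊕ ℝ b`. -/
noncomputable def form (l : ℕ) : LinearMap.BilinForm ℝ (Space l) :=
  LinearMap.mk₂ ℝ (fun x y => ∑ i, x.1 i * y.1 i)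
    (fun x y z => by simp [add_mul, Finset.sum_add_distrib])
    (fun c x y => by simp [Finset.mul_sum, mul_assoc])
    (fun x y z => by simp [mul_add, Finset.sum_add_distrib])
    (fun c x y => by simp [Finset.mul_sum, mul_left_comm])

/-- The vector `a`. -/
def vecA (l : ℕ) : Space l := (0, (1, 0))

/-- The marking `G = ℝ a`. -/
def lineA (l : ℕ) : Submodule ℝ (Space l) := Submodule.span ℝ {vecA l}

/-- `(R(BC_l)_s + S) ∪ (R(BC_l)_m + M) ∪ (R(BC_l)_l + E)` for subsets `S, M, E` of
`ℤ a ⊕ ℤ b`; the pair `(m, n)` stands for `m a + n b`. -/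
def rootsOf (l : ℕ) (S M E : Set (ℤ × ℤ)) : Set (Space l) :=
  {v | v.1 ∈ shortBC l ∧ ∃ p ∈ S, v.2 = ((p.1 : ℝ), (p.2 : ℝ))} ∪
  {v | v.1 ∈ middleBC l ∧ ∃ p ∈ M, v.2 = ((p.1 : ℝ), (p.2 : ℝ))} ∪
  {v | v.1 ∈ longBC l ∧ ∃ p ∈ E, v.2 = ((p.1 : ℝ), (p.2 : ℝ))}

/-- The lattice `i ℤ a + j ℤ b`. -/
def lat (i j : ℤ) : Set (ℤ × ℤ) := {p | i ∣ p.1 ∧ j ∣ p.2}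

/-- `L_{i,j}^{s₁,s₂} = { s₂ m a + s₁ n b | (m - i)(n - j) even }`. -/
def starSet (i j s₁ s₂ : ℤ) : Set (ℤ × ℤ) :=
  {p | ∃ m n : ℤ, Even ((m - i) * (n - j)) ∧ p = (s₂ * m, s₁ * n)}

/-- `{ m a + 2 n b | m - n even }`. -/
def diamondSet : Set (ℤ × ℤ) := {p | ∃ m n : ℤ, Even (m - n) ∧ p = (m, 2 * n)}

/-! ### The list of types -/

/-- The superscripts `(1)`, `(2)(1)`, `(2)(2)`, `(4)` of the classical types. -/
inductive ClassicalKind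
  | one
  | twoOne
  | twoTwo
  | four

/-- The types of the list: the 16 classical types `X^{(1)}`, `X^{(2)}(1)`, `X^{(2)}(2)`, `X^{(4)}`
and 19 further ones; for example `CvC2star1'` stands for `C^∨C_l^{(2)∗_{1'}}`. -/
inductive EllipticType
  | classical (X : AffineType) (k : ClassicalKind)
  | BCC1star0
  | BCC1star0'
  | BCC2star0
  | BCC2star1
  | CvBC2star0
  | CvBC2star1
  | CvBC4star0
  | CvBC4star0'
  | BBv2star
  | CvC1star0
  | CvC1star1
  | CvC2starS
  | CvC2starL
  | CvC2star0
  | CvC2star1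
  | CvC2star1'
  | CvC2diamond
  | CvC4star0
  | CvC4star1

namespace EllipticType

/-- The affine type under which a type is listed. -/
def quotient : EllipticType → AffineType
  | classical X _ => X
  | BCC1star0 | BCC1star0' | BCC2star0 | BCC2star1 => .BCC
  | CvBC2star0 | CvBC2star1 | CvBC4star0 | CvBC4star0' => .CvBC
  | BBv2star => .BBv
  | CvC1star0 | CvC1star1 | CvC2starS | CvC2starL | CvC2star0 | CvC2star1 | CvC2star1'
  | CvC2diamond | CvC4star0 | CvC4star1 => .CvC

/-- The ranks `l` for which a type occurs in the list. -/
def Admissible : EllipticType → ℕ → Prop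
  | classical .BBv _, l => 2 ≤ l
  | classical _ .twoOne, l => 2 ≤ l
  | BBv2star, l => l = 2
  | _, l => 1 ≤ l

/-- The subset `S` of `ℤ a ⊕ ℤ b` with `R_s = R(BC_l)_s + S`. -/
def shortSet : EllipticType → Set (ℤ × ℤ)
  | classical _ _ => lat 1 1
  | BCC1star0 | BCC1star0' | BCC2star0 | BCC2star1 => lat 1 1
  | CvBC2star0 => starSet 0 0 1 1
  | CvBC2star1 => starSet 1 1 1 1
  | CvBC4star0 => starSet 0 0 1 1
  | CvBC4star0' => starSet 0 1 1 1
  | BBv2star => lat 1 1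
  | CvC1star0 | CvC1star1 => lat 1 1
  | CvC2starS => starSet 0 0 1 1
  | CvC2starL => lat 1 1
  | CvC2star0 | CvC2star1 | CvC2star1' => starSet 0 0 1 1
  | CvC2diamond => lat 1 1
  | CvC4star0 => starSet 0 0 1 1
  | CvC4star1 => starSet 1 1 1 1

/-- The subset `M` of `ℤ a ⊕ ℤ b` with `R_m = R(BC_l)_m + M`. -/
def middleSet : EllipticType → Set (ℤ × ℤ)
  | classical X .one => lat 1 X.middle
  | classical X .twoOne => lat 1 X.middle
  | classical X .twoTwo => lat 2 X.middle
  | classical X .four => lat 2 X.middle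
  | BCC1star0 | BCC1star0' => lat 1 1
  | BCC2star0 | BCC2star1 => lat 2 1
  | CvBC2star0 | CvBC2star1 | CvBC4star0 | CvBC4star0' => lat 2 2
  | BBv2star => starSet 0 0 1 1
  | CvC1star0 | CvC1star1 => lat 1 2
  | CvC2starS | CvC2starL | CvC2star0 | CvC2star1 | CvC2star1' => lat 2 2
  | CvC2diamond => lat 1 2
  | CvC4star0 | CvC4star1 => lat 2 2

/-- The subset `E` of `ℤ a ⊕ ℤ b` with `R_l = R(BC_l)_l + E`. -/
def longSet : EllipticType → Set (ℤ × ℤ)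
  | classical X .one => lat 1 X.long
  | classical X .twoOne => lat 2 X.long
  | classical X .twoTwo => lat 2 X.long
  | classical X .four => lat 4 X.long
  | BCC1star0 => starSet 0 0 1 1
  | BCC1star0' => starSet 0 1 1 1
  | BCC2star0 => starSet 0 0 1 2
  | BCC2star1 => starSet 1 1 1 2
  | CvBC2star0 | CvBC2star1 => lat 2 4
  | CvBC4star0 | CvBC4star0' => lat 4 4
  | BBv2star => lat 2 2
  | CvC1star0 => starSet 0 0 2 1
  | CvC1star1 => starSet 1 1 2 1
  | CvC2starS => lat 2 2
  | CvC2starL => starSet 0 0 2 2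
  | CvC2star0 => starSet 0 0 2 2
  | CvC2star1 => starSet 1 1 2 2
  | CvC2star1' => starSet 1 0 2 2
  | CvC2diamond => diamondSet
  | CvC4star0 | CvC4star1 => lat 4 2

/-- The standard root system of the given type in `ℝ^l ⊕ ℝ a ⊕ ℝ b`. -/
def roots (t : EllipticType) (l : ℕ) : Set (Space l) :=
  rootsOf l t.shortSet t.middleSet t.longSet

end EllipticType

end MERS

/-! Modulo the radical the roots form an irreducible crystallographic set `Δ` in Euclidean
`l`-space. As `R` is not reduced, some root `α₀` has `2α₀ ∈ R`. Call a vector of `Δ` a half root if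
its double is also in `Δ`. Integrality against the doubled vector is so strong that two half roots
are orthogonal or equal up to sign, and that a vector of `Δ` not orthogonal to a half root `α` is
`±α`, `±2α` or `±(α - δ)` with a half root `δ ⊥ α` of the same length. Irreducibility then gives an
orthogonal basis of half roots, with `Δ` inside `BC_l` (`IsCrystallographic.exists_frame`).

Lift this basis to `F` so that the vectors `ε_{i₀}`, `2ε_{i₀}`, `ε_{i₀} - ε_i` are roots, and choose
a basis `a, b` of the lattice `Q(R) ∩ rad I` with `a` on the marking. Reflections in these roots do
not change translation parts, so `R` is given by three sets `S, M, E ⊂ Λ`, one per length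
(`IsFramed`). The other reflections give the closure rules `ReflClosed`, and `S` generates `Λ`.

If `M` is a group, it lies between `2Λ` and `Λ`, `S` is a union of cosets of `M`, and `E ⊂ M` is a
union of cosets of `2M ⊃ 4Λ`. Only finitely many triples remain, all visible modulo `4`;
`search_mod` finds for each a shear fixing `a` and a shift of the frame that lead to the list. If
`M` is not a group, then `l = 2`, `M` consists of three of the four classes modulo `2Λ`, and the
type is `BBv2star`. In rank one there are no middle roots, and the group generated by `E` and `2Λ`
takes the place of `M`.

For uniqueness, a linear isomorphism of pairs respects the radical, because roots are bounded modulo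
the radical, and it respects short roots, because these are the halves of roots. Hence it acts on
translation sets by affine maps `(m, n) ↦ (± m + k n, ± n) + ξ`. Numbers of pairs of classes modulo
`4` in the same row `n = const` are invariant under such maps and separate the types
(`eq_of_affine_equiv`, `eq_of_markedIso`). -/

namespace MERS

/-! ### The list of types modulo `4` -/

/-- The residue class modulo `4` of an element of the lattice `ℤ a ⊕ ℤ b`. -/
def residue (p : ℤ × ℤ) : ZMod 4 × ZMod 4 := ((p.1 : ZMod 4), (p.2 : ZMod 4))

/-- The residue classes of `lat i j`. -/
def latMod (i j : ℕ) (p : ZMod 4 × ZMod 4) : Bool :=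
  p.1.val % i == 0 && p.2.val % j == 0

/-- The residue classes of `starSet i j s₁ s₂`. -/
def starMod (i j s₁ s₂ : ℕ) (p : ZMod 4 × ZMod 4) : Bool :=
  -- The sums stand for the differences `m - i` and `n - j`: the parity is the same, and subtraction
  -- in `ℕ` would truncate. The parity of `m = p.1 / s₂` is determined modulo `4` because `s₂ ≤ 2`
  -- in all uses.
  p.1.val % s₂ == 0 && p.2.val % s₁ == 0 && (p.1.val / s₂ + i) * (p.2.val / s₁ + j) % 2 == 0

/-- The residue classes of `diamondSet`. -/
def diamondMod (p : ZMod 4 × ZMod 4) : Bool :=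
  p.2.val % 2 == 0 && (p.1.val + p.2.val / 2) % 2 == 0

theorem val_intCast_four (n : ℤ) : (((n : ZMod 4).val : ℕ) : ℤ) = n % 4 := by
  rw [ZMod.val_intCast]; rfl

theorem intCast_dvd_iff_val {i : ℕ} (hi : i = 1 ∨ i = 2 ∨ i = 4) (n : ℤ) :
    (i : ℤ) ∣ n ↔ (n : ZMod 4).val % i = 0 := by
  have h := val_intCast_four n
  rcases hi with rfl | rfl | rfl <;> omega

theorem mem_lat_iff {i j : ℕ} (hi : i = 1 ∨ i = 2 ∨ i = 4) (hj : j = 1 ∨ j = 2 ∨ j = 4)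
    (p : ℤ × ℤ) : p ∈ lat i j ↔ latMod i j (residue p) = true := by
  simp [lat, latMod, residue, intCast_dvd_iff_val hi, intCast_dvd_iff_val hj]

theorem mem_starSet_iff_dvd {i j s₁ s₂ : ℤ} (h₁ : s₁ ≠ 0) (h₂ : s₂ ≠ 0) (p : ℤ × ℤ) :
    p ∈ starSet i j s₁ s₂ ↔
      s₂ ∣ p.1 ∧ s₁ ∣ p.2 ∧ Even ((p.1 / s₂ - i) * (p.2 / s₁ - j)) := by
  constructor
  · rintro ⟨m, n, h, rfl⟩
    simpa [h₁, h₂] using h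
  · rintro ⟨⟨m, hm⟩, ⟨n, hn⟩, h⟩
    refine ⟨m, n, ?_, Prod.ext hm hn⟩
    simpa [hm, hn, h₁, h₂] using h

theorem even_sub_iff_val_div {s : ℕ} (hs : s = 1 ∨ s = 2) (i : ℕ) (n : ℤ) :
    Even (n / s - i) ↔ Even ((n : ZMod 4).val / s + i) := by
  have h := val_intCast_four n
  rw [Int.even_iff, Nat.even_iff]
  rcases hs with rfl | rfl <;> omega

theorem mem_starSet_iff {s₁ s₂ : ℕ} (h₁ : s₁ = 1 ∨ s₁ = 2) (h₂ : s₂ = 1 ∨ s₂ = 2) (i j : ℕ)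
    (p : ℤ × ℤ) : p ∈ starSet i j s₁ s₂ ↔ starMod i j s₁ s₂ (residue p) = true := by
  rw [mem_starSet_iff_dvd (by omega) (by omega), intCast_dvd_iff_val (by omega),
    intCast_dvd_iff_val (by omega), Int.even_mul, even_sub_iff_val_div h₂,
    even_sub_iff_val_div h₁, ← Nat.even_mul, Nat.even_iff]
  simp [starMod, residue, and_assoc]

theorem mem_diamondSet_iff (p : ℤ × ℤ) : p ∈ diamondSet ↔ diamondMod (residue p) = true := by
  have h₁ := val_intCast_four p.1
  have h₂ := val_intCast_four p.2
  simp only [diamondMod, residue, Bool.and_eq_true, beq_iff_eq]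
  constructor
  · rintro ⟨m, n, h, hp⟩
    rw [Int.even_iff] at h
    simp only [hp] at h₁ h₂ ⊢
    omega
  · rintro ⟨h, h'⟩
    refine ⟨p.1, p.2 / 2, ?_, Prod.ext rfl ?_⟩
    · rw [Int.even_iff]; omega
    · change p.2 = 2 * (p.2 / 2); omega

namespace EllipticType

/-- The residue classes of `shortSet`. -/
def shortMod : EllipticType → ZMod 4 × ZMod 4 → Bool
  | CvBC2star0 | CvBC4star0 | CvC2starS | CvC2star0 | CvC2star1 | CvC2star1' | CvC4star0 =>
    starMod 0 0 1 1
  | CvBC2star1 | CvC4star1 => starMod 1 1 1 1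
  | CvBC4star0' => starMod 0 1 1 1
  | _ => latMod 1 1

/-- The residue classes of `middleSet`. -/
def middleMod : EllipticType → ZMod 4 × ZMod 4 → Bool
  | classical X .one | classical X .twoOne => latMod 1 X.middle.natAbs
  | classical X .twoTwo | classical X .four => latMod 2 X.middle.natAbs
  | BCC1star0 | BCC1star0' => latMod 1 1
  | BCC2star0 | BCC2star1 => latMod 2 1
  | BBv2star => starMod 0 0 1 1
  | CvC1star0 | CvC1star1 | CvC2diamond => latMod 1 2
  | _ => latMod 2 2

/-- The residue classes of `longSet`. -/
def longMod : EllipticType → ZMod 4 × ZMod 4 → Bool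
  | classical X .one => latMod 1 X.long.natAbs
  | classical X .twoOne | classical X .twoTwo => latMod 2 X.long.natAbs
  | classical X .four => latMod 4 X.long.natAbs
  | BCC1star0 => starMod 0 0 1 1
  | BCC1star0' => starMod 0 1 1 1
  | BCC2star0 => starMod 0 0 1 2
  | BCC2star1 => starMod 1 1 1 2
  | CvBC2star0 | CvBC2star1 => latMod 2 4
  | CvBC4star0 | CvBC4star0' => latMod 4 4
  | BBv2star | CvC2starS => latMod 2 2
  | CvC1star0 => starMod 0 0 2 1
  | CvC1star1 => starMod 1 1 2 1
  | CvC2starL | CvC2star0 => starMod 0 0 2 2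
  | CvC2star1 => starMod 1 1 2 2
  | CvC2star1' => starMod 1 0 2 2
  | CvC2diamond => diamondMod
  | CvC4star0 | CvC4star1 => latMod 4 2

/-- All sets of the list are unions of cosets of `4Λ`. This lemma and its two companions turn
statements about the list into finite checks over `(ℤ / 4)²`. -/
theorem mem_shortSet_iff (t : EllipticType) (p : ℤ × ℤ) :
    p ∈ t.shortSet ↔ t.shortMod (residue p) = true := by
  cases t
  all_goals first
    | exact mem_lat_iff (i := 1) (j := 1) (by decide) (by decide) p
    | exact mem_starSet_iff (s₁ := 1) (s₂ := 1) (by decide) (by decide) 0 0 p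
    | exact mem_starSet_iff (s₁ := 1) (s₂ := 1) (by decide) (by decide) 1 1 p
    | exact mem_starSet_iff (s₁ := 1) (s₂ := 1) (by decide) (by decide) 0 1 p

theorem mem_middleSet_iff (t : EllipticType) (p : ℤ × ℤ) :
    p ∈ t.middleSet ↔ t.middleMod (residue p) = true := by
  rcases t with ⟨X, k⟩ | _
  · cases X <;> cases k <;> exact mem_lat_iff (by decide) (by decide) p
  all_goals first
    | exact mem_lat_iff (by decide) (by decide) p
    | exact mem_starSet_iff (s₁ := 1) (s₂ := 1) (by decide) (by decide) 0 0 p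

theorem mem_longSet_iff (t : EllipticType) (p : ℤ × ℤ) :
    p ∈ t.longSet ↔ t.longMod (residue p) = true := by
  rcases t with ⟨X, k⟩ | _
  · cases X <;> cases k <;> exact mem_lat_iff (by decide) (by decide) p
  all_goals first
    | exact mem_lat_iff (by decide) (by decide) p
    | exact mem_starSet_iff (by decide) (by decide) _ _ p
    | exact mem_diamondSet_iff p

/-- The types in the order of the list. -/
def list : List EllipticType :=
  [classical .BCC .one, classical .BCC .twoOne, classical .BCC .twoTwo, classical .BCC .four,
    classical .CvBC .one, classical .CvBC .twoOne, classical .CvBC .twoTwo, classical .CvBC .four,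
    classical .BBv .one, classical .BBv .twoOne, classical .BBv .twoTwo, classical .BBv .four,
    classical .CvC .one, classical .CvC .twoOne, classical .CvC .twoTwo, classical .CvC .four,
    BCC1star0, BCC1star0', BCC2star0, BCC2star1, CvBC2star0, CvBC2star1, CvBC4star0, CvBC4star0',
    BBv2star, CvC1star0, CvC1star1, CvC2starS, CvC2starL, CvC2star0, CvC2star1, CvC2star1',
    CvC2diamond, CvC4star0, CvC4star1]

theorem mem_list (t : EllipticType) : t ∈ list := by
  rcases t with ⟨X, k⟩ | _
  · cases X <;> cases k <;> simp [list]
  all_goals simp [list]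

theorem nodup_list : list.Nodup := by
  simp [list]

theorem natCard_eq : Nat.card EllipticType = 35 := by
  classical
  have : Fintype EllipticType := ⟨⟨(list : Multiset EllipticType), nodup_list⟩, mem_list⟩
  rw [Nat.card_eq_fintype_card]
  have h : (Finset.univ : Finset EllipticType) = ⟨(list : Multiset EllipticType), nodup_list⟩ :=
    Finset.ext fun t => by
      simp only [Finset.mem_univ, true_iff]
      exact mem_list t
  rw [← Finset.card_univ, h]
  rfl

end EllipticType
end MERS

/-! ### Closure of the listed translation sets under reflections. -/

namespace MERS

/-- The closure properties of translation sets under which `rootsOf l S M E` is closed under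
its reflections. -/
structure ReflClosed (l : ℕ) (S M E : Set (ℤ × ℤ)) : Prop where
  neg_short : ∀ x ∈ S, -x ∈ S
  neg_middle : ∀ x ∈ M, -x ∈ M
  neg_long : ∀ x ∈ E, -x ∈ E
  -- In each name the reflecting root comes first. The coefficient is the absolute value of a
  -- nonzero Cartan integer between roots of these lengths in `BC_l`; it is `4` for `2ε_i` reflected
  -- in `ε_i`.
  short_short : ∀ x ∈ S, ∀ y ∈ S, y - (2 : ℤ) • x ∈ S
  short_middle : ∀ x ∈ S, ∀ y ∈ M, y - (2 : ℤ) • x ∈ M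
  short_long : ∀ x ∈ S, ∀ y ∈ E, y - (4 : ℤ) • x ∈ E
  middle_short : ∀ x ∈ M, ∀ y ∈ S, y - x ∈ S
  middle_middle : ∀ x ∈ M, ∀ y ∈ M, y - (2 : ℤ) • x ∈ M
  -- Cartan integer `±1` between middle roots, as for `ε_1 - ε_2` and `ε_1 - ε_3`, needs three
  -- indices. For `l = 2` middle roots are orthogonal or parallel modulo the radical.
  middle_middle_sub : 3 ≤ l → ∀ x ∈ M, ∀ y ∈ M, y - x ∈ M
  middle_long : ∀ x ∈ M, ∀ y ∈ E, y - (2 : ℤ) • x ∈ E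
  long_short : ∀ x ∈ E, ∀ y ∈ S, y - x ∈ S
  long_middle : ∀ x ∈ E, ∀ y ∈ M, y - x ∈ M
  long_long : ∀ x ∈ E, ∀ y ∈ E, y - (2 : ℤ) • x ∈ E

theorem residue_neg (x : ℤ × ℤ) : residue (-x) = -residue x := by simp [residue]

theorem residue_add (x y : ℤ × ℤ) : residue (x + y) = residue x + residue y := by simp [residue]

theorem residue_sub (x y : ℤ × ℤ) : residue (x - y) = residue x - residue y := by simp [residue]

theorem residue_two_smul (x : ℤ × ℤ) : residue ((2 : ℤ) • x) = residue x + residue x := by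
  rw [two_smul, residue_add]

theorem residue_four_smul (x : ℤ × ℤ) : residue ((4 : ℤ) • x) = 0 := by
  have h : (4 : ZMod 4) = 0 := rfl
  simp [residue, h]

theorem residue_surjective : Function.Surjective residue := fun p =>
  ⟨(p.1.val, p.2.val), by simp [residue]⟩

namespace EllipticType

/-- The rule `short_long` needs no check since `4 • x` vanishes modulo `4`. The rule
`middle_middle_sub` is absent because it fails for `BBv2star`; all other types have a lattice as
middle set. -/
theorem closed_mod : ∀ t ∈ list, ∀ x y : ZMod 4 × ZMod 4,
    (t.shortMod x → t.shortMod (-x) ∧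
      (t.shortMod y → t.shortMod (y - (x + x))) ∧ (t.middleMod y → t.middleMod (y - (x + x)))) ∧
    (t.middleMod x → t.middleMod (-x) ∧ (t.shortMod y → t.shortMod (y - x)) ∧
      (t.middleMod y → t.middleMod (y - (x + x))) ∧ (t.longMod y → t.longMod (y - (x + x)))) ∧
    (t.longMod x → t.longMod (-x) ∧ (t.shortMod y → t.shortMod (y - x)) ∧
      (t.middleMod y → t.middleMod (y - x)) ∧ (t.longMod y → t.longMod (y - (x + x)))) := by
  decide +kernel

theorem exists_middleSet_eq_lat (t : EllipticType) :
    t = BBv2star ∨ ∃ i j, t.middleSet = lat i j := by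
  rcases t with ⟨X, k⟩ | _
  · cases k <;> exact Or.inr ⟨_, _, rfl⟩
  all_goals first | exact Or.inl rfl | exact Or.inr ⟨_, _, rfl⟩

theorem one_le_of_admissible {t : EllipticType} {l : ℕ} (h : t.Admissible l) : 1 ≤ l := by
  rcases t with ⟨X, k⟩ | _
  · cases X <;> cases k <;> simp only [Admissible] at h <;> omega
  all_goals simp only [Admissible] at h; omega

theorem reflClosed {t : EllipticType} {l : ℕ} (h : t.Admissible l) :
    ReflClosed l t.shortSet t.middleSet t.longSet := by
  have key := closed_mod t t.mem_list
  constructor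
  all_goals try simp only [mem_shortSet_iff, mem_middleSet_iff, mem_longSet_iff, residue_neg,
    residue_sub, residue_two_smul, residue_four_smul, sub_zero]
  · exact fun x hx => ((key _ 0).1 hx).1
  · exact fun x hx => ((key _ 0).2.1 hx).1
  · exact fun x hx => ((key _ 0).2.2 hx).1
  · exact fun x hx y hy => ((key _ _).1 hx).2.1 hy
  · exact fun x hx y hy => ((key _ _).1 hx).2.2 hy
  · exact fun _ _ _ hy => hy
  · exact fun x hx y hy => ((key _ _).2.1 hx).2.1 hy
  · exact fun x hx y hy => ((key _ _).2.1 hx).2.2.1 hy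
  · intro hl x hx y hy
    rw [← residue_sub, ← mem_middleSet_iff]
    rw [← mem_middleSet_iff] at hx hy
    obtain rfl | ⟨i, j, hij⟩ := exists_middleSet_eq_lat t
    · change l = 2 at h
      omega
    · rw [hij] at hx hy ⊢
      exact ⟨dvd_sub hy.1 hx.1, dvd_sub hy.2 hx.2⟩
  · exact fun x hx y hy => ((key _ _).2.1 hx).2.2.2 hy
  · exact fun x hx y hy => ((key _ _).2.2 hx).2.1 hy
  · exact fun x hx y hy => ((key _ _).2.2 hx).2.2.1 hy
  · exact fun x hx y hy => ((key _ _).2.2 hx).2.2.2 hy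

/-- Everything about the list that needs a witness: short translations differing by `a` or by `b`,
which put `a` and `b` into the root lattice; a short root whose double is a root; and the
projections of `S, M, E` to the coordinate of `b`, which determine the quotient `R/G`. -/
theorem points_mod : ∀ t ∈ list,
    (∃ x, t.shortMod x ∧ t.shortMod (x + (1, 0))) ∧ (∃ x, t.shortMod x ∧ t.shortMod (x + (0, 1))) ∧
    (∃ x, t.middleMod x) ∧ (∃ x, t.shortMod x ∧ t.longMod (x + x)) ∧
    ∀ y, (∃ x, t.shortMod (x, y)) ∧
      ((∃ x, t.middleMod (x, y)) ↔ y.val % t.quotient.middle.natAbs = 0) ∧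
      ((∃ x, t.longMod (x, y)) ↔ y.val % t.quotient.long.natAbs = 0) := by
  decide +kernel

theorem exists_short_add_a (t : EllipticType) : ∃ p ∈ t.shortSet, p + (1, 0) ∈ t.shortSet := by
  obtain ⟨x, h₁, h₂⟩ := (points_mod t t.mem_list).1
  obtain ⟨p, rfl⟩ := residue_surjective x
  exact ⟨p, (mem_shortSet_iff _ _).2 h₁, (mem_shortSet_iff _ _).2 (by
    rw [residue_add]; simpa [residue] using h₂)⟩

theorem exists_short_add_b (t : EllipticType) : ∃ p ∈ t.shortSet, p + (0, 1) ∈ t.shortSet := by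
  obtain ⟨x, h₁, h₂⟩ := (points_mod t t.mem_list).2.1
  obtain ⟨p, rfl⟩ := residue_surjective x
  exact ⟨p, (mem_shortSet_iff _ _).2 h₁, (mem_shortSet_iff _ _).2 (by
    rw [residue_add]; simpa [residue] using h₂)⟩

theorem middleSet_nonempty (t : EllipticType) : t.middleSet.Nonempty := by
  obtain ⟨x, h⟩ := (points_mod t t.mem_list).2.2.1
  obtain ⟨p, rfl⟩ := residue_surjective x
  exact ⟨p, (mem_middleSet_iff _ _).2 h⟩

theorem exists_two_smul_mem (t : EllipticType) : ∃ p ∈ t.shortSet, (2 : ℤ) • p ∈ t.longSet := by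
  obtain ⟨x, h₁, h₂⟩ := (points_mod t t.mem_list).2.2.2.1
  obtain ⟨p, rfl⟩ := residue_surjective x
  exact ⟨p, (mem_shortSet_iff _ _).2 h₁, (mem_longSet_iff _ _).2 (by rwa [residue_two_smul])⟩

theorem exists_fst_mem_short (t : EllipticType) (n : ℤ) : ∃ m, (m, n) ∈ t.shortSet := by
  obtain ⟨x, h⟩ := ((points_mod t t.mem_list).2.2.2.2 (n : ZMod 4)).1
  refine ⟨x.val, (mem_shortSet_iff _ _).2 ?_⟩
  simpa [residue] using h

theorem exists_fst_mem_middle_iff (t : EllipticType) (n : ℤ) :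
    (∃ m, (m, n) ∈ t.middleSet) ↔ t.quotient.middle ∣ n := by
  have hX : ((t.quotient.middle.natAbs : ℕ) : ℤ) = t.quotient.middle ∧
      (t.quotient.middle.natAbs = 1 ∨ t.quotient.middle.natAbs = 2 ∨
        t.quotient.middle.natAbs = 4) := by
    cases t.quotient <;> decide
  rw [← hX.1, intCast_dvd_iff_val hX.2,
    ← ((points_mod t t.mem_list).2.2.2.2 (n : ZMod 4)).2.1]
  simp only [mem_middleSet_iff]
  exact ⟨fun ⟨m, h⟩ => ⟨m, h⟩, fun ⟨x, h⟩ => ⟨x.val, by simpa [residue] using h⟩⟩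

theorem exists_fst_mem_long_iff (t : EllipticType) (n : ℤ) :
    (∃ m, (m, n) ∈ t.longSet) ↔ t.quotient.long ∣ n := by
  have hX : ((t.quotient.long.natAbs : ℕ) : ℤ) = t.quotient.long ∧
      (t.quotient.long.natAbs = 1 ∨ t.quotient.long.natAbs = 2 ∨
        t.quotient.long.natAbs = 4) := by
    cases t.quotient <;> decide
  rw [← hX.1, intCast_dvd_iff_val hX.2,
    ← ((points_mod t t.mem_list).2.2.2.2 (n : ZMod 4)).2.2]
  simp only [mem_longSet_iff]
  exact ⟨fun ⟨m, h⟩ => ⟨m, h⟩, fun ⟨x, h⟩ => ⟨x.val, by simpa [residue] using h⟩⟩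

end EllipticType
end MERS

namespace MERS

/-! ### Invariants -/

/-- The number of pairs of residue classes in `X × Y` with the same coefficient of `b`. -/
def pairCount (X Y : ZMod 4 × ZMod 4 → Bool) : ℕ :=
  (Finset.univ.filter fun q : ZMod 4 × ZMod 4 × ZMod 4 =>
    X (q.1, q.2.2) = true ∧ Y (q.2.1, q.2.2) = true).card

/-- The affine map `p ↦ (c m + k n, d n) + ξ` for `p = (m, n)`. -/
def affineMod (c d k : ZMod 4) (ξ p : ZMod 4 × ZMod 4) : ZMod 4 × ZMod 4 :=
  (c * p.1 + k * p.2 + ξ.1, d * p.2 + ξ.2)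

theorem affineMod_surjective {c d : ZMod 4} (hc : c * c = 1) (hd : d * d = 1)
    (k : ZMod 4) (ξ : ZMod 4 × ZMod 4) : Function.Surjective (affineMod c d k ξ) := by
  intro p
  refine ⟨(c * (p.1 - k * (d * (p.2 - ξ.2)) - ξ.1), d * (p.2 - ξ.2)), ?_⟩
  simp only [affineMod, ← mul_assoc, hc, hd, one_mul]
  ext <;> ring_nf

theorem affineMod_two {c d k : ZMod 4} (ξ p : ZMod 4 × ZMod 4) :
    affineMod c d k (ξ + ξ) (p + p) = affineMod c d k ξ p + affineMod c d k ξ p := by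
  simp only [affineMod]
  ext <;> simp <;> ring

/-- The affine map permutes the rows `n = const` and acts on each row by one bijection, so it acts
on pairs within a row. Plain cardinalities would not see the direction of the marking. -/
theorem pairCount_eq {c d : ZMod 4} (hc : c * c = 1) (hd : d * d = 1) (k : ZMod 4)
    (ξ : ZMod 4 × ZMod 4) {X Y X' Y' : ZMod 4 × ZMod 4 → Bool}
    (hX : ∀ p, X p = X' (affineMod c d k ξ p)) (hY : ∀ p, Y p = Y' (affineMod c d k ξ p)) :
    pairCount X Y = pairCount X' Y' := by
  refine Finset.card_bij
    (fun q _ => (c * q.1 + k * q.2.2 + ξ.1, c * q.2.1 + k * q.2.2 + ξ.1, d * q.2.2 + ξ.2))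
    ?_ ?_ ?_
  · intro q hq
    simpa [hX, hY, affineMod] using hq
  · rintro ⟨x, y, z⟩ _ ⟨x', y', z'⟩ _ h
    simp only [Prod.mk.injEq, add_left_inj] at h
    have hz : z = z' := by simpa [← mul_assoc, hd] using congrArg (d * ·) h.2.2
    subst hz
    have hx : x = x' := by simpa [← mul_assoc, hc] using congrArg (c * ·) (add_right_cancel h.1)
    have hy : y = y' := by simpa [← mul_assoc, hc] using congrArg (c * ·) (add_right_cancel h.2.1)
    rw [hx, hy]
  · rintro ⟨x, y, z⟩ hq
    have hz : d * (d * (z - ξ.2)) + ξ.2 = z := by rw [← mul_assoc, hd]; ring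
    have hw : ∀ w, c * (c * (w - k * (d * (z - ξ.2)) - ξ.1)) + k * (d * (z - ξ.2)) + ξ.1 = w := by
      intro w; rw [← mul_assoc, hc]; ring
    refine ⟨(c * (x - k * (d * (z - ξ.2)) - ξ.1), c * (y - k * (d * (z - ξ.2)) - ξ.1),
      d * (z - ξ.2)), ?_, ?_⟩
    · simpa [hX, hY, affineMod, hz, hw] using hq
    · simp only [hz, hw]

/-- Counting invariants of translation sets `S`, `E`. -/
def countsSE (S E : ZMod 4 × ZMod 4 → Bool) : ℕ × ℕ × ℕ × ℕ :=
  -- A change of frame shifts `S` by `ξ` and `E` by `2ξ`. The last two counts use the subsets `{p ∈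
  -- S | 2p ∈ E}` and `E ∩ 2S` modulo `4`, which are compatible with these shifts and record the
  -- relative position of `S` and `E`.
  (pairCount S S, pairCount E E, pairCount S (fun p => S p && E (p + p)),
    pairCount E (fun p => E p && decide (∃ s, S s = true ∧ s + s = p)))

theorem countsSE_eq {c d : ZMod 4} (hc : c * c = 1) (hd : d * d = 1) (k : ZMod 4)
    (ξ : ZMod 4 × ZMod 4) {S E S' E' : ZMod 4 × ZMod 4 → Bool}
    (hS : ∀ p, S p = S' (affineMod c d k ξ p)) (hE : ∀ p, E p = E' (affineMod c d k (ξ + ξ) p)) :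
    countsSE S E = countsSE S' E' := by
  have hinj (η) := Finite.injective_iff_surjective.2 (affineMod_surjective hc hd k η)
  simp only [countsSE, Prod.mk.injEq]
  refine ⟨pairCount_eq hc hd k ξ hS hS, pairCount_eq hc hd k _ hE hE,
    pairCount_eq hc hd k ξ hS fun p => ?_, pairCount_eq hc hd k _ hE fun p => ?_⟩
  · rw [hS, hE, affineMod_two]
  · rw [hE]
    congr 2
    refine propext ⟨?_, ?_⟩
    · rintro ⟨s, hs, rfl⟩
      exact ⟨_, (hS s) ▸ hs, (affineMod_two ξ s).symm⟩
    · rintro ⟨s', hs', h⟩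
      obtain ⟨s, rfl⟩ := affineMod_surjective hc hd k ξ s'
      rw [← affineMod_two] at h
      exact ⟨s, (hS s).trans hs', hinj _ h⟩

namespace EllipticType

/-- The types that occur in rank `1`. -/
def occursInRankOne : EllipticType → Bool
  | classical .BBv _ => false
  | classical _ .twoOne => false
  | BBv2star => false
  | _ => true

theorem admissible_one_iff (t : EllipticType) : t.Admissible 1 ↔ t.occursInRankOne = true := by
  rcases t with ⟨X, k⟩ | _
  · cases X <;> cases k <;> simp [Admissible, occursInRankOne]
  all_goals simp [Admissible, occursInRankOne]

theorem nodup_counts :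
    (list.map fun t => (countsSE t.shortMod t.longMod, pairCount t.middleMod t.middleMod)).Nodup := by
  decide +kernel

/-- Without middle roots `M` gives no invariant. Types that differ only in `M` coincide in rank one,
for instance `X^{(2)}(1)` and `X^{(2)}(2)`, or the types under `BBv` and classical ones under `CvC`;
`occursInRankOne` keeps one of each, and `S` and `E` separate the rest. -/
theorem nodup_counts_rank_one :
    ((list.filter occursInRankOne).map fun t => countsSE t.shortMod t.longMod).Nodup := by
  decide +kernel

end EllipticType
end MERS

namespace MERS

theorem residue_affine (c d k : ℤ) (ξ p : ℤ × ℤ) :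
    residue (c * p.1 + k * p.2 + ξ.1, d * p.2 + ξ.2) = affineMod c d k (residue ξ) (residue p) := by
  simp [residue, affineMod]

namespace EllipticType

/-- These are the affine maps that an isomorphism of pairs induces on translation sets. The shift
`η` of the middle set is independent of `ξ`, because different frame vectors may be shifted
differently. -/
theorem eq_of_affine_equiv {t t' : EllipticType} {l : ℕ} (ht : t.Admissible l)
    (ht' : t'.Admissible l) {c d : ℤ} (hc : c * c = 1) (hd : d * d = 1) (k : ℤ) (ξ η : ℤ × ℤ)
    (hS : ∀ p : ℤ × ℤ, p ∈ t.shortSet ↔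
      (c * p.1 + k * p.2 + ξ.1, d * p.2 + ξ.2) ∈ t'.shortSet)
    (hE : ∀ p : ℤ × ℤ, p ∈ t.longSet ↔
      (c * p.1 + k * p.2 + (ξ + ξ).1, d * p.2 + (ξ + ξ).2) ∈ t'.longSet)
    (hM : 2 ≤ l → ∀ p : ℤ × ℤ, p ∈ t.middleSet ↔
      (c * p.1 + k * p.2 + η.1, d * p.2 + η.2) ∈ t'.middleSet) : t = t' := by
  have hc' : (c : ZMod 4) * c = 1 := by exact_mod_cast congrArg (Int.cast (R := ZMod 4)) hc
  have hd' : (d : ZMod 4) * d = 1 := by exact_mod_cast congrArg (Int.cast (R := ZMod 4)) hd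
  have h₁ : countsSE t.shortMod t.longMod = countsSE t'.shortMod t'.longMod := by
    refine countsSE_eq hc' hd' k (residue ξ) (fun p => ?_) fun p => ?_
    · obtain ⟨p, rfl⟩ := residue_surjective p
      rw [Bool.eq_iff_iff, ← residue_affine, ← mem_shortSet_iff, ← mem_shortSet_iff, hS]
    · obtain ⟨p, rfl⟩ := residue_surjective p
      rw [Bool.eq_iff_iff, ← residue_add, ← residue_affine, ← mem_longSet_iff,
        ← mem_longSet_iff, hE]
  rcases Nat.lt_or_ge l 2 with hl | hl
  · obtain rfl : l = 1 := by have := one_le_of_admissible ht; omega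
    rw [admissible_one_iff] at ht ht'
    exact List.inj_on_of_nodup_map nodup_counts_rank_one
      (List.mem_filter.2 ⟨mem_list t, ht⟩) (List.mem_filter.2 ⟨mem_list t', ht'⟩) h₁
  · have h₂ : pairCount t.middleMod t.middleMod = pairCount t'.middleMod t'.middleMod := by
      have : ∀ p, t.middleMod p = t'.middleMod (affineMod c d k (residue η) p) := fun p => by
        obtain ⟨p, rfl⟩ := residue_surjective p
        rw [Bool.eq_iff_iff, ← residue_affine, ← mem_middleSet_iff, ← mem_middleSet_iff, hM hl]
      exact pairCount_eq hc' hd' k _ this this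
    exact List.inj_on_of_nodup_map nodup_counts (mem_list t) (mem_list t')
      (Prod.ext h₁ h₂)

end EllipticType
end MERS

namespace MERS

/-! ### Classification of translation sets -/

/-- The subset of `(ℤ / 2)²` that contains `0` and, as prescribed, `(1, 0)`, `(0, 1)`, `(1, 1)`. -/
def parityMod (u v w : Bool) (m n : ℕ) : Bool :=
  if m % 2 = 0 then (if n % 2 = 0 then true else v) else (if n % 2 = 0 then u else w)

/-- The residue classes of the lattice with basis `i a` and `h a + j b`. -/
def skewMod (i h j : ℕ) (p : ZMod 4 × ZMod 4) : Bool :=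
  (p.1 - h * p.2).val % i == 0 && p.2.val % j == 0

/-- The residue classes of the subset of the lattice with basis `i a` and `h a + j b` in which the
parities of the coordinates are prescribed. -/
def skewParityMod (i h j : ℕ) (u v w : Bool) (p : ZMod 4 × ZMod 4) : Bool :=
  skewMod i h j p && parityMod u v w ((p.1 - h * p.2).val / i) (p.2.val / j)

/-- The lattices between `2 Λ` and `Λ`. -/
def skewList : List (ℕ × ℕ × ℕ) := [(1, 0, 1), (2, 0, 1), (2, 1, 1), (1, 0, 2), (2, 0, 2)]

namespace EllipticType

/-- Whether the type is different from `BBv2star`. -/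
def hasMiddleLattice : EllipticType → Bool
  | BBv2star => false
  | _ => true

-- The finite core of the classification. The Booleans `u, v, w` tell which of the classes of `a`,
-- `b`, `a + b` modulo `2Λ` lie in `S`: at least two, since `S` generates `Λ`, and all three unless
-- `M = 2Λ`. The Booleans `u', v', w'` do the same for `E` in a basis of `M`. Shifts `ξ` modulo `2`
-- suffice, as `S` is stable under `2Λ` and `E` under `4Λ`. The condition on `f` says that a
-- functional modulo `2` vanishing on `E` vanishes on `M`; it is the dual, decidable form of `M`
-- being generated by `E` and `2Λ`, and it selects types that occur in rank one.
set_option synthInstance.maxHeartbeats 400000 in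
set_option synthInstance.maxSize 2000 in
theorem search_mod : ∀ c ∈ skewList, ∀ u v w : Bool, (u || w) → (v || w) → (u || v) →
    ((u && v && w) || c == (2, 0, 2)) → ∀ u' v' w' : Bool,
    ∃ t ∈ list, t.hasMiddleLattice ∧
      ((∀ f ∈ [(1, 0), (0, 1), (1, 1)],
        (∀ p, skewParityMod c.1 c.2.1 c.2.2 u' v' w' p →
          (f.1 * p.1.val + f.2 * p.2.val) % 2 = 0) →
        ∀ p, skewMod c.1 c.2.1 c.2.2 p → (f.1 * p.1.val + f.2 * p.2.val) % 2 = 0) →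
          t.occursInRankOne) ∧
      ∃ k : ZMod 4, (∀ p, skewMod c.1 c.2.1 c.2.2 p = t.middleMod (affineMod 1 1 k 0 p)) ∧
        ∃ ξ ∈ [((0, 0) : ZMod 4 × ZMod 4), (1, 0), (0, 1), (1, 1)],
          (∀ p, parityMod u v w p.1.val p.2.val = t.shortMod (affineMod 1 1 k ξ p)) ∧
          ∀ p, skewParityMod c.1 c.2.1 c.2.2 u' v' w' p =
            t.longMod (affineMod 1 1 k (ξ + ξ) p) := by
  decide +kernel

end EllipticType
end MERS

namespace MERS

theorem mem_skew_iff {i h j : ℕ} (hi : i = 1 ∨ i = 2) (hj : j = 1 ∨ j = 2) (p : ℤ × ℤ) :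
    skewMod i h j (residue p) = true ↔ (i : ℤ) ∣ p.1 - h * p.2 ∧ (j : ℤ) ∣ p.2 := by
  have e : ((residue p).1 - h * (residue p).2) = ((p.1 - h * p.2 : ℤ) : ZMod 4) := by
    simp [residue]
  rw [skewMod, e, intCast_dvd_iff_val (by omega), intCast_dvd_iff_val (by omega)]
  simp [residue]

/-- A subgroup between `2 Λ` and `Λ` has a basis `i a`, `h a + j b` from a short list. -/
theorem exists_skew (M : AddSubgroup (ℤ × ℤ)) (hM : ∀ z : ℤ × ℤ, (2 : ℤ) • z ∈ M) :
    ∃ c ∈ skewList, ∀ p : ℤ × ℤ, p ∈ M ↔ skewMod c.1 c.2.1 c.2.2 (residue p) = true := by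
  have hpar : ∀ p : ℤ × ℤ, p ∈ M ↔ (p.1 % 2, p.2 % 2) ∈ M := fun p => by
    have : p = (p.1 % 2, p.2 % 2) + (2 : ℤ) • (p.1 / 2, p.2 / 2) := by
      ext <;> simp <;> omega
    conv_lhs => rw [this]
    exact M.add_mem_cancel_right (hM _)
  have h0 : ((0, 0) : ℤ × ℤ) ∈ M := M.zero_mem
  have h12 : ((1, 0) : ℤ × ℤ) ∈ M → ((0, 1) : ℤ × ℤ) ∈ M → ((1, 1) : ℤ × ℤ) ∈ M := fun h h' => by
    simpa using M.add_mem h h'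
  have h13 : ((1, 0) : ℤ × ℤ) ∈ M → ((1, 1) : ℤ × ℤ) ∈ M → ((0, 1) : ℤ × ℤ) ∈ M := fun h h' => by
    simpa using M.sub_mem h' h
  have h23 : ((0, 1) : ℤ × ℤ) ∈ M → ((1, 1) : ℤ × ℤ) ∈ M → ((1, 0) : ℤ × ℤ) ∈ M := fun h h' => by
    simpa using M.sub_mem h' h
  have main : ∃ c ∈ skewList, ∀ x ∈ [((0, 0) : ℤ × ℤ), (1, 0), (0, 1), (1, 1)],
      x ∈ M ↔ ((c.1 : ℤ) ∣ x.1 - c.2.1 * x.2 ∧ (c.2.2 : ℤ) ∣ x.2) := by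
    by_cases ha : ((1, 0) : ℤ × ℤ) ∈ M
    · by_cases hb : ((0, 1) : ℤ × ℤ) ∈ M
      · exact ⟨(1, 0, 1), by decide, by simp [ha, hb, h12 ha hb, h0]⟩
      · have hc : ((1, 1) : ℤ × ℤ) ∉ M := fun h => hb (h13 ha h)
        exact ⟨(1, 0, 2), by decide, by
          simp only [List.forall_mem_cons, ha, hb, hc, h0]; norm_num⟩
    · by_cases hb : ((0, 1) : ℤ × ℤ) ∈ M
      · have hc : ((1, 1) : ℤ × ℤ) ∉ M := fun h => ha (h23 hb h)
        exact ⟨(2, 0, 1), by decide, by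
          simp only [List.forall_mem_cons, ha, hb, hc, h0]; norm_num⟩
      · by_cases hc : ((1, 1) : ℤ × ℤ) ∈ M
        · exact ⟨(2, 1, 1), by decide, by
            simp only [List.forall_mem_cons, ha, hb, hc, h0]; norm_num⟩
        · exact ⟨(2, 0, 2), by decide, by
            simp only [List.forall_mem_cons, ha, hb, hc, h0]; norm_num⟩
  obtain ⟨c, hc, h⟩ := main
  refine ⟨c, hc, fun p => ?_⟩
  have hc' : (c.1 = 1 ∨ c.1 = 2) ∧ (c.2.2 = 1 ∨ c.2.2 = 2) := by
    clear h; revert c; decide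
  rw [mem_skew_iff hc'.1 hc'.2, hpar, h]
  · have hx : (c.1 : ℤ) ∣ 2 := by rcases hc'.1 with h | h <;> rw [h] <;> decide
    have hy : (c.2.2 : ℤ) ∣ 2 := by rcases hc'.2 with h | h <;> rw [h] <;> decide
    have e₁ : p.1 - c.2.1 * p.2 = p.1 % 2 - c.2.1 * (p.2 % 2)
        + 2 * (p.1 / 2 - c.2.1 * (p.2 / 2)) := by
      have h₁ := Int.emod_add_mul_ediv p.1 2
      have h₂ := Int.emod_add_mul_ediv p.2 2
      linear_combination -h₁ + c.2.1 * h₂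
    have e₂ : p.2 = p.2 % 2 + 2 * (p.2 / 2) := (Int.emod_add_mul_ediv p.2 2).symm
    conv_rhs => rw [e₁, dvd_add_left (hx.mul_right _)]
    refine and_congr_right fun _ => ?_
    conv_rhs => rw [e₂, dvd_add_left (hy.mul_right _)]
  · have h₁ := Int.emod_two_eq p.1
    have h₂ := Int.emod_two_eq p.2
    rcases h₁ with h₁ | h₁ <;> rcases h₂ with h₂ | h₂ <;> rw [h₁, h₂] <;> decide

theorem parityMod_iff (P : ℤ × ℤ → Prop) [DecidablePred P] (h0 : P (0, 0)) (m n : ℕ) :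
    parityMod (P (1, 0)) (P (0, 1)) (P (1, 1)) m n = true ↔ P ((m : ℤ) % 2, (n : ℤ) % 2) := by
  rcases Nat.mod_two_eq_zero_or_one m with hm | hm <;>
  rcases Nat.mod_two_eq_zero_or_one n with hn | hn
  all_goals
    have hm' : (m : ℤ) % 2 = ((m % 2 : ℕ) : ℤ) := by simp
    have hn' : (n : ℤ) % 2 = ((n % 2 : ℕ) : ℤ) := by simp
    rw [hm', hn']
    simp [parityMod, hm, hn, h0]

/-- The kernel of a functional `Λ → ℤ / 2`. -/
def parityKer (f : ℤ × ℤ) : AddSubgroup (ℤ × ℤ) where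
  carrier := {s | (f.1 * s.1 + f.2 * s.2) % 2 = 0}
  zero_mem' := by simp
  add_mem' := fun {x y} hx hy => by
    simp only [Set.mem_ofPred_eq, Prod.fst_add, Prod.snd_add, mul_add] at *; omega
  neg_mem' := fun {x} hx => by
    simp only [Set.mem_ofPred_eq, Prod.fst_neg, Prod.snd_neg, mul_neg] at *; omega

theorem mem_parityKer {f s : ℤ × ℤ} : s ∈ parityKer f ↔ (f.1 * s.1 + f.2 * s.2) % 2 = 0 := Iff.rfl

theorem exists_notMem_parityKer {S : Set (ℤ × ℤ)} (hS : AddSubgroup.closure S = ⊤) {f : ℤ × ℤ}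
    (hf : f.1 % 2 ≠ 0 ∨ f.2 % 2 ≠ 0) : ∃ s ∈ S, s ∉ parityKer f := by
  by_contra! h
  have hN : AddSubgroup.closure S ≤ parityKer f := (AddSubgroup.closure_le _).2 h
  rw [hS] at hN
  have h₁ := mem_parityKer.1 (hN (AddSubgroup.mem_top (1, 0)))
  have h₂ := mem_parityKer.1 (hN (AddSubgroup.mem_top (0, 1)))
  simp only [mul_one, mul_zero, add_zero, zero_add] at h₁ h₂
  omega

/-- A generating set that is stable under `2 Λ` meets at least two of the three nontrivial classes
modulo `2 Λ`. -/
theorem mem_or_mem_of_closure_eq_top {S : Set (ℤ × ℤ)} (hS : AddSubgroup.closure S = ⊤)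
    (hS2 : ∀ x ∈ S, ∀ z : ℤ × ℤ, x + (2 : ℤ) • z ∈ S) :
    ((1, 0) ∈ S ∨ (1, 1) ∈ S) ∧ ((0, 1) ∈ S ∨ (1, 1) ∈ S) ∧ ((1, 0) ∈ S ∨ (0, 1) ∈ S) := by
  -- A functional `f` modulo `2` is nonzero on exactly two of the three nontrivial classes. A
  -- generating set is not contained in the kernel of `f`, so it meets one of these two.
  have key : ∀ x y f : ℤ × ℤ, (f.1 % 2 ≠ 0 ∨ f.2 % 2 ≠ 0) →
      (∀ s : ℤ × ℤ, s ∉ parityKer f →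
        (s.1 % 2 = x.1 % 2 ∧ s.2 % 2 = x.2 % 2) ∨ (s.1 % 2 = y.1 % 2 ∧ s.2 % 2 = y.2 % 2)) →
      x ∈ S ∨ y ∈ S := by
    intro x y f hf hfs
    obtain ⟨s, hs, hs'⟩ := exists_notMem_parityKer hS hf
    have hcl : ∀ z : ℤ × ℤ, (s.1 % 2 = z.1 % 2 ∧ s.2 % 2 = z.2 % 2) → z ∈ S := fun z hz => by
      have e : z = s + (2 : ℤ) • ((z.1 - s.1) / 2, (z.2 - s.2) / 2) := by
        ext <;> simp <;> omega
      rw [e]; exact hS2 _ hs _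
    exact (hfs s hs').imp (hcl _) (hcl _)
  refine ⟨key _ _ (1, 0) ?_ ?_, key _ _ (0, 1) ?_ ?_, key _ _ (1, 1) ?_ ?_⟩ <;>
    simp [mem_parityKer] <;> omega

theorem val_div_emod_two {i : ℕ} (hi : i = 1 ∨ i = 2) (n : ℤ) :
    (((n : ZMod 4).val / i : ℕ) : ℤ) % 2 = n / i % 2 := by
  have h := val_intCast_four n
  rcases hi with rfl | rfl <;> push_cast <;> omega

theorem shear_residue (k : ZMod 4) (ξ : ZMod 4 × ZMod 4) (p : ℤ × ℤ) :
    affineMod 1 1 k ξ (residue p) =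
      residue (p.1 + k.val * p.2 + (ξ.1.val : ℤ), p.2 + (ξ.2.val : ℤ)) := by
  simp [affineMod, residue]

/-- Translation sets in which the middle roots form a lattice are, up to a shear and a translation,
those of a type from the list. -/
theorem exists_type_of_lattice {S E : Set (ℤ × ℤ)} {M : AddSubgroup (ℤ × ℤ)}
    (hS0 : 0 ∈ S) (hSgen : AddSubgroup.closure S = ⊤) (hM2 : ∀ z : ℤ × ℤ, (2 : ℤ) • z ∈ M)
    (hSM : ∀ x ∈ S, ∀ m ∈ M, x + m ∈ S) (hE0 : 0 ∈ E) (hEM : ∀ x ∈ E, x ∈ M)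
    (hE2 : ∀ x ∈ E, ∀ m ∈ M, x + (2 : ℤ) • m ∈ E) :
    ∃ (t : EllipticType) (k : ℤ) (ξ : ℤ × ℤ), t.hasMiddleLattice = true ∧
      (M ≤ AddSubgroup.closure (E ∪ Set.range fun z : ℤ × ℤ => (2 : ℤ) • z) →
        t.occursInRankOne = true) ∧
      ∀ p : ℤ × ℤ, (p ∈ S ↔ (p.1 + k * p.2 + ξ.1, p.2 + ξ.2) ∈ t.shortSet) ∧
        (p ∈ M ↔ (p.1 + k * p.2, p.2) ∈ t.middleSet) ∧
        (p ∈ E ↔ (p.1 + k * p.2 + 2 * ξ.1, p.2 + 2 * ξ.2) ∈ t.longSet) := by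
  classical
  -- Since `2Λ ⊂ M`, the set `S` is a union of cosets of `2Λ`, hence determined by the three classes
  -- tested here.
  have hS : ∀ p : ℤ × ℤ, p ∈ S ↔ parityMod ((1, 0) ∈ S) ((0, 1) ∈ S) ((1, 1) ∈ S)
      (residue p).1.val (residue p).2.val = true := fun p => by
    rw [parityMod_iff (· ∈ S) hS0]
    have e : p = (p.1 % 2, p.2 % 2) + (2 : ℤ) • (p.1 / 2, p.2 / 2) := by
      ext <;> simp <;> omega
    have e₁ : (((residue p).1.val : ℤ) % 2, ((residue p).2.val : ℤ) % 2) = (p.1 % 2, p.2 % 2) := by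
      have h₁ := val_intCast_four p.1
      have h₂ := val_intCast_four p.2
      refine Prod.ext ?_ ?_ <;> simp only [residue] <;> omega
    rw [e₁]
    refine ⟨fun h => ?_, fun h => ?_⟩
    · have := hSM _ h _ (M.neg_mem (hM2 (p.1 / 2, p.2 / 2)))
      nth_rewrite 1 [e] at this
      simpa using this
    · rw [e]; exact hSM _ h _ (hM2 _)
  obtain ⟨c, hc, hM⟩ := exists_skew M hM2
  have hc' : (c.1 = 1 ∨ c.1 = 2) ∧ (c.2.2 = 1 ∨ c.2.2 = 2) := by
    clear hM; revert c; decide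
  set i := c.1
  set h := c.2.1
  set j := c.2.2
  have hM' : ∀ p : ℤ × ℤ, p ∈ M ↔ (i : ℤ) ∣ p.1 - h * p.2 ∧ (j : ℤ) ∣ p.2 := fun p => by
    rw [hM, mem_skew_iff hc'.1 hc'.2]
  -- Coordinates with respect to the basis `i a`, `h a + j b` of `M`. As `E` is a union of cosets of
  -- `2M`, only their parities matter.
  let B : ℤ × ℤ → ℤ × ℤ := fun q => (q.1 * i + q.2 * (h * j), q.2 * j)
  have hB : ∀ q, B q ∈ M := fun q => (hM' _).2 ⟨⟨q.1, by simp only [B]; ring⟩, ⟨q.2, by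
    simp only [B]; ring⟩⟩
  have hE : ∀ p : ℤ × ℤ, p ∈ E ↔ skewParityMod i h j (B (1, 0) ∈ E) (B (0, 1) ∈ E) (B (1, 1) ∈ E)
      (residue p) = true := fun p => by
    have e : (residue p).1 - h * (residue p).2 = ((p.1 - h * p.2 : ℤ) : ZMod 4) := by
      simp [residue]
    rw [skewParityMod, Bool.and_eq_true, ← hM, parityMod_iff (fun q => B q ∈ E) (by simpa [B]), e,
      val_div_emod_two hc'.1]
    change _ ↔ p ∈ M ∧ B (_, (((p.2 : ZMod 4).val / j : ℕ) : ℤ) % 2) ∈ E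
    rw [val_div_emod_two hc'.2]
    have key : p ∈ M → p = B ((p.1 - h * p.2) / i % 2, p.2 / j % 2) +
        (2 : ℤ) • B ((p.1 - h * p.2) / i / 2, p.2 / j / 2) := fun hp => by
      obtain ⟨⟨u, hu⟩, ⟨v, hv⟩⟩ := (hM' p).1 hp
      have hi0 : (i : ℤ) ≠ 0 := by omega
      have hj0 : (j : ℤ) ≠ 0 := by omega
      rw [hu, hv, Int.mul_ediv_cancel_left _ hi0, Int.mul_ediv_cancel_left _ hj0]
      have h₁ := Int.emod_add_mul_ediv u 2
      have h₂ := Int.emod_add_mul_ediv v 2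
      ext
      · simp only [B, Prod.fst_add, Prod.smul_fst, smul_eq_mul]
        linear_combination hu + h * hv - i * h₁ - h * j * h₂
      · simp only [B, Prod.snd_add, Prod.smul_snd, smul_eq_mul]
        linear_combination hv - j * h₂
    refine ⟨fun hp => ⟨hEM p hp, ?_⟩, fun ⟨hp, hp'⟩ => ?_⟩
    · have := hE2 p hp _ (M.neg_mem (hB ((p.1 - h * p.2) / i / 2, p.2 / j / 2)))
      nth_rewrite 1 [key (hEM p hp)] at this
      simpa using this
    · rw [key hp]; exact hE2 _ hp' _ (hB _)
  obtain ⟨hg₁, hg₂, hg₃⟩ := mem_or_mem_of_closure_eq_top hSgen fun x hx z => hSM x hx _ (hM2 z)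
  have hadd : ∀ x ∈ S, ∀ m ∈ M, ∀ y : ℤ × ℤ, (y.1 - x.1 - m.1) % 2 = 0 →
      (y.2 - x.2 - m.2) % 2 = 0 → y ∈ S := fun x hx m hm y h₁ h₂ => by
    have e : y = x + (m + (2 : ℤ) • ((y.1 - x.1 - m.1) / 2, (y.2 - x.2 - m.2) / 2)) := by
      ext <;> simp <;> omega
    rw [e]; exact hSM _ hx _ (M.add_mem hm (hM2 _))
  -- If `M ≠ 2Λ`, it contains a nontrivial class. Adding this class to `0` and to another class in
  -- `S` produces the remaining ones.
  have hall : c ≠ (2, 0, 2) → (1, 0) ∈ S ∧ (0, 1) ∈ S ∧ (1, 1) ∈ S := fun hne => by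
    simp only [skewList, List.mem_cons, List.not_mem_nil, or_false] at hc
    have hm : (1, 0) ∈ M ∨ (0, 1) ∈ M ∨ (1, 1) ∈ M := by
      simp only [hM', i, h, j]
      rcases hc with hc | hc | hc | hc | hc <;> simp [hc] at hne ⊢
    rcases hm with hm | hm | hm
    · refine ⟨hadd 0 hS0 _ hm _ (by simp) (by simp), ?_, ?_⟩
      · exact hg₂.elim id fun h => hadd _ h _ hm _ (by simp) (by simp)
      · exact hg₂.elim (fun h => hadd _ h _ hm _ (by simp) (by simp)) id
    · refine ⟨?_, hadd 0 hS0 _ hm _ (by simp) (by simp), ?_⟩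
      · exact hg₁.elim id fun h => hadd _ h _ hm _ (by simp) (by simp)
      · exact hg₁.elim (fun h => hadd _ h _ hm _ (by simp) (by simp)) id
    · refine ⟨?_, ?_, hadd 0 hS0 _ hm _ (by simp) (by simp)⟩
      · exact hg₃.elim id fun h => hadd _ h _ hm _ (by simp) (by simp)
      · exact hg₃.elim (fun h => hadd _ h _ hm _ (by simp) (by simp)) id
  obtain ⟨t, -, ht, ht₁, k, hk, ξ, -, hξ, hξ'⟩ := EllipticType.search_mod c hc
    (decide ((1, 0) ∈ S)) (decide ((0, 1) ∈ S)) (decide ((1, 1) ∈ S))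
    (by simpa using hg₁) (by simpa using hg₂) (by simpa using hg₃)
    (by
      by_cases hne : c = (2, 0, 2)
      · simp [hne]
      · simp [hall hne])
    (decide (B (1, 0) ∈ E)) (decide (B (0, 1) ∈ E)) (decide (B (1, 1) ∈ E))
  refine ⟨t, k.val, (ξ.1.val, ξ.2.val), ht, fun hME => ht₁ ?_, fun p => ⟨?_, ?_, ?_⟩⟩
  · intro f hf hfE p hp
    have hker : ∀ p : ℤ × ℤ, (f.1 * (residue p).1.val + f.2 * (residue p).2.val) % 2 = 0 ↔
        p ∈ parityKer ((f.1 : ℤ), (f.2 : ℤ)) := fun p => by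
      have h₁ := val_intCast_four p.1
      have h₂ := val_intCast_four p.2
      simp only [List.mem_cons, List.not_mem_nil, or_false] at hf
      rcases hf with rfl | rfl | rfl <;> simp [mem_parityKer, residue] <;> omega
    obtain ⟨p, rfl⟩ := residue_surjective p
    rw [hker]
    refine (AddSubgroup.closure_le _).2 ?_ (hME ((hM p).2 hp))
    rintro x (hx | ⟨z, rfl⟩)
    · exact (hker x).1 (hfE _ ((hE x).1 hx))
    · simp only [SetLike.mem_coe, mem_parityKer, Prod.smul_fst, Prod.smul_snd, smul_eq_mul]
      rw [mul_left_comm, mul_left_comm _ 2, ← mul_add, Int.mul_emod_right]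
  · rw [hS, hξ, EllipticType.mem_shortSet_iff, shear_residue]
  · rw [hM, hk, EllipticType.mem_middleSet_iff, shear_residue]
    simp
  · rw [hE, hξ', EllipticType.mem_longSet_iff]
    simp [affineMod, residue, two_mul]

end MERS

/-! ### Reflection-closed translation sets up to change of frame. -/

namespace MERS

/-- Turns closure rules for single translations into stability under a whole group: `X` becomes a
union of cosets of `n` times the group generated by `T`. -/
theorem add_smul_mem_of_mem_closure {X T : Set (ℤ × ℤ)} {n : ℤ} (hT : ∀ t ∈ T, -t ∈ T)
    (h : ∀ t ∈ T, ∀ x ∈ X, x - n • t ∈ X) {z : ℤ × ℤ} (hz : z ∈ AddSubgroup.closure T) :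
    ∀ x ∈ X, x + n • z ∈ X := by
  -- Both signs go through the induction together, since passing to `-z` exchanges them.
  suffices ∀ x ∈ X, x + n • z ∈ X ∧ x - n • z ∈ X from fun x hx => (this x hx).1
  induction hz using AddSubgroup.closure_induction with
  | mem t ht => exact fun x hx => ⟨by simpa using h _ (hT t ht) x hx, h t ht x hx⟩
  | zero => exact fun x hx => by simpa using hx
  | add y z _ _ hy hz =>
    refine fun x hx => ⟨?_, ?_⟩
    · rw [smul_add, ← add_assoc]; exact (hz _ (hy x hx).1).1
    · rw [smul_add, ← sub_sub]; exact (hz _ (hy x hx).2).2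
  | neg y _ hy =>
    refine fun x hx => ⟨?_, ?_⟩
    · rw [smul_neg, ← sub_eq_add_neg]; exact (hy x hx).2
    · rw [smul_neg, sub_neg_eq_add]; exact (hy x hx).1

theorem smul_mem_of_mem_closure {X T : Set (ℤ × ℤ)} {n : ℤ} (h0 : 0 ∈ X) (hT : ∀ t ∈ T, -t ∈ T)
    (h : ∀ t ∈ T, ∀ x ∈ X, x - n • t ∈ X) {z : ℤ × ℤ} (hz : z ∈ AddSubgroup.closure T) :
    n • z ∈ X := by
  simpa using add_smul_mem_of_mem_closure hT h hz 0 h0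

/-- The shear `m a + n b ↦ (m + k n) a + n b`. -/
def shear (k : ℤ) (p : ℤ × ℤ) : ℤ × ℤ := (p.1 + k * p.2, p.2)

/-- A shear followed by the change of frame `ε_i ↦ ε_i + ξ_i` carries one triple of translation
sets to another one. -/
structure FrameChange (l : ℕ) (k : ℤ) (ξ : Fin l → ℤ × ℤ) (S M E S' M' E' : Set (ℤ × ℤ)) :
    Prop where
  short : ∀ i p, p ∈ S ↔ shear k p + ξ i ∈ S'
  middle_add : ∀ i j, i ≠ j → ∀ p, p ∈ M ↔ shear k p + (ξ i + ξ j) ∈ M'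
  middle_sub : ∀ i j, i ≠ j → ∀ p, p ∈ M ↔ shear k p + (ξ i - ξ j) ∈ M'
  long : ∀ i p, p ∈ E ↔ shear k p + (2 : ℤ) • ξ i ∈ E'

namespace EllipticType

theorem admissible_of_hasMiddleLattice {t : EllipticType} (ht : t.hasMiddleLattice = true) {l : ℕ}
    (hl : 2 ≤ l) : t.Admissible l := by
  rcases t with ⟨X, k⟩ | _
  · cases X <;> cases k <;> simp only [Admissible] <;> omega
  all_goals first | (simp only [Admissible]; omega) | simp [hasMiddleLattice] at ht

end EllipticType

/-- When all frame vectors are shifted by the same `ξ`, the root `ε_i + ε_j` is shifted by `2ξ`, and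
this shift is invisible to the middle set. -/
theorem middleSet_add_two_smul_iff (t : EllipticType) (p z : ℤ × ℤ) :
    p + (2 : ℤ) • z ∈ t.middleSet ↔ p ∈ t.middleSet := by
  have key : ∀ t ∈ EllipticType.list, ∀ p z : ZMod 4 × ZMod 4,
    t.middleMod (p + (z + z)) = t.middleMod p := by decide +kernel
  rw [EllipticType.mem_middleSet_iff, EllipticType.mem_middleSet_iff, residue_add,
    residue_two_smul, key t t.mem_list]

/-- Translation sets of rank `1`. -/
theorem exists_frameChange_one {S E : Set (ℤ × ℤ)} (hS0 : 0 ∈ S) (hE0 : 0 ∈ E)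
    (hSgen : AddSubgroup.closure S = ⊤) (hSneg : ∀ x ∈ S, -x ∈ S) (hEneg : ∀ x ∈ E, -x ∈ E)
    (hSS : ∀ x ∈ S, ∀ y ∈ S, y - (2 : ℤ) • x ∈ S) (hSE : ∀ x ∈ S, ∀ y ∈ E, y - (4 : ℤ) • x ∈ E)
    (hES : ∀ x ∈ E, ∀ y ∈ S, y - x ∈ S) (hEE : ∀ x ∈ E, ∀ y ∈ E, y - (2 : ℤ) • x ∈ E)
    (M : Set (ℤ × ℤ)) :
    ∃ (t : EllipticType) (k : ℤ) (ξ : Fin 1 → ℤ × ℤ), t.Admissible 1 ∧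
      FrameChange 1 k ξ S M E t.shortSet t.middleSet t.longSet := by
  have hneg : ∀ x ∈ E ∪ Set.range fun z : ℤ × ℤ => (2 : ℤ) • z,
      -x ∈ E ∪ Set.range fun z : ℤ × ℤ => (2 : ℤ) • z := by
    rintro x (hx | ⟨z, rfl⟩)
    · exact Or.inl (hEneg x hx)
    · exact Or.inr ⟨-z, by simp⟩
  -- In place of a middle lattice stands the group generated by `E` and `2Λ`. Reflections in short
  -- and long roots make `S` stable under it and `E` stable under its double, and its definition
  -- gives the condition that makes the type occur in rank one.
  obtain ⟨t, k, ξ, -, ht, h⟩ := exists_type_of_lattice (S := S) (E := E)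
    (M := AddSubgroup.closure (E ∪ Set.range fun z : ℤ × ℤ => (2 : ℤ) • z)) hS0 hSgen
    (fun z => AddSubgroup.subset_closure (Or.inr ⟨z, rfl⟩))
    (fun x hx m hm => by
      simpa using add_smul_mem_of_mem_closure (X := S) (n := 1) hneg (by
        rintro _ (ht | ⟨z, rfl⟩) y hy
        · simpa using hES _ ht y hy
        · have := add_smul_mem_of_mem_closure (X := S) (n := 2) hSneg hSS
            (z := -z) (by rw [hSgen]; trivial) y hy
          simpa [sub_eq_add_neg] using this) hm x hx)
    hE0 (fun x hx => AddSubgroup.subset_closure (Or.inl hx))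
    (fun x hx m hm => add_smul_mem_of_mem_closure (X := E) (n := 2) hneg (by
        rintro _ (ht | ⟨z, rfl⟩) y hy
        · exact hEE _ ht y hy
        · have := add_smul_mem_of_mem_closure (X := E) (n := 4) hSneg hSE
            (z := -z) (by rw [hSgen]; trivial) y hy
          change y - (2 : ℤ) • ((2 : ℤ) • z) ∈ E
          rw [smul_smul]
          simpa [sub_eq_add_neg] using this) hm x hx)
  refine ⟨t, k, fun _ => ξ, t.admissible_one_iff.2 (ht le_rfl), fun _ p => (h p).1,
    fun i j hij => absurd (Subsingleton.elim i j) hij,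
    fun i j hij => absurd (Subsingleton.elim i j) hij, fun _ p => (h p).2.2⟩

/-- Translation sets of rank at least `2`. -/
theorem exists_frameChange {l : ℕ} (hl : 2 ≤ l) {S M E : Set (ℤ × ℤ)} (h : ReflClosed l S M E)
    (hS0 : 0 ∈ S) (hM0 : 0 ∈ M) (hE0 : 0 ∈ E) (hSgen : AddSubgroup.closure S = ⊤) :
    ∃ (t : EllipticType) (k : ℤ) (ξ : Fin l → ℤ × ℤ), t.Admissible l ∧
      FrameChange l k ξ S M E t.shortSet t.middleSet t.longSet := by
  have hM2 : ∀ x ∈ M, ∀ z : ℤ × ℤ, x + (2 : ℤ) • z ∈ M := fun x hx z =>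
    add_smul_mem_of_mem_closure h.neg_short h.short_middle (by rw [hSgen]; trivial) x hx
  have hMS : ∀ z ∈ AddSubgroup.closure M, ∀ x ∈ S, x + z ∈ S := fun z hz x hx => by
    simpa using add_smul_mem_of_mem_closure (n := 1) h.neg_middle
      (by simpa using h.middle_short) hz x hx
  have hME : ∀ z ∈ AddSubgroup.closure M, ∀ x ∈ E, x + (2 : ℤ) • z ∈ E := fun z hz x hx =>
    add_smul_mem_of_mem_closure h.neg_middle h.middle_long hz x hx
  by_cases hsub : ∀ x ∈ M, ∀ y ∈ M, y - x ∈ M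
  · have hcl : ∀ z, z ∈ AddSubgroup.closure M ↔ z ∈ M := fun z =>
      ⟨fun hz => by
        simpa using smul_mem_of_mem_closure (n := 1) hM0 h.neg_middle (by simpa using hsub) hz,
        fun hz => AddSubgroup.subset_closure hz⟩
    obtain ⟨t, k, ξ, ht, -, H⟩ := exists_type_of_lattice (S := S) (E := E)
      (M := AddSubgroup.closure M) hS0 hSgen (fun z => (hcl _).2 (by simpa using hM2 0 hM0 z))
      (fun x hx z hz => hMS z hz x hx) hE0
      (fun x hx => (hcl x).2 (by simpa using h.neg_middle _ (h.long_middle x hx 0 hM0)))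
      (fun x hx z hz => hME z hz x hx)
    refine ⟨t, k, fun _ => ξ, EllipticType.admissible_of_hasMiddleLattice ht hl,
      fun _ p => (H p).1, fun i j hij p => ?_, fun i j hij p => ?_, fun _ p => (H p).2.2⟩
    · rw [← two_smul ℤ, middleSet_add_two_smul_iff, ← hcl]
      exact (H p).2.1
    · rw [sub_self, add_zero, ← hcl]
      exact (H p).2.1
  · push Not at hsub
    obtain ⟨x, hx, y, hy, hxy⟩ := hsub
    obtain rfl : l = 2 := by
      by_contra hne
      exact hxy (h.middle_middle_sub (by omega) x hx y hy)
    have hpar : ∀ p ∈ M, ∀ q : ℤ × ℤ, (q.1 - p.1) % 2 = 0 → (q.2 - p.2) % 2 = 0 → q ∈ M := by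
      intro p hp q h₁ h₂
      have e : q = p + (2 : ℤ) • ((q.1 - p.1) / 2, (q.2 - p.2) / 2) := by
        ext <;> simp <;> omega
      rw [e]; exact hM2 p hp _
    have hne : ∀ p ∈ M, (y.1 - x.1 - p.1) % 2 ≠ 0 ∨ (y.2 - x.2 - p.2) % 2 ≠ 0 := fun p hp => by
      by_contra! hcon
      exact hxy (hpar p hp _ hcon.1 hcon.2)
    have h0 := hne 0 hM0
    have h1 := hne x hx
    have h2 := hne y hy
    simp only [Prod.fst_zero, Prod.snd_zero, sub_zero] at h0
    -- The class of `y - x` is missing from `M`. The classes of `0`, `x`, `y` modulo `2Λ` are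
    -- distinct and different from it, so they are the other three.
    have hM : ∀ p : ℤ × ℤ, p ∈ M ↔ (y.1 - x.1 - p.1) % 2 ≠ 0 ∨ (y.2 - x.2 - p.2) % 2 ≠ 0 := by
      refine fun p => ⟨hne p, fun hp => ?_⟩
      have : (p.1 % 2 = 0 ∧ p.2 % 2 = 0) ∨ ((p.1 - x.1) % 2 = 0 ∧ (p.2 - x.2) % 2 = 0) ∨
          ((p.1 - y.1) % 2 = 0 ∧ (p.2 - y.2) % 2 = 0) := by omega
      rcases this with h | h | h
      · exact hpar 0 hM0 p (by simpa using h.1) (by simpa using h.2)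
      · exact hpar x hx p h.1 h.2
      · exact hpar y hy p h.1 h.2
    have hMtop : AddSubgroup.closure M = ⊤ := by
      refine eq_top_iff.2 fun z _ => ?_
      by_cases hz : z ∈ M
      · exact AddSubgroup.subset_closure hz
      · have hz' : z - x ∈ M := by
          rw [hM] at hz ⊢
          simp only [Prod.fst_sub, Prod.snd_sub]
          omega
        simpa using (AddSubgroup.closure M).add_mem (AddSubgroup.subset_closure hz')
          (AddSubgroup.subset_closure hx)
    have hS : ∀ p, p ∈ S := fun p => by simpa using hMS p (by rw [hMtop]; trivial) 0 hS0
    -- Subtracting an element of `E` preserves `M`, hence its single missing class, so the element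
    -- lies in `2Λ`.
    have hE : ∀ p : ℤ × ℤ, p ∈ E ↔ p.1 % 2 = 0 ∧ p.2 % 2 = 0 := by
      refine fun p => ⟨fun hp => ?_, fun hp => ?_⟩
      · have k0 := (hM _).1 (h.long_middle p hp 0 hM0)
        have k1 := (hM _).1 (h.long_middle p hp x hx)
        have k2 := (hM _).1 (h.long_middle p hp y hy)
        simp only [Prod.fst_sub, Prod.snd_sub, Prod.fst_zero, Prod.snd_zero] at k0 k1 k2
        omega
      · have e : p = 0 + (2 : ℤ) • (p.1 / 2, p.2 / 2) := by
          ext <;> simp <;> omega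
        rw [e]
        exact hME _ (by rw [hMtop]; trivial) 0 hE0
    have hstar : ∀ p : ℤ × ℤ, p ∈ starSet 0 0 1 1 ↔ p.1 % 2 = 0 ∨ p.2 % 2 = 0 := fun p => by
      rw [mem_starSet_iff_dvd one_ne_zero one_ne_zero, Int.even_mul, Int.even_iff, Int.even_iff]
      simp
    -- Shifting only the first frame vector moves `ε_1 + ε_2` and `ε_1 - ε_2` by the same class
    -- modulo `2Λ`. The shift `(1, 1) - (y - x)` carries the missing class to that of `(1, 1)`,
    -- which `L_{0,0}` omits.
    refine ⟨.BBv2star, 0, ![(1, 1) - (y - x), 0], rfl, fun i p => ?_, ?_, ?_, ?_⟩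
    · simp only [hS, true_iff]
      exact ⟨one_dvd _, one_dvd _⟩
    · intro i j hij p
      rw [EllipticType.middleSet, hstar, hM]
      fin_cases i <;> fin_cases j <;> simp [shear] at hij ⊢ <;> omega
    · intro i j hij p
      rw [EllipticType.middleSet, hstar, hM]
      fin_cases i <;> fin_cases j <;> simp [shear] at hij ⊢ <;> omega
    · intro i p
      rw [hE]
      change _ ↔ 2 ∣ _ ∧ 2 ∣ _
      fin_cases i <;> simp [shear]

end MERS

namespace MERS

/-! ### The roots of `BC_l` as integer vectors -/

section IntVec

variable {ι : Type*}

theorem exists_eq_of_sum_sq_eq_one {s : Finset ι} {n : ι → ℤ} (h : ∑ i ∈ s, n i * n i = 1) :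
    ∃ i ∈ s, (n i = 1 ∨ n i = -1) ∧ ∀ j ∈ s, j ≠ i → n j = 0 := by
  classical
  obtain ⟨i, hi, hne⟩ := Finset.exists_ne_zero_of_sum_ne_zero (by rw [h]; exact one_ne_zero)
  have hsum := Finset.add_sum_erase s (fun i => n i * n i) hi
  have hnn : ∀ j ∈ s.erase i, 0 ≤ n j * n j := fun j _ => mul_self_nonneg _
  have hrest := Finset.sum_nonneg hnn
  have hpos : 0 < n i * n i := lt_of_le_of_ne (mul_self_nonneg _) (Ne.symm hne)
  rw [h] at hsum
  have h1 : n i * n i = 1 := by linarith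
  refine ⟨i, hi, mul_self_eq_one_iff.1 h1, fun j hj hji => ?_⟩
  have h0 : ∑ j ∈ s.erase i, n j * n j = 0 := by linarith
  exact mul_self_eq_zero.1 ((Finset.sum_eq_zero_iff_of_nonneg hnn).1 h0 j
    (Finset.mem_erase.2 ⟨hji, hj⟩))

theorem exists_eq_of_sum_sq_eq_two {s : Finset ι} {n : ι → ℤ} (h : ∑ i ∈ s, n i * n i = 2) :
    ∃ i ∈ s, ∃ j ∈ s, j ≠ i ∧ (n i = 1 ∨ n i = -1) ∧ (n j = 1 ∨ n j = -1) ∧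
      ∀ k ∈ s, k ≠ i → k ≠ j → n k = 0 := by
  classical
  obtain ⟨i, hi, hne⟩ := Finset.exists_ne_zero_of_sum_ne_zero (by rw [h]; exact two_ne_zero)
  have hsum := Finset.add_sum_erase s (fun i => n i * n i) hi
  have hnn : ∀ j ∈ s.erase i, 0 ≤ n j * n j := fun j _ => mul_self_nonneg _
  have hrest := Finset.sum_nonneg hnn
  rw [h] at hsum
  have h1 : n i = 1 ∨ n i = -1 := by
    have h0 : n i ≠ 0 := fun h0 => hne (by rw [h0]; rfl)
    have hu : n i < 2 := by nlinarith
    have hl : -2 < n i := by nlinarith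
    omega
  have h2 : n i * n i = 1 := by rcases h1 with h1 | h1 <;> rw [h1] <;> rfl
  obtain ⟨j, hj, hj1, hj0⟩ := exists_eq_of_sum_sq_eq_one (s := s.erase i) (n := n) (by linarith)
  rw [Finset.mem_erase] at hj
  exact ⟨i, hi, j, hj.2, hj.1, h1, hj1, fun k hk hki hkj =>
    hj0 k (Finset.mem_erase.2 ⟨hki, hk⟩) hkj⟩

end IntVec

section

variable {l : ℕ}

/-- The real vector with the given integer coordinates. -/
def realVec (n : Fin l → ℤ) : Fin l → ℝ := fun i => n i

theorem realVec_single (i : Fin l) (c : ℤ) : realVec (Pi.single i c) = Pi.single i (c : ℝ) := by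
  ext j; by_cases h : j = i
  · subst h; simp [realVec]
  · simp [realVec, h]

theorem realVec_add (n m : Fin l → ℤ) : realVec (n + m) = realVec n + realVec m := by
  ext; simp [realVec]

theorem realVec_sub (n m : Fin l → ℤ) : realVec (n - m) = realVec n - realVec m := by
  ext; simp [realVec]

theorem realVec_neg (n : Fin l → ℤ) : realVec (-n) = -realVec n := by
  ext; simp [realVec]

theorem realVec_smul (k : ℤ) (n : Fin l → ℤ) : realVec (k • n) = (k : ℝ) • realVec n := by
  ext; simp [realVec]

theorem realVec_dotProduct (n m : Fin l → ℤ) : realVec n ⬝ᵥ realVec m = ((n ⬝ᵥ m : ℤ) : ℝ) := by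
  simp [realVec, dotProduct]

theorem realVec_injective : Function.Injective (realVec (l := l)) := fun n m h => by
  ext i
  have hi := congrFun h i
  simp only [realVec] at hi
  exact_mod_cast hi

theorem mem_shortBC_iff {v : Fin l → ℝ} : v ∈ shortBC l ↔ ∃ n, v = realVec n ∧ n ⬝ᵥ n = 1 := by
  constructor
  · rintro ⟨i, rfl | rfl⟩
    · exact ⟨Pi.single i 1, by simp [realVec_single], by simp⟩
    · exact ⟨-Pi.single i 1, by simp [realVec_neg, realVec_single], by simp⟩
  · rintro ⟨n, rfl, h⟩
    obtain ⟨i, -, h1, h0⟩ := exists_eq_of_sum_sq_eq_one (s := Finset.univ) (n := n) h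
    have hn : n = Pi.single i (n i) := by
      ext j; by_cases hj : j = i
      · subst hj; simp
      · simp [hj, h0 j (Finset.mem_univ _) hj]
    refine ⟨i, ?_⟩
    rw [hn, realVec_single]
    rcases h1 with h1 | h1 <;> simp [h1, Pi.single_neg]

theorem eq_single_add_single {n : Fin l → ℤ} {i j : Fin l} (hij : j ≠ i)
    (h0 : ∀ k, k ≠ i → k ≠ j → n k = 0) : n = Pi.single i (n i) + Pi.single j (n j) := by
  ext k
  by_cases hi : k = i
  · subst hi; simp [hij.symm]
  · by_cases hj : k = j
    · subst hj; simp [hi]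
    · simp [hi, hj, h0 k hi hj]

theorem exists_of_dotProduct_self_eq_two {n : Fin l → ℤ} (h : n ⬝ᵥ n = 2) :
    ∃ i j, i < j ∧ (n i = 1 ∨ n i = -1) ∧ (n j = 1 ∨ n j = -1) ∧
      n = Pi.single i (n i) + Pi.single j (n j) := by
  obtain ⟨i, -, j, -, hji, h1, h2, h0⟩ := exists_eq_of_sum_sq_eq_two (s := Finset.univ) (n := n) h
  rcases lt_or_gt_of_ne hji with hlt | hlt
  · exact ⟨j, i, hlt, h2, h1, eq_single_add_single hji.symm
      fun k hk hk' => h0 k (Finset.mem_univ _) hk' hk⟩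
  · exact ⟨i, j, hlt, h1, h2, eq_single_add_single hji
      fun k hk hk' => h0 k (Finset.mem_univ _) hk hk'⟩

theorem mem_middleBC_iff {v : Fin l → ℝ} : v ∈ middleBC l ↔ ∃ n, v = realVec n ∧ n ⬝ᵥ n = 2 := by
  constructor
  · rintro ⟨i, j, hij, rfl | rfl | rfl | rfl⟩
    · exact ⟨Pi.single i 1 + Pi.single j 1, by simp [realVec_single, realVec_add], by
        simp [hij.ne, hij.ne']⟩
    · exact ⟨-(Pi.single i 1 + Pi.single j 1), by simp [realVec_neg, realVec_single, realVec_add],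
        by simp [hij.ne, hij.ne']⟩
    · exact ⟨Pi.single i 1 - Pi.single j 1, by simp [realVec_single, realVec_sub], by
        simp [hij.ne, hij.ne']⟩
    · exact ⟨-(Pi.single i 1 - Pi.single j 1), by simp [realVec_single, realVec_sub],
        by simp [hij.ne, hij.ne']⟩
  · rintro ⟨n, rfl, h⟩
    obtain ⟨i, j, hij, h1, h2, hn⟩ := exists_of_dotProduct_self_eq_two h
    refine ⟨i, j, hij, ?_⟩
    rw [hn, realVec_add, realVec_single, realVec_single]
    rcases h1 with h1 | h1 <;> rcases h2 with h2 | h2 <;>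
      simp [h1, h2, Pi.single_neg, sub_eq_add_neg, add_comm]

theorem mem_longBC_iff {v : Fin l → ℝ} :
    v ∈ longBC l ↔ ∃ n, v = realVec ((2 : ℤ) • n) ∧ n ⬝ᵥ n = 1 := by
  have : v ∈ longBC l ↔ ∃ w ∈ shortBC l, v = (2 : ℝ) • w := by
    constructor
    · rintro ⟨i, rfl | rfl⟩
      · exact ⟨_, ⟨i, Or.inl rfl⟩, rfl⟩
      · exact ⟨_, ⟨i, Or.inr rfl⟩, (smul_neg _ _).symm⟩
    · rintro ⟨w, ⟨i, rfl | rfl⟩, rfl⟩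
      · exact ⟨i, Or.inl rfl⟩
      · exact ⟨i, Or.inr (smul_neg _ _)⟩
  rw [this]
  constructor
  · rintro ⟨w, hw, rfl⟩
    obtain ⟨n, rfl, hn⟩ := mem_shortBC_iff.1 hw
    exact ⟨n, by rw [realVec_smul]; norm_num, hn⟩
  · rintro ⟨n, rfl, hn⟩
    exact ⟨_, mem_shortBC_iff.2 ⟨n, rfl, hn⟩, by rw [realVec_smul]; norm_num⟩

/-- The point of `Space l` with the given integer coordinates. -/
def realPt (n : Fin l → ℤ) (p : ℤ × ℤ) : Space l := (realVec n, ((p.1 : ℝ), (p.2 : ℝ)))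

/-- The roots in integer coordinates. -/
def IsIntRoot (S M E : Set (ℤ × ℤ)) (n : Fin l → ℤ) (p : ℤ × ℤ) : Prop :=
  (n ⬝ᵥ n = 1 ∧ p ∈ S) ∨ (n ⬝ᵥ n = 2 ∧ p ∈ M) ∨ ∃ m, n = (2 : ℤ) • m ∧ m ⬝ᵥ m = 1 ∧ p ∈ E

theorem mem_rootsOf_iff {S M E : Set (ℤ × ℤ)} {v : Space l} :
    v ∈ rootsOf l S M E ↔ ∃ n p, v = realPt n p ∧ IsIntRoot S M E n p := by
  constructor
  · rintro ((⟨hv, p, hp, h⟩ | ⟨hv, p, hp, h⟩) | ⟨hv, p, hp, h⟩)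
    · obtain ⟨n, hn, hn'⟩ := mem_shortBC_iff.1 hv
      exact ⟨n, p, Prod.ext hn h, Or.inl ⟨hn', hp⟩⟩
    · obtain ⟨n, hn, hn'⟩ := mem_middleBC_iff.1 hv
      exact ⟨n, p, Prod.ext hn h, Or.inr (Or.inl ⟨hn', hp⟩)⟩
    · obtain ⟨n, hn, hn'⟩ := mem_longBC_iff.1 hv
      exact ⟨_, p, Prod.ext hn h, Or.inr (Or.inr ⟨n, rfl, hn', hp⟩)⟩
  · rintro ⟨n, p, rfl, ⟨hn, hp⟩ | ⟨hn, hp⟩ | ⟨m, rfl, hn, hp⟩⟩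
    · exact Or.inl (Or.inl ⟨mem_shortBC_iff.2 ⟨n, rfl, hn⟩, p, hp, rfl⟩)
    · exact Or.inl (Or.inr ⟨mem_middleBC_iff.2 ⟨n, rfl, hn⟩, p, hp, rfl⟩)
    · exact Or.inr ⟨mem_longBC_iff.2 ⟨m, rfl, hn⟩, p, hp, rfl⟩

theorem realPt_injective {n m : Fin l → ℤ} {p q : ℤ × ℤ} (h : realPt n p = realPt m q) :
    n = m ∧ p = q := by
  simp only [realPt, Prod.mk.injEq] at h
  exact ⟨realVec_injective h.1, Prod.ext (by exact_mod_cast h.2.1) (by exact_mod_cast h.2.2)⟩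

theorem realPt_mem_rootsOf {S M E : Set (ℤ × ℤ)} {n : Fin l → ℤ} {p : ℤ × ℤ} :
    realPt n p ∈ rootsOf l S M E ↔ IsIntRoot S M E n p := by
  rw [mem_rootsOf_iff]
  refine ⟨fun ⟨m, q, h, h'⟩ => ?_, fun h => ⟨n, p, rfl, h⟩⟩
  obtain ⟨rfl, rfl⟩ := realPt_injective h
  exact h'

end

end MERS

/-! ### Reflections in integer coordinates. -/

namespace MERS

variable {l : ℕ}

theorem dotProduct_sq_le (n m : Fin l → ℤ) : (n ⬝ᵥ m) ^ 2 ≤ (n ⬝ᵥ n) * (m ⬝ᵥ m) := by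
  simpa [dotProduct, pow_two] using Finset.sum_mul_sq_le_sq_mul_sq Finset.univ n m

/-- Between roots of given lengths the Cartan integer is a fixed `c` times `0`, `1` or `-1`, so
stability under one step of size `c` suffices. -/
theorem sub_mul_smul_mem {X Y : Set (ℤ × ℤ)} {c d : ℤ} (hX : ∀ x ∈ X, -x ∈ X)
    (h : ∀ x ∈ X, ∀ y ∈ Y, y - c • x ∈ Y) (hd : d = 0 ∨ d = 1 ∨ d = -1) {x y : ℤ × ℤ}
    (hx : x ∈ X) (hy : y ∈ Y) : y - (c * d) • x ∈ Y := by
  rcases hd with rfl | rfl | rfl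
  · simpa using hy
  · simpa using h x hx y hy
  · simpa using h _ (hX x hx) y hy

theorem eq_of_sq_le {d : ℤ} (h : d ^ 2 ≤ 3) : d = 0 ∨ d = 1 ∨ d = -1 := by
  have h₁ : d < 2 := by nlinarith
  have h₂ : -2 < d := by nlinarith
  omega

theorem dotProduct_self_sub_smul {n m : Fin l → ℤ} {k : ℤ} (h : 2 * (n ⬝ᵥ m) = k * (n ⬝ᵥ n)) :
    (m - k • n) ⬝ᵥ (m - k • n) = m ⬝ᵥ m := by
  simp only [sub_dotProduct, dotProduct_sub, smul_dotProduct, dotProduct_smul, smul_eq_mul,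
    dotProduct_comm m n]
  linear_combination (-k) * h

/-- A case check over pairs of lengths. Writing a long vector as twice a short one, Cauchy–Schwarz
bounds every relevant product by `1` in absolute value, except between two middle vectors. -/
theorem isIntRoot_refl {S M E : Set (ℤ × ℤ)} (h : ReflClosed l S M E) {n m : Fin l → ℤ}
    {p q : ℤ × ℤ} (hn : IsIntRoot S M E n p) (hm : IsIntRoot S M E m q) :
    ∃ k : ℤ, 2 * (n ⬝ᵥ m) = k * (n ⬝ᵥ n) ∧ IsIntRoot S M E (m - k • n) (q - k • p) := by
  have cs := dotProduct_sq_le n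
  rcases hn with ⟨hn, hp⟩ | ⟨hn, hp⟩ | ⟨n, rfl, hn, hp⟩
  · rcases hm with ⟨hm, hq⟩ | ⟨hm, hq⟩ | ⟨m, rfl, hm, hq⟩
    · have hd := eq_of_sq_le ((cs m).trans (by rw [hn, hm]; norm_num))
      have hk : 2 * (n ⬝ᵥ m) = (2 * (n ⬝ᵥ m)) * (n ⬝ᵥ n) := by rw [hn, mul_one]
      exact ⟨_, hk, Or.inl ⟨(dotProduct_self_sub_smul hk).trans hm,
        sub_mul_smul_mem h.neg_short h.short_short hd hp hq⟩⟩
    · have hd := eq_of_sq_le ((cs m).trans (by rw [hn, hm]; norm_num))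
      have hk : 2 * (n ⬝ᵥ m) = (2 * (n ⬝ᵥ m)) * (n ⬝ᵥ n) := by rw [hn, mul_one]
      exact ⟨_, hk, Or.inr (Or.inl ⟨(dotProduct_self_sub_smul hk).trans hm,
        sub_mul_smul_mem h.neg_short h.short_middle hd hp hq⟩)⟩
    · have hd := eq_of_sq_le ((cs m).trans (by rw [hn, hm]; norm_num))
      have hk : 2 * (n ⬝ᵥ m) = (2 * (n ⬝ᵥ m)) * (n ⬝ᵥ n) := by rw [hn, mul_one]
      refine ⟨4 * (n ⬝ᵥ m), ?_, Or.inr (Or.inr ⟨m - (2 * (n ⬝ᵥ m)) • n, ?_,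
        (dotProduct_self_sub_smul hk).trans hm,
        sub_mul_smul_mem h.neg_short h.short_long hd hp hq⟩)⟩
      · rw [hn, dotProduct_smul, smul_eq_mul]; ring
      · rw [smul_sub, smul_smul]; congr 2; ring
  · rcases hm with ⟨hm, hq⟩ | ⟨hm, hq⟩ | ⟨m, rfl, hm, hq⟩
    · have hd := eq_of_sq_le ((cs m).trans (by rw [hn, hm]; norm_num))
      have hk : 2 * (n ⬝ᵥ m) = (1 * (n ⬝ᵥ m)) * (n ⬝ᵥ n) := by rw [hn]; ring
      exact ⟨_, hk, Or.inl ⟨(dotProduct_self_sub_smul hk).trans hm,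
        sub_mul_smul_mem h.neg_middle (by simpa using h.middle_short) hd hp hq⟩⟩
    · have hk : 2 * (n ⬝ᵥ m) = (n ⬝ᵥ m) * (n ⬝ᵥ n) := by rw [hn]; ring
      refine ⟨_, hk, Or.inr (Or.inl ⟨(dotProduct_self_sub_smul hk).trans hm, ?_⟩)⟩
      -- An even product is `0` or `±2` and uses `middle_middle`. An odd one uses
      -- `middle_middle_sub`; it forces `3 ≤ l`, as in the plane all middle vectors are `(±1, ±1)`
      -- and their products are even.
      by_cases hev : Even (n ⬝ᵥ m)
      · obtain ⟨d, hd⟩ := hev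
        rw [hd, ← two_mul]
        refine sub_mul_smul_mem h.neg_middle h.middle_middle (eq_of_sq_le ?_) hp hq
        have := (cs m).trans (by rw [hn, hm])
        rw [hd] at this
        nlinarith
      · have hl : 3 ≤ l := by
          by_contra hl
          apply hev
          obtain ⟨i, j, hij, hi, hj, -⟩ := exists_of_dotProduct_self_eq_two hn
          obtain ⟨i', j', hij', hi', hj', -⟩ := exists_of_dotProduct_self_eq_two hm
          have hi0 : i.1 = 0 ∧ j.1 = 1 ∧ i'.1 = 0 ∧ j'.1 = 1 ∧ l = 2 := by
            have := i.2; have := j.2; have := j'.2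
            simp only [Fin.lt_def] at hij hij'
            omega
          obtain rfl := hi0.2.2.2.2
          obtain rfl : i = 0 := Fin.ext hi0.1
          obtain rfl : j = 1 := Fin.ext hi0.2.1
          obtain rfl : i' = 0 := Fin.ext hi0.2.2.1
          obtain rfl : j' = 1 := Fin.ext hi0.2.2.2.1
          rw [dotProduct, Fin.sum_univ_two]
          rcases hi with hi | hi <;> rcases hj with hj | hj <;> rcases hi' with hi' | hi' <;>
            rcases hj' with hj' | hj' <;> rw [hi, hj, hi', hj'] <;> decide
        have hd : n ⬝ᵥ m = 0 ∨ n ⬝ᵥ m = 1 ∨ n ⬝ᵥ m = -1 := by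
          have h4 := (cs m).trans (by rw [hn, hm])
          have h₁ : n ⬝ᵥ m < 3 := by nlinarith
          have h₂ : -3 < n ⬝ᵥ m := by nlinarith
          rw [Int.even_iff] at hev
          omega
        rw [← one_mul (n ⬝ᵥ m)]
        exact sub_mul_smul_mem h.neg_middle (by simpa using h.middle_middle_sub hl) hd hp hq
    · have hd := eq_of_sq_le ((cs m).trans (by rw [hn, hm]; norm_num))
      have hk : 2 * (n ⬝ᵥ m) = (n ⬝ᵥ m) * (n ⬝ᵥ n) := by rw [hn]; ring
      refine ⟨2 * (n ⬝ᵥ m), ?_, Or.inr (Or.inr ⟨m - (n ⬝ᵥ m) • n, ?_,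
        (dotProduct_self_sub_smul hk).trans hm,
        sub_mul_smul_mem h.neg_middle h.middle_long hd hp hq⟩)⟩
      · rw [hn, dotProduct_smul, smul_eq_mul]; ring
      · rw [smul_sub, smul_smul]
  · have cs := dotProduct_sq_le n
    have hnn : ((2 : ℤ) • n) ⬝ᵥ ((2 : ℤ) • n) = 4 := by
      simp only [smul_dotProduct, dotProduct_smul, hn, smul_eq_mul]; norm_num
    rcases hm with ⟨hm, hq⟩ | ⟨hm, hq⟩ | ⟨m, rfl, hm, hq⟩
    · have hd := eq_of_sq_le ((cs m).trans (by rw [hn, hm]; norm_num))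
      have hk : 2 * (((2 : ℤ) • n) ⬝ᵥ m) = (1 * (n ⬝ᵥ m)) * (((2 : ℤ) • n) ⬝ᵥ ((2 : ℤ) • n)) := by
        rw [hnn, smul_dotProduct, smul_eq_mul]; ring
      exact ⟨_, hk, Or.inl ⟨(dotProduct_self_sub_smul hk).trans hm,
        sub_mul_smul_mem h.neg_long (by simpa using h.long_short) hd hp hq⟩⟩
    · have hd := eq_of_sq_le ((cs m).trans (by rw [hn, hm]; norm_num))
      have hk : 2 * (((2 : ℤ) • n) ⬝ᵥ m) = (1 * (n ⬝ᵥ m)) * (((2 : ℤ) • n) ⬝ᵥ ((2 : ℤ) • n)) := by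
        rw [hnn, smul_dotProduct, smul_eq_mul]; ring
      exact ⟨_, hk, Or.inr (Or.inl ⟨(dotProduct_self_sub_smul hk).trans hm,
        sub_mul_smul_mem h.neg_long (by simpa using h.long_middle) hd hp hq⟩)⟩
    · have hd := eq_of_sq_le ((cs m).trans (by rw [hn, hm]; norm_num))
      have hk : 2 * (n ⬝ᵥ m) = (2 * (n ⬝ᵥ m)) * (n ⬝ᵥ n) := by rw [hn, mul_one]
      refine ⟨2 * (n ⬝ᵥ m), ?_, Or.inr (Or.inr ⟨m - (2 * (n ⬝ᵥ m)) • n, ?_,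
        (dotProduct_self_sub_smul hk).trans hm,
        sub_mul_smul_mem h.neg_long h.long_long hd hp hq⟩)⟩
      · rw [hnn, smul_dotProduct, dotProduct_smul, smul_eq_mul, smul_eq_mul]; ring
      · rw [smul_sub, smul_comm]

end MERS

/-! ### The standard models as marked elliptic root systems. -/

namespace MERS

section

variable {F : Type*} [NormedAddCommGroup F] [NormedSpace ℝ F] {I : LinearMap.BilinForm ℝ F}

theorem coroot_apply (α β : F) : I (coroot I α) β = 2 / I α α * I α β := by
  simp [coroot]

theorem coroot_apply_eq_iff {α β : F} (h : I α α ≠ 0) (k : ℝ) :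
    I (coroot I α) β = k ↔ 2 * I α β = k * I α α := by
  rw [coroot_apply, div_mul_eq_mul_div, div_eq_iff h]

theorem refl_eq (hI : ∀ x y, I x y = I y x) {α β : F} (h : I α α ≠ 0) {k : ℝ}
    (hk : 2 * I α β = k * I α α) : refl I α β = β - k • α := by
  rw [refl, hI, (coroot_apply_eq_iff h k).2 hk]

theorem refl_refl (hI : ∀ x y, I x y = I y x) {α : F} (h : I α α ≠ 0) (β : F) :
    refl I α (refl I α β) = β := by
  obtain ⟨k, hk⟩ : ∃ k, 2 * I α β = k * I α α := ⟨_, (coroot_apply_eq_iff h _).1 rfl⟩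
  rw [refl_eq hI h hk, refl_eq hI h (k := -k)]
  · simp
  · simp only [map_sub, map_smul, smul_eq_mul]
    linear_combination hk

end

variable {l : ℕ}

theorem form_apply (x y : Space l) : form l x y = x.1 ⬝ᵥ y.1 := rfl

theorem form_comm (x y : Space l) : form l x y = form l y x := by
  rw [form_apply, form_apply, dotProduct_comm]

theorem form_realPt (n m : Fin l → ℤ) (p q : ℤ × ℤ) :
    form l (realPt n p) (realPt m q) = ((n ⬝ᵥ m : ℤ) : ℝ) := realVec_dotProduct n m

theorem realPt_sub_smul (n m : Fin l → ℤ) (p q : ℤ × ℤ) (k : ℤ) :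
    realPt (m - k • n) (q - k • p) = realPt m q - (k : ℝ) • realPt n p := by
  simp [realPt, realVec_sub, realVec_smul, -zsmul_eq_mul]

theorem IsIntRoot.dotProduct_self_pos {S M E : Set (ℤ × ℤ)} {n : Fin l → ℤ} {p : ℤ × ℤ}
    (h : IsIntRoot S M E n p) : 0 < n ⬝ᵥ n := by
  rcases h with ⟨h, -⟩ | ⟨h, -⟩ | ⟨m, rfl, h, -⟩
  · omega
  · omega
  · simp [h, -zsmul_eq_mul]

/-- The standard basis `ε_1, …, ε_l, a, b`. -/
noncomputable def spaceBasis (l : ℕ) : Module.Basis (Fin l ⊕ Fin 2) ℝ (Space l) :=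
  (Pi.basisFun ℝ (Fin l)).prod (Module.Basis.finTwoProd ℝ)

theorem hasSignature_form (l : ℕ) : HasSignature (form l) l 2 0 := by
  refine ⟨(spaceBasis l).reindex (Equiv.sumCongr (Equiv.refl _) (Equiv.sumEmpty _ _).symm),
    ?_, ?_, ?_, ?_⟩
  · rintro (i | i | i) (j | j | j) hij
    all_goals first | exact i.elim0 | exact j.elim0 | skip
    · have : i ≠ j := fun h => hij (by rw [h])
      simp [spaceBasis, form_apply, this]
    all_goals simp [spaceBasis, form_apply]
  · intro i; simp [spaceBasis, form_apply]
  · intro i; simp [spaceBasis, form_apply]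
  · exact fun i => i.elim0

theorem realPt_mem_span (n : Fin l → ℤ) (p : ℤ × ℤ) :
    realPt n p ∈ Submodule.span ℤ (Set.range (spaceBasis l)) := by
  rw [Module.Basis.mem_span_iff_repr_mem]
  rintro (i | i)
  · exact ⟨n i, by simp [spaceBasis, realPt, realVec]⟩
  · fin_cases i
    · exact ⟨p.1, by simp [spaceBasis, realPt]⟩
    · exact ⟨p.2, by simp [spaceBasis, realPt]⟩

theorem rootLattice_rootsOf_le (S M E : Set (ℤ × ℤ)) :
    rootLattice (rootsOf l S M E) ≤ Submodule.span ℤ (Set.range (spaceBasis l)) := by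
  refine Submodule.span_le.2 fun v hv => ?_
  obtain ⟨n, p, rfl, -⟩ := mem_rootsOf_iff.1 hv
  exact realPt_mem_span n p

/-- The root system `rootsOf l S M E` for suitable translation sets. -/
theorem isMarkedElliptic_rootsOf (hl : 1 ≤ l) {S M E : Set (ℤ × ℤ)} (h : ReflClosed l S M E)
    (ha : ∃ p ∈ S, p + (1, 0) ∈ S) (hb : ∃ p ∈ S, p + (0, 1) ∈ S) (hM : M.Nonempty) :
    IsMarkedElliptic l (form l) (rootsOf l S M E) (lineA l) := by
  have hshort : ∀ i, ∀ p ∈ S, realPt (Pi.single i 1) p ∈ rootsOf l S M E := fun i p hp =>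
    realPt_mem_rootsOf.2 (Or.inl ⟨by simp, hp⟩)
  have hQ : ∀ v ∈ rootsOf l S M E, v ∈ rootLattice (rootsOf l S M E) := fun v hv =>
    Submodule.subset_span hv
  obtain ⟨pa, hpa, hpa'⟩ := ha
  obtain ⟨pb, hpb, hpb'⟩ := hb
  have hA : vecA l ∈ rootLattice (rootsOf l S M E) := by
    have e : vecA l = realPt (Pi.single ⟨0, hl⟩ 1) (pa + (1, 0)) - realPt (Pi.single ⟨0, hl⟩ 1) pa := by
      simp [vecA, realPt]
    rw [e]
    exact Submodule.sub_mem _ (hQ _ (hshort _ _ hpa')) (hQ _ (hshort _ _ hpa))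
  have hB : ((0, (0, 1)) : Space l) ∈ rootLattice (rootsOf l S M E) := by
    have e : ((0, (0, 1)) : Space l) =
        realPt (Pi.single ⟨0, hl⟩ 1) (pb + (0, 1)) - realPt (Pi.single ⟨0, hl⟩ 1) pb := by
      simp [realPt]
    rw [e]
    exact Submodule.sub_mem _ (hQ _ (hshort _ _ hpb')) (hQ _ (hshort _ _ hpb))
  have hdisc : DiscreteTopology (rootLattice (rootsOf l S M E)) :=
    DiscreteTopology.of_subset (s := (Submodule.span ℤ (Set.range (spaceBasis l)) : Set (Space l)))
      (inferInstanceAs (DiscreteTopology (Submodule.span ℤ (Set.range (spaceBasis l)))))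
      (rootLattice_rootsOf_le S M E)
  have hne : ∀ α ∈ rootsOf l S M E, form l α α ≠ 0 := by
    intro α hα
    obtain ⟨n, p, rfl, hn⟩ := mem_rootsOf_iff.1 hα
    rw [form_realPt]
    exact_mod_cast hn.dotProduct_self_pos.ne'
  have hrefl : ∀ α ∈ rootsOf l S M E, ∀ β ∈ rootsOf l S M E, ∃ k : ℤ,
      2 * form l α β = k * form l α α ∧ refl (form l) α β ∈ rootsOf l S M E := by
    intro α hα β hβ
    have hα0 := hne α hα
    obtain ⟨n, p, rfl, hn⟩ := mem_rootsOf_iff.1 hα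
    obtain ⟨m, q, rfl, hm⟩ := mem_rootsOf_iff.1 hβ
    obtain ⟨k, hk, hk'⟩ := isIntRoot_refl h hn hm
    have hkR : 2 * form l (realPt n p) (realPt m q) = (k : ℝ) * form l (realPt n p) (realPt n p) := by
      simp only [form_realPt]; exact_mod_cast hk
    refine ⟨k, hkR, ?_⟩
    rw [refl_eq form_comm hα0 hkR, ← realPt_sub_smul, realPt_mem_rootsOf]
    exact hk'
  refine ⟨form_comm, hasSignature_form l, ⟨⟨_, hshort ⟨0, hl⟩ _ hpa⟩, ?_, hdisc, ?_, hne, ?_, ?_, ?_⟩,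
    ⟨?_, ?_, ?_⟩⟩
  · exact DiscreteTopology.of_subset (s := (rootLattice (rootsOf l S M E) : Set (Space l)))
      hdisc Submodule.subset_span
  · rw [eq_top_iff, ← (spaceBasis l).span_eq, Submodule.span_le]
    have hsub := Submodule.subset_span (R := ℝ) (s := (rootLattice (rootsOf l S M E) : Set (Space l)))
    rintro _ ⟨i | i, rfl⟩
    · have e : spaceBasis l (Sum.inl i) = realPt (Pi.single i 1) pa -
          ((pa.1 : ℝ) • vecA l + (pa.2 : ℝ) • ((0, (0, 1)) : Space l)) := by
        simp [spaceBasis, realPt, vecA, realVec_single]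
      rw [e]
      exact Submodule.sub_mem _ (hsub (hQ _ (hshort _ _ hpa))) (Submodule.add_mem _
        (Submodule.smul_mem _ _ (hsub hA)) (Submodule.smul_mem _ _ (hsub hB)))
    · fin_cases i
      · convert hsub hA using 1
        simp [spaceBasis, vecA]
      · convert hsub hB using 1
        simp [spaceBasis]
  · intro α hα β hβ
    obtain ⟨k, hk, -⟩ := hrefl α hα β hβ
    exact ⟨k, (coroot_apply_eq_iff (hne α hα) _).2 hk⟩
  · intro α hα
    refine Set.Subset.antisymm ?_ fun β hβ => ?_
    · rintro _ ⟨β, hβ, rfl⟩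
      exact (hrefl α hα β hβ).choose_spec.2
    · exact ⟨_, (hrefl α hα β hβ).choose_spec.2, refl_refl form_comm (hne α hα) β⟩
  · intro R₁ R₂ hR horth
    -- A root in `R₂` is orthogonal to the first frame vector, so it has a nonzero coordinate at
    -- another index `i`. The middle root over `ε_0 + ε_i` is then orthogonal neither to it nor to
    -- the first frame vector, and fits into neither part.
    have key : ∀ R₁ R₂ : Set (Space l), R₁ ∪ R₂ = rootsOf l S M E →
        (∀ α ∈ R₁, ∀ β ∈ R₂, form l α β = 0) → realPt (Pi.single ⟨0, hl⟩ 1) pa ∈ R₁ → R₂ = ∅ := by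
      intro R₁ R₂ hR horth h1
      refine Set.eq_empty_of_forall_notMem fun β hβ => ?_
      obtain ⟨n, p, rfl, hn⟩ := mem_rootsOf_iff.1 (hR.subset (Or.inr hβ))
      have h0 : n ⟨0, hl⟩ = 0 := by
        have := horth _ h1 _ hβ
        rw [form_realPt] at this
        simpa using this
      have hn0 : n ≠ 0 := fun h0 => by have := hn.dotProduct_self_pos; simp [h0] at this
      obtain ⟨i, hi⟩ := Function.ne_iff.1 hn0
      have hi0 : i ≠ ⟨0, hl⟩ := fun h => hi (h ▸ h0)
      obtain ⟨q, hq⟩ := hM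
      have hγ : realPt (Pi.single ⟨0, hl⟩ 1 + Pi.single i 1) q ∈ R₁ ∪ R₂ := by
        rw [hR, realPt_mem_rootsOf]
        exact Or.inr (Or.inl ⟨by simp [hi0, hi0.symm], hq⟩)
      rcases hγ with hγ | hγ
      · have := horth _ hγ _ hβ
        rw [form_realPt] at this
        simp [h0] at this
        exact hi this
      · have := horth _ h1 _ hγ
        rw [form_realPt] at this
        simp [hi0.symm] at this
    have h1 : realPt (Pi.single ⟨0, hl⟩ 1) pa ∈ R₁ ∪ R₂ := hR.superset (hshort _ _ hpa)
    rcases h1 with h1 | h1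
    · exact Or.inr (key R₁ R₂ hR horth h1)
    · exact Or.inl (key R₂ R₁ ((Set.union_comm _ _).trans hR)
        (fun α hα β hβ => (form_comm _ _).trans (horth β hβ α hα)) h1)
  · rw [lineA, Submodule.span_singleton_le_iff_mem, LinearMap.mem_ker]
    ext x <;> simp [vecA, form_apply]
  · exact finrank_span_singleton (by simp [vecA])
  · refine le_antisymm (Submodule.span_le.2 fun x hx => hx.1) ?_
    rw [lineA, Submodule.span_singleton_le_iff_mem]
    exact Submodule.subset_span ⟨Submodule.mem_span_singleton_self _, hA⟩

namespace EllipticType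

theorem isMarkedElliptic_roots {t : EllipticType} (ht : t.Admissible l) :
    IsMarkedElliptic l (form l) (t.roots l) (lineA l) :=
  isMarkedElliptic_rootsOf (one_le_of_admissible ht) (reflClosed ht) t.exists_short_add_a
    t.exists_short_add_b t.middleSet_nonempty

theorem not_isReduced_roots {t : EllipticType} (ht : t.Admissible l) : ¬ IsReduced (t.roots l) := by
  intro h
  obtain ⟨p, hp, hp'⟩ := t.exists_two_smul_mem
  refine (h (realPt (Pi.single ⟨0, one_le_of_admissible ht⟩ 1) p)
    (realPt_mem_rootsOf.2 (Or.inl ⟨by simp, hp⟩))).1 ?_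
  have e : (2 : ℝ) • realPt (Pi.single (⟨0, one_le_of_admissible ht⟩ : Fin l) 1) p =
      realPt ((2 : ℤ) • Pi.single ⟨0, one_le_of_admissible ht⟩ 1) ((2 : ℤ) • p) := by
    simp [realPt, realVec_smul, -zsmul_eq_mul]
  rw [e]
  exact realPt_mem_rootsOf.2 (Or.inr (Or.inr ⟨_, rfl, by simp, hp'⟩))

end EllipticType

/-! ### The quotient of a standard model by its marking. -/

/-- The projection `ℝ^l ⊕ ℝ a ⊕ ℝ b → ℝ^l ⊕ ℝ b` along `a`. -/
def forgetA (l : ℕ) : Space l →ₗ[ℝ] (Fin l → ℝ) × ℝ :=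
  (LinearMap.id).prodMap (LinearMap.snd ℝ ℝ ℝ)

theorem ker_forgetA (l : ℕ) : LinearMap.ker (forgetA l) = lineA l := by
  ext ⟨v, x, y⟩
  rw [lineA, Submodule.mem_span_singleton, LinearMap.mem_ker]
  constructor
  · intro h
    simp only [forgetA, LinearMap.prodMap_apply, LinearMap.id_coe, id_eq, LinearMap.snd_apply,
      Prod.mk_eq_zero] at h
    exact ⟨x, by simp [vecA, h]⟩
  · rintro ⟨c, h⟩
    simp only [vecA, Prod.smul_mk, smul_zero, Prod.mk.injEq] at h
    simp [forgetA, ← h.1, ← h.2.2]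

theorem range_forgetA (l : ℕ) : LinearMap.range (forgetA l) = ⊤ :=
  LinearMap.range_eq_top.2 fun v => ⟨(v.1, (0, v.2)), rfl⟩

/-- The identification of the quotient by `ℝ a` with `ℝ^l ⊕ ℝ b`. -/
noncomputable def quotientEquiv (l : ℕ) : (Space l ⧸ lineA l) ≃ₗ[ℝ] (Fin l → ℝ) × ℝ :=
  (Submodule.quotEquivOfEq _ _ (ker_forgetA l).symm).trans
    ((forgetA l).quotKerEquivOfSurjective (LinearMap.range_eq_top.1 (range_forgetA l)))

theorem quotientEquiv_mkQ (v : Space l) : quotientEquiv l ((lineA l).mkQ v) = forgetA l v := rfl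

theorem EllipticType.quotientEquiv_image (t : EllipticType) (l : ℕ) :
    quotientEquiv l '' quotientRoots (t.roots l) (lineA l) = t.quotient.roots l := by
  rw [quotientRoots, Set.image_image]
  simp only [quotientEquiv_mkQ]
  ext ⟨v, y⟩
  constructor
  · rintro ⟨⟨w, x, z⟩, ((⟨hw, p, hp, h⟩ | ⟨hw, p, hp, h⟩) | ⟨hw, p, hp, h⟩), he⟩
    all_goals
      obtain ⟨rfl, rfl⟩ : w = v ∧ z = y := by simpa [forgetA] using he
      obtain ⟨-, h⟩ := Prod.mk.injEq .. ▸ h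
    · exact Or.inl (Or.inl ⟨hw, p.2, h⟩)
    · exact Or.inl (Or.inr ⟨hw, p.2, (t.exists_fst_mem_middle_iff _).1 ⟨p.1, hp⟩, h⟩)
    · exact Or.inr ⟨hw, p.2, (t.exists_fst_mem_long_iff _).1 ⟨p.1, hp⟩, h⟩
  · rintro ((⟨hv, n, h⟩ | ⟨hv, n, hn, h⟩) | ⟨hv, n, hn, h⟩)
    · obtain ⟨m, hm⟩ := t.exists_fst_mem_short n
      exact ⟨(v, (m, n)), Or.inl (Or.inl ⟨hv, _, hm, rfl⟩), Prod.ext rfl h.symm⟩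
    · obtain ⟨m, hm⟩ := (t.exists_fst_mem_middle_iff n).2 hn
      exact ⟨(v, (m, n)), Or.inl (Or.inr ⟨hv, _, hm, rfl⟩), Prod.ext rfl h.symm⟩
    · obtain ⟨m, hm⟩ := (t.exists_fst_mem_long_iff n).2 hn
      exact ⟨(v, (m, n)), Or.inr ⟨hv, _, hm, rfl⟩, Prod.ext rfl h.symm⟩

end MERS

namespace MERS

variable {l : ℕ}

/-! ### Changes of frame are isomorphisms -/

/-- A change of frame shifts the root with coordinates `n` by `∑ n_j ξ_j`. Up to sign this is one of
the shifts in `FrameChange`; the sign is absorbed by `mem_iff_shear_neg`. -/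
theorem vecCombo_eq_of_short {n : Fin l → ℤ} (hn : n ⬝ᵥ n = 1) (ξ : Fin l → ℤ × ℤ) :
    ∃ i, ∑ j, n j • ξ j = ξ i ∨ ∑ j, n j • ξ j = -ξ i := by
  obtain ⟨i, -, h1, h0⟩ := exists_eq_of_sum_sq_eq_one (s := Finset.univ) (n := n) hn
  refine ⟨i, ?_⟩
  rw [Finset.sum_eq_single_of_mem i (Finset.mem_univ _)
    fun j hj hji => by rw [h0 j hj hji, zero_smul]]
  rcases h1 with h1 | h1 <;> simp [h1]

theorem vecCombo_eq_of_middle {n : Fin l → ℤ} (hn : n ⬝ᵥ n = 2) (ξ : Fin l → ℤ × ℤ) :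
    ∃ i j, i ≠ j ∧ (∑ k, n k • ξ k = ξ i + ξ j ∨ ∑ k, n k • ξ k = -(ξ i + ξ j) ∨
      ∑ k, n k • ξ k = ξ i - ξ j) := by
  obtain ⟨i, j, hij, h1, h2, h⟩ := exists_of_dotProduct_self_eq_two hn
  have hsum : ∑ k, n k • ξ k = n i • ξ i + n j • ξ j := by
    rw [h]
    simp only [Pi.add_apply, add_smul, Finset.sum_add_distrib]
    rw [Finset.sum_eq_single_of_mem i (Finset.mem_univ _) fun k _ hk => by simp [hk],
      Finset.sum_eq_single_of_mem j (Finset.mem_univ _) fun k _ hk => by simp [hk]]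
    simp [hij.ne, hij.ne']
  rw [hsum]
  rcases h1 with h1 | h1 <;> rcases h2 with h2 | h2 <;> rw [h1, h2]
  · exact ⟨i, j, hij.ne, Or.inl (by simp)⟩
  · exact ⟨i, j, hij.ne, Or.inr (Or.inr (by simp [sub_eq_add_neg]))⟩
  · exact ⟨j, i, hij.ne', Or.inr (Or.inr (by simp [sub_eq_add_neg, add_comm]))⟩
  · exact ⟨i, j, hij.ne, Or.inr (Or.inl (by simp [add_comm]))⟩

theorem shear_neg (k : ℤ) (p : ℤ × ℤ) : shear k (-p) = -shear k p := by
  ext <;> simp [shear]; ring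

theorem mem_iff_shear_neg {k : ℤ} {X X' : Set (ℤ × ℤ)} (hX : ∀ x ∈ X, -x ∈ X)
    (hX' : ∀ x ∈ X', -x ∈ X') {η : ℤ × ℤ} (h : ∀ p, p ∈ X ↔ shear k p + η ∈ X') (p : ℤ × ℤ) :
    p ∈ X ↔ shear k p + -η ∈ X' := by
  have h₁ : p ∈ X ↔ -p ∈ X := ⟨hX p, fun h => by simpa using hX _ h⟩
  have h₂ : shear k p + -η ∈ X' ↔ -(shear k p + -η) ∈ X' :=
    ⟨hX' _, fun h => by simpa using hX' _ h⟩
  rw [h₁, h₂, h, shear_neg]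
  congr! 1
  abel

theorem FrameChange.isIntRoot_iff {k : ℤ} {ξ : Fin l → ℤ × ℤ} {S M E S' M' E' : Set (ℤ × ℤ)}
    (h : FrameChange l k ξ S M E S' M' E') (hS : ∀ x ∈ S, -x ∈ S) (hM : ∀ x ∈ M, -x ∈ M)
    (hE : ∀ x ∈ E, -x ∈ E) (hS' : ∀ x ∈ S', -x ∈ S') (hM' : ∀ x ∈ M', -x ∈ M')
    (hE' : ∀ x ∈ E', -x ∈ E') (n : Fin l → ℤ) (p : ℤ × ℤ) :
    IsIntRoot S M E n p ↔ IsIntRoot S' M' E' n (shear k p + ∑ i, n i • ξ i) := by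
  refine or_congr (and_congr_right fun hn => ?_) (or_congr (and_congr_right fun hn => ?_)
    (exists_congr fun m => and_congr_right fun hm => and_congr_right fun hn => ?_))
  · obtain ⟨i, hi | hi⟩ := vecCombo_eq_of_short hn ξ <;> rw [hi]
    · exact h.short i p
    · exact mem_iff_shear_neg hS hS' (h.short i) p
  · obtain ⟨i, j, hij, hi | hi | hi⟩ := vecCombo_eq_of_middle hn ξ <;> rw [hi]
    · exact h.middle_add i j hij p
    · exact mem_iff_shear_neg hM hM' (h.middle_add i j hij) p
    · exact h.middle_sub i j hij p
  · have e : ∑ i, n i • ξ i = (2 : ℤ) • ∑ i, m i • ξ i := by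
      simp only [hm, Finset.smul_sum, Pi.smul_apply, smul_assoc]
    rw [e]
    obtain ⟨i, hi | hi⟩ := vecCombo_eq_of_short hn ξ <;> rw [hi]
    · exact h.long i p
    · rw [smul_neg]; exact mem_iff_shear_neg hE hE' (h.long i) p

/-- The linear map underlying a change of frame. -/
def frameMap (k : ℝ) (ξ : Fin l → ℝ × ℝ) : Space l →ₗ[ℝ] Space l where
  toFun v := (v.1, (v.2.1 + k * v.2.2, v.2.2) + ∑ i, v.1 i • ξ i)
  map_add' v w := by
    ext <;> simp [add_smul, Finset.sum_add_distrib] <;> ring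
  map_smul' c v := by
    ext <;> simp [mul_smul, ← Finset.smul_sum]; ring

theorem frameMap_apply (k : ℝ) (ξ : Fin l → ℝ × ℝ) (v : Space l) :
    frameMap k ξ v = (v.1, (v.2.1 + k * v.2.2, v.2.2) + ∑ i, v.1 i • ξ i) := rfl

/-- To undo the map, the shift `-ξ_i` has to be sheared by `-k`, which gives `(k ξ_{i,2} - ξ_{i,1},
-ξ_{i,2})`. -/
theorem frameMap_comp (k : ℝ) (ξ : Fin l → ℝ × ℝ) (v : Space l) :
    frameMap (-k) (fun i => (k * (ξ i).2 - (ξ i).1, -(ξ i).2)) (frameMap k ξ v) = v := by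
  ext i
  · simp [frameMap_apply]
  · simp only [frameMap_apply, Prod.fst_add, Prod.snd_add, Prod.fst_sum, Prod.snd_sum,
      Prod.smul_fst, Prod.smul_snd, smul_eq_mul, mul_sub, Finset.sum_sub_distrib, mul_left_comm _ k,
      ← Finset.mul_sum]
    ring
  · simp [frameMap_apply, Prod.snd_sum]

/-- The linear isomorphism underlying a change of frame. -/
def frameEquiv (k : ℝ) (ξ : Fin l → ℝ × ℝ) : Space l ≃ₗ[ℝ] Space l :=
  LinearEquiv.ofLinearMap (frameMap k ξ) (frameMap (-k) fun i => (k * (ξ i).2 - (ξ i).1, -(ξ i).2))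
    (LinearMap.ext fun v => by
      have h := frameMap_comp (-k) (fun i => (k * (ξ i).2 - (ξ i).1, -(ξ i).2)) v
      simpa using h)
    (LinearMap.ext (frameMap_comp k ξ))

theorem frameEquiv_realPt (k : ℤ) (ξ : Fin l → ℤ × ℤ) (n : Fin l → ℤ) (p : ℤ × ℤ) :
    frameEquiv k (fun i => (((ξ i).1 : ℝ), ((ξ i).2 : ℝ))) (realPt n p) =
      realPt n (shear k p + ∑ i, n i • ξ i) := by
  change frameMap _ _ _ = _
  ext
  · rfl
  · simp [frameMap_apply, realPt, realVec, shear, Prod.fst_sum]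
  · simp [frameMap_apply, realPt, realVec, shear, Prod.snd_sum]

theorem image_lineA (e : Space l ≃ₗ[ℝ] Space l) (h : e (vecA l) = vecA l) :
    e '' (lineA l : Set (Space l)) = lineA l := by
  have := congrArg (fun N : Submodule ℝ (Space l) => (N : Set (Space l)))
    (Submodule.map_span (e : Space l →ₗ[ℝ] Space l) {vecA l})
  simpa [h, lineA] using this

theorem FrameChange.markedSimilar {k : ℤ} {ξ : Fin l → ℤ × ℤ} {S M E S' M' E' : Set (ℤ × ℤ)}
    (h : FrameChange l k ξ S M E S' M' E') (hS : ∀ x ∈ S, -x ∈ S) (hM : ∀ x ∈ M, -x ∈ M)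
    (hE : ∀ x ∈ E, -x ∈ E) (hS' : ∀ x ∈ S', -x ∈ S') (hM' : ∀ x ∈ M', -x ∈ M')
    (hE' : ∀ x ∈ E', -x ∈ E') :
    MarkedSimilar (form l) (rootsOf l S M E) (lineA l)
      (form l) (rootsOf l S' M' E') (lineA l) := by
  refine ⟨frameEquiv k fun i => (((ξ i).1 : ℝ), ((ξ i).2 : ℝ)), ?_, ?_, 1, one_pos, ?_⟩
  · ext v
    constructor
    · rintro ⟨v, hv, rfl⟩
      obtain ⟨n, p, rfl, hn⟩ := mem_rootsOf_iff.1 hv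
      rw [frameEquiv_realPt, realPt_mem_rootsOf]
      exact (h.isIntRoot_iff hS hM hE hS' hM' hE' n p).1 hn
    · intro hv
      obtain ⟨n, q, rfl, hn⟩ := mem_rootsOf_iff.1 hv
      have e : q = shear k (shear (-k) (q - ∑ i, n i • ξ i)) + ∑ i, n i • ξ i := by
        ext <;> simp [shear]
      rw [e] at hn ⊢
      exact ⟨_, realPt_mem_rootsOf.2 ((h.isIntRoot_iff hS hM hE hS' hM' hE' n _).2 hn),
        frameEquiv_realPt _ _ _ _⟩
  · refine image_lineA _ ?_
    change frameMap _ _ _ = _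
    ext <;> simp [frameMap_apply, vecA]
  · intro x y
    rw [one_mul]; rfl

end MERS

namespace MERS

variable {l : ℕ}

/-! ### Uniqueness -/

/-- Applied to coordinates of the images of the roots `α + 4 j z`, where `j` runs through `ℤ`: it
shows that a linear isomorphism respects the radical even if it is not assumed to respect the form.
-/
theorem eq_zero_of_bounded {c w : ℝ} (h : ∀ j : ℤ, |c + j * w| ≤ 2) : w = 0 := by
  by_contra hw
  obtain ⟨n, hn⟩ := exists_nat_gt (4 / |w|)
  have hw' : 0 < |w| := abs_pos.2 hw
  rw [div_lt_iff₀ hw'] at hn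
  have h0 := h 0
  have h1 := h n
  have h2 : |(n : ℝ) * w| ≤ |c + (n : ℤ) * w| + |c + (0 : ℤ) * w| := by
    have := abs_sub (c + (n : ℤ) * w) (c + (0 : ℤ) * w)
    simpa using this
  rw [abs_mul, Nat.abs_cast] at h2
  linarith

theorem IsIntRoot.dotProduct_self {S M E : Set (ℤ × ℤ)} {n : Fin l → ℤ} {p : ℤ × ℤ}
    (h : IsIntRoot S M E n p) : n ⬝ᵥ n = 1 ∨ n ⬝ᵥ n = 2 ∨ n ⬝ᵥ n = 4 := by
  rcases h with ⟨h, -⟩ | ⟨h, -⟩ | ⟨m, rfl, h, -⟩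
  · exact Or.inl h
  · exact Or.inr (Or.inl h)
  · exact Or.inr (Or.inr (by simp [h, -zsmul_eq_mul]))

theorem abs_le_two_of_mem_rootsOf {S M E : Set (ℤ × ℤ)} {v : Space l} (h : v ∈ rootsOf l S M E)
    (i : Fin l) : |v.1 i| ≤ 2 := by
  obtain ⟨n, p, rfl, hn⟩ := mem_rootsOf_iff.1 h
  have h4 : n ⬝ᵥ n ≤ 4 := by have := hn.dotProduct_self; omega
  have hi : n i * n i ≤ n ⬝ᵥ n := Finset.single_le_sum (f := fun i => n i * n i)
    (fun j _ => mul_self_nonneg _) (Finset.mem_univ i)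
  have : |n i| ≤ 2 := abs_le.2 ⟨by nlinarith, by nlinarith⟩
  change |(n i : ℝ)| ≤ 2
  exact_mod_cast this

/-- The real point with the given integer coordinates. -/
def realPair (p : ℤ × ℤ) : ℝ × ℝ := ((p.1 : ℝ), (p.2 : ℝ))

theorem realPair_injective : Function.Injective realPair := fun p q h => by
  simp only [realPair, Prod.mk.injEq] at h
  exact Prod.ext (by exact_mod_cast h.1) (by exact_mod_cast h.2)

theorem mem_rootsOf_short_iff {S M E : Set (ℤ × ℤ)} {n : Fin l → ℤ} (hn : n ⬝ᵥ n = 1)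
    (q : ℝ × ℝ) : (realVec n, q) ∈ rootsOf l S M E ↔ ∃ p ∈ S, q = realPair p := by
  rw [mem_rootsOf_iff]
  constructor
  · rintro ⟨m, p, h, hm⟩
    obtain rfl := realVec_injective (Prod.ext_iff.1 h).1
    rcases hm with ⟨-, hp⟩ | ⟨h', -⟩ | ⟨m, rfl, h', -⟩
    · exact ⟨p, hp, (Prod.ext_iff.1 h).2⟩
    · omega
    · simp [h', -zsmul_eq_mul] at hn
  · rintro ⟨p, hp, rfl⟩
    exact ⟨n, p, rfl, Or.inl ⟨hn, hp⟩⟩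

theorem mem_rootsOf_middle_iff {S M E : Set (ℤ × ℤ)} {n : Fin l → ℤ} (hn : n ⬝ᵥ n = 2)
    (q : ℝ × ℝ) : (realVec n, q) ∈ rootsOf l S M E ↔ ∃ p ∈ M, q = realPair p := by
  rw [mem_rootsOf_iff]
  constructor
  · rintro ⟨m, p, h, hm⟩
    obtain rfl := realVec_injective (Prod.ext_iff.1 h).1
    rcases hm with ⟨h', -⟩ | ⟨-, hp⟩ | ⟨m, rfl, h', -⟩
    · omega
    · exact ⟨p, hp, (Prod.ext_iff.1 h).2⟩
    · simp [h', -zsmul_eq_mul] at hn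
  · rintro ⟨p, hp, rfl⟩
    exact ⟨n, p, rfl, Or.inr (Or.inl ⟨hn, hp⟩)⟩

theorem mem_rootsOf_long_iff {S M E : Set (ℤ × ℤ)} {n : Fin l → ℤ} (hn : n ⬝ᵥ n = 1)
    (q : ℝ × ℝ) : (realVec ((2 : ℤ) • n), q) ∈ rootsOf l S M E ↔ ∃ p ∈ E, q = realPair p := by
  have hn4 : ((2 : ℤ) • n) ⬝ᵥ ((2 : ℤ) • n) = 4 := by simp [hn, -zsmul_eq_mul]
  rw [mem_rootsOf_iff]
  constructor
  · rintro ⟨m, p, h, hm⟩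
    obtain rfl := realVec_injective (Prod.ext_iff.1 h).1
    rcases hm with ⟨h', -⟩ | ⟨h', -⟩ | ⟨m, hm, h', hp⟩
    · omega
    · omega
    · exact ⟨p, hp, (Prod.ext_iff.1 h).2⟩
  · rintro ⟨p, hp, rfl⟩
    exact ⟨_, p, rfl, Or.inr (Or.inr ⟨n, rfl, hn, hp⟩)⟩

namespace EllipticType

theorem add_four_smul_mem_shortSet {t : EllipticType} {p : ℤ × ℤ} (hp : p ∈ t.shortSet)
    (z : ℤ × ℤ) : p + (4 : ℤ) • z ∈ t.shortSet := by
  rw [mem_shortSet_iff, residue_add, residue_four_smul, add_zero, ← mem_shortSet_iff]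
  exact hp

theorem longSet_nonempty (t : EllipticType) : t.longSet.Nonempty :=
  let ⟨_, _, h⟩ := t.exists_two_smul_mem; ⟨_, h⟩

/-- The isomorphism acts on the radical by an upper triangular matrix with entries `c, k, d`, since
it preserves the line of `a`. It remains to see that lengths of roots are preserved, that the matrix
is integral, and that `c` and `d` are units. -/
theorem eq_of_markedIso {t t' : EllipticType} (ht : t.Admissible l) (ht' : t'.Admissible l)
    (h : MarkedIso (t.roots l) (lineA l) (t'.roots l) (lineA l)) : t = t' := by
  obtain ⟨e, hR, hG⟩ := h
  have hmem : ∀ x, x ∈ t.roots l ↔ e x ∈ t'.roots l := fun x => by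
    rw [← hR, e.injective.mem_set_image]
  let i₀ : Fin l := ⟨0, one_le_of_admissible ht⟩
  obtain ⟨pa, hpa, hpa'⟩ := t.exists_short_add_a
  obtain ⟨pb, hpb, hpb'⟩ := t.exists_short_add_b
  -- the radical is mapped to the radical
  have hlat : ∀ z : ℤ × ℤ, (e (0, realPair z)).1 = 0 := by
    intro z
    have h4 : (e (0, realPair ((4 : ℤ) • z))).1 = 0 := by
      ext i
      refine eq_zero_of_bounded (c := (e (realPt (Pi.single i₀ 1) pa)).1 i) fun j => ?_
      have hroot : realPt (Pi.single i₀ 1) (pa + (4 : ℤ) • (j • z)) ∈ t.roots l :=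
        realPt_mem_rootsOf.2 (Or.inl ⟨by simp, add_four_smul_mem_shortSet hpa _⟩)
      have e₁ : realPt (Pi.single i₀ 1) (pa + (4 : ℤ) • (j • z)) =
          realPt (Pi.single i₀ 1) pa + (j : ℝ) • ((0, realPair ((4 : ℤ) • z)) : Space l) := by
        ext <;> simp [realPt, realPair] <;> ring
      have := abs_le_two_of_mem_rootsOf ((hmem _).1 hroot) i
      rw [e₁, map_add, map_smul] at this
      simpa using this
    have e₂ : ((0, realPair z) : Space l) = (1 / 4 : ℝ) • (0, realPair ((4 : ℤ) • z)) := by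
      ext <;> simp [realPair]
    rw [e₂, map_smul, Prod.smul_fst, h4, smul_zero]
  set c := (e (0, realPair (1, 0))).2.1 with hc
  set k := (e (0, realPair (0, 1))).2.1 with hk
  set d := (e (0, realPair (0, 1))).2.2 with hd
  have hca : e (vecA l) = (0, (c, 0)) := by
    have hv : vecA l = (0, realPair (1, 0)) := by simp [vecA, realPair]
    have h₁ : e (vecA l) ∈ (lineA l : Set (Space l)) := by
      rw [← hG]; exact ⟨_, Submodule.mem_span_singleton_self _, rfl⟩
    obtain ⟨r, hr⟩ := Submodule.mem_span_singleton.1 h₁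
    rw [hc, ← hv, ← hr]
    ext <;> simp [vecA]
  have hφ : ∀ q : ℝ × ℝ, e (0, q) = (0, (c * q.1 + k * q.2, d * q.2)) := by
    intro q
    have e₁ : ((0, q) : Space l) = q.1 • vecA l + q.2 • (0, realPair (0, 1)) := by
      ext <;> simp [vecA, realPair]
    have e₂ : e (0, realPair (0, 1)) = (0, (k, d)) := Prod.ext (hlat _) rfl
    rw [e₁, map_add, map_smul, map_smul, e₂, hca]
    ext <;> simp [mul_comm]
  have hinj : ∀ q : ℝ × ℝ, (c * q.1 + k * q.2, d * q.2) = ((0, 0) : ℝ × ℝ) → q = 0 := by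
    intro q hq
    have : e (0, q) = e 0 := by rw [hφ, hq, map_zero]; rfl
    exact (Prod.ext_iff.1 (e.injective this)).2
  have hc0 : c ≠ 0 := fun h0 => by
    have := hinj (1, 0) (by simp [h0])
    simp at this
  have hd0 : d ≠ 0 := fun h0 => by
    have := hinj (-k / c, 1) (by
      simp only [h0, mul_one, Prod.mk.injEq, and_true]; field_simp; ring)
    simp at this
  have hsurj : ∀ r : ℝ × ℝ, ∃ q : ℝ × ℝ, (c * q.1 + k * q.2, d * q.2) = r := fun r =>
    ⟨((r.1 - k * (r.2 / d)) / c, r.2 / d), by ext <;> field_simp; ring⟩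
  -- The radical is mapped onto the radical, so only vectors of the radical go there.
  have hfst : ∀ n : Fin l → ℤ, (e (realVec n, 0)).1 = 0 → n = 0 := by
    intro n hn
    obtain ⟨q, hq⟩ := hsurj (e (realVec n, 0)).2
    have : e (0, q) = e (realVec n, 0) := by rw [hφ, hq]; exact Prod.ext hn.symm rfl
    have := (Prod.ext_iff.1 (e.injective this)).1
    exact realVec_injective (this.symm.trans (by ext; simp [realVec]))
  have hsplit : ∀ (n : Fin l → ℤ) (q : ℝ × ℝ), e (realVec n, q) =
      ((e (realVec n, 0)).1, (e (realVec n, 0)).2 + (c * q.1 + k * q.2, d * q.2)) := by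
    intro n q
    have e₁ : ((realVec n, q) : Space l) = (realVec n, 0) + (0, q) := by simp
    rw [e₁, map_add, hφ]
    ext <;> simp
  -- short roots are mapped to short roots
  have hshort : ∀ i, ∃ n : Fin l → ℤ, (e (realVec (Pi.single i 1), 0)).1 = realVec n ∧
      n ⬝ᵥ n = 1 := by
    intro i
    obtain ⟨p', hp'⟩ := t.longSet_nonempty
    have h₁ : (realVec (Pi.single i 1), realPair pa) ∈ t.roots l :=
      (mem_rootsOf_short_iff (by simp) _).2 ⟨pa, hpa, rfl⟩
    have h₂ : (realVec ((2 : ℤ) • Pi.single i 1), realPair p') ∈ t.roots l :=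
      (mem_rootsOf_long_iff (by simp) _).2 ⟨p', hp', rfl⟩
    rw [hmem, hsplit] at h₁ h₂
    obtain ⟨n, q, hn, hn'⟩ := mem_rootsOf_iff.1 h₁
    obtain ⟨m, q', hm, hm'⟩ := mem_rootsOf_iff.1 h₂
    have hn := (Prod.ext_iff.1 hn).1
    have hm := (Prod.ext_iff.1 hm).1
    have hmn : m = (2 : ℤ) • n := by
      apply realVec_injective
      change _ = realVec m at hm
      change _ = realVec n at hn
      rw [realVec_smul, ← hm, ← hn]
      have : ((realVec ((2 : ℤ) • Pi.single i 1), 0) : Space l) =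
          ((2 : ℤ) : ℝ) • (realVec (Pi.single i 1), 0) := by
        rw [realVec_smul]; simp
      dsimp only
      rw [this, map_smul]
      rfl
    refine ⟨n, hn, ?_⟩
    -- Both `n` and `2n` are root vectors, with squares in `{1, 2, 4}`; hence `n` has square `1`.
    have h₃ := hn'.dotProduct_self
    have h₄ := hm'.dotProduct_self
    have h₅ : m ⬝ᵥ m = 4 * (n ⬝ᵥ n) := by
      rw [hmn]; simp only [smul_dotProduct, dotProduct_smul, smul_eq_mul]; ring
    omega
  obtain ⟨n₀, hn₀, hn₀'⟩ := hshort i₀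
  set ξ := (e (realVec (Pi.single i₀ 1), 0)).2 with hξ
  have hS : ∀ q : ℝ × ℝ, (∃ p ∈ t.shortSet, q = realPair p) ↔
      ∃ p' ∈ t'.shortSet, ξ + (c * q.1 + k * q.2, d * q.2) = realPair p' := by
    intro q
    rw [← mem_rootsOf_short_iff (n := Pi.single i₀ 1) (by simp) q (M := t.middleSet)
      (E := t.longSet), ← mem_rootsOf_short_iff hn₀' _ (M := t'.middleSet) (E := t'.longSet),
      ← hn₀, hξ, ← hsplit]
    exact hmem _
  have hE : ∀ q : ℝ × ℝ, (∃ p ∈ t.longSet, q = realPair p) ↔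
      ∃ p' ∈ t'.longSet, (ξ + ξ) + (c * q.1 + k * q.2, d * q.2) = realPair p' := by
    intro q
    have e₁ : e (realVec ((2 : ℤ) • Pi.single i₀ 1), q) =
        (realVec ((2 : ℤ) • n₀), (ξ + ξ) + (c * q.1 + k * q.2, d * q.2)) := by
      have : ((realVec ((2 : ℤ) • Pi.single i₀ 1), 0) : Space l) =
          (2 : ℝ) • (realVec (Pi.single i₀ 1), 0) := by
        rw [realVec_smul]; simp
      rw [hsplit, this, map_smul, Prod.smul_fst, Prod.smul_snd, hn₀, ← hξ, realVec_smul, two_smul ℝ ξ]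
      simp
    rw [← mem_rootsOf_long_iff (n := Pi.single i₀ 1) (by simp) q (M := t.middleSet)
      (S := t.shortSet), ← mem_rootsOf_long_iff hn₀' _ (M := t'.middleSet) (S := t'.shortSet),
      ← e₁]
    exact hmem _
  have hM : 2 ≤ l → ∃ η : ℝ × ℝ, ∀ q : ℝ × ℝ, (∃ p ∈ t.middleSet, q = realPair p) ↔
      ∃ p' ∈ t'.middleSet, η + (c * q.1 + k * q.2, d * q.2) = realPair p' := by
    intro hl
    let i₁ : Fin l := ⟨1, hl⟩
    have hne : i₀ ≠ i₁ := by simp [i₀, i₁]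
    obtain ⟨n₁, hn₁, hn₁'⟩ := hshort i₁
    have hadd : ∀ s : ℤ, (e (realVec (Pi.single i₀ 1 + s • Pi.single i₁ 1), 0)).1 =
        realVec (n₀ + s • n₁) := by
      intro s
      have : ((realVec (Pi.single i₀ 1 + s • Pi.single i₁ 1), 0) : Space l) =
          (realVec (Pi.single i₀ 1), 0) + (s : ℝ) • (realVec (Pi.single i₁ 1), 0) := by
        rw [realVec_add, realVec_smul]; simp
      rw [this, map_add, map_smul, Prod.fst_add, Prod.smul_fst, hn₀, hn₁, realVec_add,
        realVec_smul]
    -- Otherwise `n₀ = ± n₁`, and `ε_0 ∓ ε_1` would be mapped into the radical.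
    have hdot : n₀ ⬝ᵥ n₁ = 0 := by
      have hd := eq_of_sq_le ((dotProduct_sq_le n₀ n₁).trans (by rw [hn₀', hn₁']; norm_num))
      by_contra h0
      have hss : (n₀ ⬝ᵥ n₁) * (n₀ ⬝ᵥ n₁) = 1 := by
        rcases hd with hd | hd | hd
        · exact absurd hd h0
        · rw [hd]; rfl
        · rw [hd]; rfl
      have hz : n₀ + (-(n₀ ⬝ᵥ n₁)) • n₁ = 0 := by
        rw [← dotProduct_self_eq_zero]
        simp only [add_dotProduct, dotProduct_add, smul_dotProduct, dotProduct_smul, smul_eq_mul,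
          dotProduct_comm n₁ n₀, hn₀', hn₁']
        linear_combination (-1) * hss
      have := hfst (Pi.single i₀ 1 + (-(n₀ ⬝ᵥ n₁)) • Pi.single i₁ 1)
        (by rw [hadd, hz]; ext; simp [realVec])
      have := congrFun this i₀
      simp [hne] at this
    have hn₂ : (n₀ + (1 : ℤ) • n₁) ⬝ᵥ (n₀ + (1 : ℤ) • n₁) = 2 := by
      simp only [add_dotProduct, dotProduct_add, smul_dotProduct, dotProduct_smul, smul_eq_mul,
        dotProduct_comm n₁ n₀, hn₀', hn₁', hdot]
      norm_num
    refine ⟨(e (realVec (Pi.single i₀ 1 + (1 : ℤ) • Pi.single i₁ 1), 0)).2, fun q => ?_⟩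
    rw [← mem_rootsOf_middle_iff (n := Pi.single i₀ 1 + (1 : ℤ) • Pi.single i₁ 1)
      (by simp [hne, hne.symm]) q (S := t.shortSet) (E := t.longSet),
      ← mem_rootsOf_middle_iff hn₂ _ (S := t'.shortSet) (E := t'.longSet), ← hadd, ← hsplit]
    exact hmem _
  -- integrality
  obtain ⟨C, hC⟩ : ∃ C : ℤ, c = C := by
    obtain ⟨p, -, hp⟩ := (hS _).1 ⟨pa, hpa, rfl⟩
    obtain ⟨p', -, hp'⟩ := (hS _).1 ⟨_, hpa', rfl⟩
    simp only [realPair, Prod.ext_iff, Prod.fst_add, Prod.snd_add] at hp hp'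
    push_cast at hp'
    exact ⟨p'.1 - p.1, by push_cast; linarith [hp.1, hp'.1]⟩
  obtain ⟨K, D, hK, hD⟩ : ∃ K D : ℤ, k = K ∧ d = D := by
    obtain ⟨p, -, hp⟩ := (hS _).1 ⟨pb, hpb, rfl⟩
    obtain ⟨p', -, hp'⟩ := (hS _).1 ⟨_, hpb', rfl⟩
    simp only [realPair, Prod.ext_iff, Prod.fst_add, Prod.snd_add] at hp hp'
    push_cast at hp'
    exact ⟨p'.1 - p.1, p'.2 - p.2, by push_cast; linarith [hp.1, hp'.1],
      by push_cast; linarith [hp.2, hp'.2]⟩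
  rw [hC, hK, hD] at hS hE hM
  have hshift : ∀ {X X' : Set (ℤ × ℤ)} {η : ℝ × ℝ}, X.Nonempty →
      (∀ q : ℝ × ℝ, (∃ p ∈ X, q = realPair p) ↔
        ∃ p' ∈ X', η + ((C : ℝ) * q.1 + K * q.2, (D : ℝ) * q.2) = realPair p') →
      ∃ ζ : ℤ × ℤ, η = realPair ζ := by
    rintro X X' η ⟨p, hp⟩ h
    obtain ⟨p', -, hp'⟩ := (h _).1 ⟨p, hp, rfl⟩
    refine ⟨(p'.1 - (C * p.1 + K * p.2), p'.2 - D * p.2), ?_⟩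
    rw [← add_right_cancel_iff, hp']
    ext <;> simp [realPair]
  have hint : ∀ {X X' : Set (ℤ × ℤ)} {η : ℤ × ℤ},
      (∀ q : ℝ × ℝ, (∃ p ∈ X, q = realPair p) ↔
        ∃ p' ∈ X', realPair η + ((C : ℝ) * q.1 + K * q.2, (D : ℝ) * q.2) = realPair p') →
      ∀ p : ℤ × ℤ, p ∈ X ↔ (C * p.1 + K * p.2 + η.1, D * p.2 + η.2) ∈ X' := by
    intro X X' η h p
    have e₁ : realPair η + ((C : ℝ) * (realPair p).1 + K * (realPair p).2,
        (D : ℝ) * (realPair p).2) = realPair (C * p.1 + K * p.2 + η.1, D * p.2 + η.2) := by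
      ext <;> simp [realPair] <;> ring
    have := h (realPair p)
    rw [e₁] at this
    simpa [realPair_injective.eq_iff] using this
  have hξ' := hshift ⟨pa, hpa⟩ hS
  obtain ⟨ζ, hζ⟩ := hξ'
  have hζ2 : ξ + ξ = realPair (ζ + ζ) := by rw [hζ]; ext <;> simp [realPair]
  rw [hζ] at hS
  rw [hζ2] at hE
  have hpre : ∀ p' ∈ t'.shortSet, ∃ p : ℤ × ℤ,
      (C * p.1 + K * p.2 + ζ.1, D * p.2 + ζ.2) = p' := by
    intro p' hp'
    obtain ⟨q, hq⟩ := hsurj (realPair p' - realPair ζ)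
    rw [hC, hK, hD] at hq
    obtain ⟨p, -, rfl⟩ := (hS q).2 ⟨p', hp', by rw [hq]; abel⟩
    refine ⟨p, realPair_injective ?_⟩
    rw [eq_sub_iff_add_eq] at hq
    rw [← hq]
    ext <;> simp [realPair]
  have hD0 : D ≠ 0 := fun h0 => hd0 (by rw [hD, h0]; simp)
  -- Two translations in the target differ by `(1, 0)` and have integral preimages. As `D ≠ 0`,
  -- these agree in the second coordinate, so `C` divides `1`.
  have hCC : C * C = 1 := by
    obtain ⟨s, hs, hs'⟩ := t'.exists_short_add_a
    obtain ⟨p, hp⟩ := hpre s hs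
    obtain ⟨p', hp'⟩ := hpre _ hs'
    rw [← hp] at hp'
    simp only [Prod.ext_iff, Prod.fst_add, Prod.snd_add] at hp'
    have h₂ : D * (p'.2 - p.2) = 0 := by linarith [hp'.2]
    have h₃ : p'.2 = p.2 := by
      rcases mul_eq_zero.1 h₂ with h | h
      · exact absurd h hD0
      · omega
    have h₁ : C * (p'.1 - p.1) = 1 := by rw [h₃] at hp'; linarith [hp'.1]
    rcases Int.eq_one_or_neg_one_of_mul_eq_one h₁ with h | h <;> rw [h] <;> rfl
  have hDD : D * D = 1 := by
    obtain ⟨s, hs, hs'⟩ := t'.exists_short_add_b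
    obtain ⟨p, hp⟩ := hpre s hs
    obtain ⟨p', hp'⟩ := hpre _ hs'
    rw [← hp] at hp'
    simp only [Prod.ext_iff, Prod.fst_add, Prod.snd_add] at hp'
    have h₁ : D * (p'.2 - p.2) = 1 := by linarith [hp'.2]
    rcases Int.eq_one_or_neg_one_of_mul_eq_one h₁ with h | h <;> rw [h] <;> rfl
  by_cases hl : 2 ≤ l
  · obtain ⟨η, hη⟩ := hM hl
    obtain ⟨θ, rfl⟩ := hshift t.middleSet_nonempty hη
    exact eq_of_affine_equiv ht ht' hCC hDD K ζ θ (hint hS) (hint hE) fun _ => hint hη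
  · exact eq_of_affine_equiv ht ht' hCC hDD K ζ 0 (hint hS) (hint hE) fun h => absurd h hl

end EllipticType
end MERS

namespace MERS

/-! ### Finite root systems of type `BC_l` -/

section Finite

variable {l : ℕ} {Δ : Set (Fin l → ℝ)}

theorem dotProduct_self_pos {v : Fin l → ℝ} (h : v ≠ 0) : 0 < v ⬝ᵥ v :=
  lt_of_le_of_ne (Finset.sum_nonneg fun _ _ => mul_self_nonneg _)
    fun h0 => h (dotProduct_self_eq_zero.1 h0.symm)

theorem real_dotProduct_sq_le (v w : Fin l → ℝ) : (v ⬝ᵥ w) ^ 2 ≤ (v ⬝ᵥ v) * (w ⬝ᵥ w) := by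
  simpa [dotProduct, pow_two] using Finset.sum_mul_sq_le_sq_mul_sq Finset.univ v w

/-- A set of nonzero vectors that is closed under its reflections and has integral Cartan
pairings. -/
structure IsCrystallographic (Δ : Set (Fin l → ℝ)) : Prop where
  ne_zero : ∀ α ∈ Δ, α ≠ 0
  refl : ∀ α ∈ Δ, ∀ β ∈ Δ, ∃ k : ℤ, 2 * (α ⬝ᵥ β) = k * (α ⬝ᵥ α) ∧ β - (k : ℝ) • α ∈ Δ

namespace IsCrystallographic

theorem sub_smul_mem (h : IsCrystallographic Δ) {α β : Fin l → ℝ} (hα : α ∈ Δ) (hβ : β ∈ Δ)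
    {k : ℝ} (hk : 2 * (α ⬝ᵥ β) = k * (α ⬝ᵥ α)) : β - k • α ∈ Δ := by
  obtain ⟨k', hk', hmem⟩ := h.refl α hα β hβ
  have : k = k' := mul_right_cancel₀ (dotProduct_self_pos (h.ne_zero α hα)).ne' (hk.symm.trans hk')
  rwa [this]

theorem neg_mem (h : IsCrystallographic Δ) {α : Fin l → ℝ} (hα : α ∈ Δ) : -α ∈ Δ := by
  have := h.sub_smul_mem hα hα (k := 2) rfl
  rwa [two_smul, sub_add_cancel_left] at this

/-- The roots whose double is a root. -/
def halfRoots (Δ : Set (Fin l → ℝ)) : Set (Fin l → ℝ) := {α | α ∈ Δ ∧ (2 : ℝ) • α ∈ Δ}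

/-- Integrality against `2α` is twice as strong as against `α`: the product is an integral multiple
of `α ⬝ᵥ α`, not merely of its half. -/
theorem exists_pairing (h : IsCrystallographic Δ) {α γ : Fin l → ℝ} (hα : α ∈ halfRoots Δ)
    (hγ : γ ∈ Δ) : ∃ j : ℤ, α ⬝ᵥ γ = j * (α ⬝ᵥ α) := by
  obtain ⟨j, hj, -⟩ := h.refl _ hα.2 γ hγ
  refine ⟨j, ?_⟩
  simp only [smul_dotProduct, dotProduct_smul, smul_eq_mul] at hj
  linarith

theorem sub_smul_mem_halfRoots (h : IsCrystallographic Δ) {α γ : Fin l → ℝ}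
    (hα : α ∈ halfRoots Δ) (hγ : γ ∈ Δ) {k : ℝ} (hk : 2 * (γ ⬝ᵥ α) = k * (γ ⬝ᵥ γ)) :
    α - k • γ ∈ halfRoots Δ := by
  refine ⟨h.sub_smul_mem hγ hα.1 hk, ?_⟩
  have := h.sub_smul_mem hγ hα.2 (k := 2 * k) (by
    simp only [dotProduct_smul, smul_eq_mul]; linarith)
  rwa [mul_smul, ← smul_sub] at this

/-- Writing the product as `j` times one square and as `i` times the other gives `(α ⬝ᵥ β)² = j i (α
⬝ᵥ α)(β ⬝ᵥ β)`. By Cauchy–Schwarz `j i` is `1` unless the product vanishes, and equality means that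
the vectors are parallel. -/
theorem halfRoots_orthogonal (h : IsCrystallographic Δ) {α β : Fin l → ℝ}
    (hα : α ∈ halfRoots Δ) (hβ : β ∈ halfRoots Δ) : α ⬝ᵥ β = 0 ∨ β = α ∨ β = -α := by
  obtain ⟨j, hj⟩ := h.exists_pairing hα hβ.1
  obtain ⟨i, hi⟩ := h.exists_pairing hβ hα.1
  have hαp := dotProduct_self_pos (h.ne_zero α hα.1)
  have hβp := dotProduct_self_pos (h.ne_zero β hβ.1)
  rw [dotProduct_comm] at hi
  by_cases h0 : α ⬝ᵥ β = 0
  · exact Or.inl h0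
  have hp : 0 < (α ⬝ᵥ α) * (β ⬝ᵥ β) := mul_pos hαp hβp
  have hsq : (α ⬝ᵥ β) ^ 2 = ((j * i : ℤ) : ℝ) * ((α ⬝ᵥ α) * (β ⬝ᵥ β)) := by
    push_cast; rw [pow_two]; nth_rewrite 1 [hj]; rw [hi]; ring
  have hle := real_dotProduct_sq_le α β
  have hpos : 0 < (α ⬝ᵥ β) ^ 2 := by positivity
  rw [hsq] at hle hpos
  have h1 : j * i ≤ 1 := by
    have : ((j * i : ℤ) : ℝ) ≤ 1 := by nlinarith
    exact_mod_cast this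
  have h2 : 0 < j * i := by
    have : (0 : ℝ) < ((j * i : ℤ) : ℝ) := by
      by_contra hcon
      nlinarith
    exact_mod_cast this
  have hji : j * i = 1 := by omega
  have hj1 := Int.eq_one_or_neg_one_of_mul_eq_one hji
  have hzero : β - (j : ℝ) • α = 0 := by
    rw [← dotProduct_self_eq_zero]
    simp only [sub_dotProduct, dotProduct_sub, smul_dotProduct, dotProduct_smul, smul_eq_mul,
      dotProduct_comm β α]
    have hji' : (j : ℝ) * i = 1 := by exact_mod_cast hji
    have hβα : β ⬝ᵥ β = (j : ℝ) * (α ⬝ᵥ β) := by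
      rw [hi, ← mul_assoc, hji', one_mul]
    rw [hβα, hj]
    ring
  right
  rw [sub_eq_zero] at hzero
  rcases hj1 with hj1 | hj1
  · left; simpa [hj1] using hzero
  · right; simpa [hj1] using hzero

/-- Here `2 (α ⬝ᵥ γ)² = j k (α ⬝ᵥ α)(γ ⬝ᵥ γ)`, so `j k` is `1` or `2`. For `j k = 2` the vectors are
parallel, with `γ = ±α` or `γ = ±2α`. For `j k = 1` the square of `γ` is twice that of `α`, and `δ`
is the reflection of `α` in `γ`. -/
theorem exists_of_dotProduct_ne_zero (h : IsCrystallographic Δ) {α γ : Fin l → ℝ}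
    (hα : α ∈ halfRoots Δ) (hγ : γ ∈ Δ) (h0 : α ⬝ᵥ γ ≠ 0) :
    ∃ s : ℤ, (s = 1 ∨ s = -1) ∧ (γ = (s : ℝ) • α ∨ γ = (s : ℝ) • (2 : ℝ) • α ∨
      ∃ δ ∈ halfRoots Δ, α ⬝ᵥ δ = 0 ∧ δ ⬝ᵥ δ = α ⬝ᵥ α ∧ γ = (s : ℝ) • (α - δ)) := by
  obtain ⟨j, hj⟩ := h.exists_pairing hα hγ
  obtain ⟨k, hk, -⟩ := h.refl γ hγ α hα.1
  have hαp := dotProduct_self_pos (h.ne_zero α hα.1)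
  have hγp := dotProduct_self_pos (h.ne_zero γ hγ)
  rw [dotProduct_comm] at hk
  have hp : 0 < (α ⬝ᵥ α) * (γ ⬝ᵥ γ) := mul_pos hαp hγp
  have hsq : 2 * (α ⬝ᵥ γ) ^ 2 = ((j * k : ℤ) : ℝ) * ((α ⬝ᵥ α) * (γ ⬝ᵥ γ)) := by
    push_cast
    linear_combination 2 * (α ⬝ᵥ γ) * hj + (j : ℝ) * (α ⬝ᵥ α) * hk
  have hle := real_dotProduct_sq_le α γ
  have hpos : 0 < (α ⬝ᵥ γ) ^ 2 := by positivity
  have h1 : j * k ≤ 2 := by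
    have : ((j * k : ℤ) : ℝ) ≤ 2 := by nlinarith
    exact_mod_cast this
  have h2 : 0 < j * k := by
    have : (0 : ℝ) < ((j * k : ℤ) : ℝ) := by
      by_contra hcon
      nlinarith
    exact_mod_cast this
  have hcases : (j = k ∧ (k = 1 ∨ k = -1)) ∨ (k = 2 * j ∧ (j = 1 ∨ j = -1)) ∨
      (j = 2 * k ∧ (k = 1 ∨ k = -1)) := by
    have hj0 : j ≠ 0 := fun h => by simp [h] at h2
    have hk0 : k ≠ 0 := fun h => by simp [h] at h2
    have a1 : j ≤ 2 := by
      by_contra! hc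
      have : 0 < k := by by_contra! hk'; nlinarith
      nlinarith
    have a2 : -2 ≤ j := by
      by_contra! hc
      have : k < 0 := by by_contra! hk'; nlinarith
      nlinarith
    have : j = -2 ∨ j = -1 ∨ j = 1 ∨ j = 2 := by omega
    rcases this with rfl | rfl | rfl | rfl <;> omega
  have key : ∀ t : ℝ, γ ⬝ᵥ γ - 2 * t * (α ⬝ᵥ γ) + t * t * (α ⬝ᵥ α) = 0 → γ = t • α := by
    intro t ht
    rw [← sub_eq_zero, ← dotProduct_self_eq_zero]
    simp only [sub_dotProduct, dotProduct_sub, smul_dotProduct, dotProduct_smul, smul_eq_mul,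
      dotProduct_comm γ α]
    linarith
  rcases hcases with ⟨rfl, hs⟩ | ⟨rfl, hs⟩ | ⟨rfl, hs⟩
  · refine ⟨j, hs, Or.inr (Or.inr ⟨α - (j : ℝ) • γ,
      h.sub_smul_mem_halfRoots hα hγ (by rw [dotProduct_comm]; exact hk), ?_, ?_, ?_⟩)⟩
    · rw [dotProduct_sub, dotProduct_smul, hj]
      rcases hs with rfl | rfl <;> simp
    · simp only [sub_dotProduct, dotProduct_sub, smul_dotProduct, dotProduct_smul, smul_eq_mul,
        dotProduct_comm γ α]
      linear_combination (-(j : ℝ)) * hk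
    · rcases hs with rfl | rfl <;> simp
  · refine ⟨j, hs, Or.inl (key _ ?_)⟩
    push_cast at hk
    rcases hs with rfl | rfl <;> push_cast at * <;> linarith
  · refine ⟨k, hs, Or.inr (Or.inl ?_)⟩
    rw [smul_smul]
    refine key _ ?_
    rcases hs with rfl | rfl <;> push_cast at * <;> linarith

/-- The half roots that are linked to a given one by a root. -/
def linkedHalfRoots (Δ : Set (Fin l → ℝ)) (α₀ : Fin l → ℝ) : Set (Fin l → ℝ) :=
  {δ | δ ∈ halfRoots Δ ∧ (δ = α₀ ∨ δ = -α₀ ∨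
    (α₀ ⬝ᵥ δ = 0 ∧ δ ⬝ᵥ δ = α₀ ⬝ᵥ α₀ ∧ α₀ - δ ∈ Δ))}

/-- Being linked to `α₀` propagates: the reflection of `α₀ - δ` in `δ - δ'` is `α₀ - δ'`. From `δ =
-α₀` one obtains `α₀ + δ'`, and the reflection in `δ'` corrects the sign. -/
theorem mem_linkedHalfRoots (h : IsCrystallographic Δ) {α₀ δ δ' : Fin l → ℝ}
    (hα₀ : α₀ ∈ halfRoots Δ) (hδ : δ ∈ linkedHalfRoots Δ α₀) (hδ' : δ' ∈ halfRoots Δ)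
    (horth : δ ⬝ᵥ δ' = 0) (hsq : δ' ⬝ᵥ δ' = δ ⬝ᵥ δ) (hmem : δ - δ' ∈ Δ) :
    δ' ∈ linkedHalfRoots Δ α₀ := by
  refine ⟨hδ', ?_⟩
  rcases hδ.2 with rfl | rfl | ⟨h1, h2, h3⟩
  · exact Or.inr (Or.inr ⟨horth, hsq, hmem⟩)
  · have horth' : α₀ ⬝ᵥ δ' = 0 := by simpa using horth
    refine Or.inr (Or.inr ⟨horth', by simpa using hsq, ?_⟩)
    have := h.sub_smul_mem hδ'.1 (h.neg_mem hmem) (k := 2) (by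
      simp [dotProduct_comm δ' α₀, horth'])
    convert this using 1
    module
  · rcases h.halfRoots_orthogonal hα₀ hδ' with h4 | h4 | h4
    · refine Or.inr (Or.inr ⟨h4, hsq.trans h2, ?_⟩)
      have := h.sub_smul_mem hmem h3 (k := -1) (by
        simp only [sub_dotProduct, dotProduct_sub, dotProduct_comm δ α₀, dotProduct_comm δ' α₀,
          dotProduct_comm δ' δ, h1, h4, horth, hsq]
        ring)
      convert this using 1
      module
    · exact Or.inl h4
    · exact Or.inr (Or.inl h4)

end IsCrystallographic
end Finite
end MERS

/-! ### Orthogonal frames of half roots. -/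

namespace MERS
open IsCrystallographic

variable {l : ℕ} {Δ : Set (Fin l → ℝ)}

/-- The integer vectors of the roots of `BC_l`. -/
def IsBCVec (n : Fin l → ℤ) : Prop :=
  n ⬝ᵥ n = 1 ∨ n ⬝ᵥ n = 2 ∨ ∃ m, n = (2 : ℤ) • m ∧ m ⬝ᵥ m = 1

/-- A root not orthogonal to some linked half root is a combination of linked half roots, so such
roots are orthogonal to all others; irreducibility leaves no others. Hence the linked half roots
span, and a basis chosen among them, containing `α₀`, is orthogonal and meets each pair `±δ`. Being
linked also supplies the roots `α₀ - e i`. -/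
theorem IsCrystallographic.exists_frame (h : IsCrystallographic Δ)
    (hirr : ∀ P : (Fin l → ℝ) → Prop, (∀ α ∈ Δ, ∀ β ∈ Δ, P α → ¬ P β → α ⬝ᵥ β = 0) →
      (∃ α ∈ Δ, P α) → ∀ α ∈ Δ, P α)
    (hspan : Submodule.span ℝ Δ = ⊤) {α₀ : Fin l → ℝ} (hα₀ : α₀ ∈ halfRoots Δ) :
    ∃ (e : Module.Basis (Fin l) ℝ (Fin l → ℝ)) (i₀ : Fin l), e i₀ = α₀ ∧
      (∀ i, e i ⬝ᵥ e i = α₀ ⬝ᵥ α₀) ∧ (∀ i j, i ≠ j → e i ⬝ᵥ e j = 0) ∧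
      (∀ i, i ≠ i₀ → α₀ - e i ∈ Δ) ∧
      ∀ γ ∈ Δ, ∃ n : Fin l → ℤ, γ = ∑ i, (n i : ℝ) • e i ∧ IsBCVec n := by
  have hα₀C : α₀ ∈ linkedHalfRoots Δ α₀ := ⟨hα₀, Or.inl rfl⟩
  have hα₀0 : α₀ ≠ 0 := h.ne_zero _ hα₀.1
  -- every root is a combination of linked half roots
  have hform : ∀ γ ∈ Δ, (∃ δ ∈ linkedHalfRoots Δ α₀, δ ⬝ᵥ γ ≠ 0) →
      ∃ s : ℤ, (s = 1 ∨ s = -1) ∧ ∃ δ ∈ linkedHalfRoots Δ α₀,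
        γ = (s : ℝ) • δ ∨ γ = (s : ℝ) • (2 : ℝ) • δ ∨
        ∃ δ' ∈ linkedHalfRoots Δ α₀, δ ⬝ᵥ δ' = 0 ∧ γ = (s : ℝ) • (δ - δ') := by
    rintro γ hγ ⟨δ, hδ, hne⟩
    obtain ⟨s, hs, hγ' | hγ' | ⟨δ', hδ', horth, hsq, hγ'⟩⟩ :=
      h.exists_of_dotProduct_ne_zero hδ.1 hγ hne
    · exact ⟨s, hs, δ, hδ, Or.inl hγ'⟩
    · exact ⟨s, hs, δ, hδ, Or.inr (Or.inl hγ')⟩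
    · refine ⟨s, hs, δ, hδ, Or.inr (Or.inr ⟨δ', ?_, horth, hγ'⟩)⟩
      refine h.mem_linkedHalfRoots hα₀ hδ hδ' horth hsq ?_
      rw [hγ'] at hγ
      rcases hs with rfl | rfl
      · simpa using hγ
      · simpa using h.neg_mem hγ
  have hall : ∀ γ ∈ Δ, ∃ δ ∈ linkedHalfRoots Δ α₀, δ ⬝ᵥ γ ≠ 0 := by
    refine hirr (fun γ => ∃ δ ∈ linkedHalfRoots Δ α₀, δ ⬝ᵥ γ ≠ 0) ?_
      ⟨α₀, hα₀.1, α₀, hα₀C, (dotProduct_self_pos hα₀0).ne'⟩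
    intro α hα β _ hPα hPβ
    push Not at hPβ
    obtain ⟨s, -, δ, hδ, rfl | rfl | ⟨δ', hδ', -, rfl⟩⟩ := hform α hα hPα
    · simp [hPβ δ hδ]
    · simp [hPβ δ hδ]
    · simp [hPβ δ' hδ', hPβ δ hδ]
  -- a basis of linked half roots
  have hα₀ind : LinearIndepOn ℝ id {α₀} := LinearIndepOn.singleton hα₀0
  obtain ⟨b, hbC, hα₀b, hCb, hb⟩ := exists_linearIndepOn_id_extension hα₀ind
    (Set.singleton_subset_iff.2 hα₀C)
  have hbtop : Submodule.span ℝ b = ⊤ := by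
    rw [eq_top_iff, ← hspan, Submodule.span_le]
    intro γ hγ
    obtain ⟨s, -, δ, hδ, rfl | rfl | ⟨δ', hδ', -, rfl⟩⟩ := hform γ hγ (hall γ hγ)
    · exact Submodule.smul_mem _ _ (hCb hδ)
    · exact Submodule.smul_mem _ _ (Submodule.smul_mem _ _ (hCb hδ))
    · exact Submodule.smul_mem _ _ (Submodule.sub_mem _ (hCb hδ) (hCb hδ'))
  let B : Module.Basis b ℝ (Fin l → ℝ) := Module.Basis.mk hb (by simp [hbtop])
  have hBapp : ∀ x : b, B x = x := fun x => by simp [B]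
  let σ : b ≃ Fin l := B.indexEquiv (Pi.basisFun ℝ (Fin l))
  let e : Module.Basis (Fin l) ℝ (Fin l → ℝ) := B.reindex σ
  have heC : ∀ i, e i ∈ linkedHalfRoots Δ α₀ := fun i => by
    simp only [e, Module.Basis.reindex_apply, hBapp]; exact hbC (σ.symm i).2
  let i₀ : Fin l := σ ⟨α₀, hα₀b rfl⟩
  have hei₀ : e i₀ = α₀ := by simp [e, i₀, hBapp]
  have hne : ∀ i j, i ≠ j → e i ≠ e j ∧ e i ≠ -e j := by
    intro i j hij
    refine ⟨fun h' => hij (e.injective h'), fun h' => ?_⟩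
    have := congrArg (fun v => e.repr v i) h'
    simp [hij.symm] at this
  have horth : ∀ i j, i ≠ j → e i ⬝ᵥ e j = 0 := by
    intro i j hij
    rcases h.halfRoots_orthogonal (heC i).1 (heC j).1 with h' | h' | h'
    · exact h'
    · exact absurd h' (hne j i hij.symm).1
    · exact absurd h' (hne j i hij.symm).2
  -- A linked half root different from all `± e i` would be orthogonal to a basis.
  have hpm : ∀ δ ∈ linkedHalfRoots Δ α₀, ∃ i, ∃ s : ℤ, (s = 1 ∨ s = -1) ∧ δ = (s : ℝ) • e i := by
    intro δ hδ
    by_contra! hcon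
    have h0 : ∀ i, δ ⬝ᵥ e i = 0 := by
      intro i
      rcases h.halfRoots_orthogonal (heC i).1 hδ.1 with h' | h' | h'
      · rw [dotProduct_comm]; exact h'
      · exact absurd h' (by simpa using hcon i 1 (Or.inl rfl))
      · exact absurd h' (by simpa using hcon i (-1) (Or.inr rfl))
    have hδδ : δ ⬝ᵥ δ = 0 := by
      nth_rewrite 2 [← e.sum_repr δ]
      rw [dotProduct_sum]
      exact Finset.sum_eq_zero fun i _ => by rw [dotProduct_smul, h0, smul_zero]
    exact (dotProduct_self_pos (h.ne_zero δ hδ.1.1)).ne' hδδ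
  refine ⟨e, i₀, hei₀, fun i => ?_, horth, fun i hi => ?_, fun γ hγ => ?_⟩
  · rcases (heC i).2 with h' | h' | ⟨-, h', -⟩
    · rw [h']
    · rw [h']; simp
    · exact h'
  · rcases (heC i).2 with h' | h' | ⟨-, -, h'⟩
    · exact absurd (h'.trans hei₀.symm) (hne i i₀ hi).1
    · exact absurd (h'.trans (congrArg _ hei₀.symm)) (hne i i₀ hi).2
    · exact h'
  · have hsum : ∀ (i : Fin l) (c : ℤ),
        ∑ j, ((Pi.single i c : Fin l → ℤ) j : ℝ) • e j = (c : ℝ) • e i := by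
      intro i c
      rw [Finset.sum_eq_single_of_mem i (Finset.mem_univ _) fun j _ hj => by simp [hj]]
      simp
    have hsq : ∀ s : ℤ, (s = 1 ∨ s = -1) → s * s = 1 := by
      rintro s (rfl | rfl) <;> rfl
    obtain ⟨s, hs, δ, hδ, hγ'⟩ := hform γ hγ (hall γ hγ)
    obtain ⟨i, r, hr, rfl⟩ := hpm δ hδ
    rcases hγ' with rfl | rfl | ⟨δ', hδ', hdd, rfl⟩
    · refine ⟨Pi.single i (s * r), ?_, Or.inl ?_⟩
      · rw [hsum, smul_smul]; push_cast; rfl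
      · simp only [dotProduct_single, Pi.single_eq_same]
        linear_combination s * s * hsq r hr + hsq s hs
    · refine ⟨(2 : ℤ) • Pi.single i (s * r), ?_, Or.inr (Or.inr ⟨_, rfl, ?_⟩)⟩
      · rw [← Pi.single_smul', hsum, smul_smul, smul_smul]
        congr 1
        push_cast [smul_eq_mul]
        ring
      · simp only [dotProduct_single, Pi.single_eq_same]
        linear_combination s * s * hsq r hr + hsq s hs
    · obtain ⟨j, r', hr', rfl⟩ := hpm δ' hδ'
      have hij : i ≠ j := by
        rintro rfl
        simp only [smul_dotProduct, dotProduct_smul, smul_eq_mul] at hdd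
        have := dotProduct_self_pos (h.ne_zero _ (heC i).1.1)
        rcases hr with rfl | rfl <;> rcases hr' with rfl | rfl <;> push_cast at hdd <;> linarith
      refine ⟨Pi.single i (s * r) - Pi.single j (s * r'), ?_, Or.inr (Or.inl ?_)⟩
      · simp only [Pi.sub_apply, Int.cast_sub, sub_smul, Finset.sum_sub_distrib, hsum, smul_sub,
          smul_smul]
        push_cast; rfl
      · simp only [dotProduct_sub, dotProduct_single, Pi.sub_apply, Pi.single_eq_same,
          Pi.single_eq_of_ne hij, Pi.single_eq_of_ne hij.symm]
        linear_combination s * s * hsq r hr + 2 * hsq s hs + s * s * hsq r' hr'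

end MERS

namespace MERS

variable {l : ℕ}

/-! ### Translation sets of a root system that contains a frame -/

/-- A root system in integer coordinates that contains the vectors `ε_{i₀}`, `2 ε_{i₀}` and
`ε_{i₀} - ε_i`. -/
structure IsFramed (D : (Fin l → ℤ) → ℤ × ℤ → Prop) (i₀ : Fin l) : Prop where
  isBCVec : ∀ n p, D n p → IsBCVec n
  refl : ∀ n p m q, D n p → D m q → ∃ k : ℤ, 2 * (n ⬝ᵥ m) = k * (n ⬝ᵥ n) ∧
    D (m - k • n) (q - k • p)
  short : D (Pi.single i₀ 1) 0
  long : D ((2 : ℤ) • Pi.single i₀ 1) 0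
  middle : ∀ i, i ≠ i₀ → D (Pi.single i₀ 1 - Pi.single i 1) 0

theorem IsBCVec.dotProduct_self_pos {n : Fin l → ℤ} (h : IsBCVec n) : 0 < n ⬝ᵥ n := by
  rcases h with h | h | ⟨m, rfl, h⟩
  · omega
  · omega
  · simp [h, -zsmul_eq_mul]

namespace IsFramed

variable {D : (Fin l → ℤ) → ℤ × ℤ → Prop} {i₀ : Fin l}

theorem sub_smul (h : IsFramed D i₀) {n m : Fin l → ℤ} {p q : ℤ × ℤ} (hn : D n p) (hm : D m q)
    (k : ℤ) (hk : 2 * (n ⬝ᵥ m) = k * (n ⬝ᵥ n)) {m' : Fin l → ℤ} (hm' : m - k • n = m') :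
    D m' (q - k • p) := by
  obtain ⟨k', hk', hD⟩ := h.refl n p m q hn hm
  have : k = k' := mul_right_cancel₀ (h.isBCVec n p hn).dotProduct_self_pos.ne' (hk.symm.trans hk')
  rwa [← hm', this]

/-- Reflections in roots with translation zero do not change translations. Those over `ε_i` and `ε_i
- ε_j` generate the Weyl group of `BC_l`, which is why the set of translations depends only on the
length of a root. -/
theorem sub_smul_zero (h : IsFramed D i₀) {n m : Fin l → ℤ} {q : ℤ × ℤ} (hn : D n 0) (hm : D m q)
    (k : ℤ) (hk : 2 * (n ⬝ᵥ m) = k * (n ⬝ᵥ n)) {m' : Fin l → ℤ} (hm' : m - k • n = m') :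
    D m' q := by
  simpa using h.sub_smul hn hm k hk hm'

theorem neg (h : IsFramed D i₀) {n : Fin l → ℤ} {p : ℤ × ℤ} (hn : D n p) : D (-n) (-p) := by
  have := h.sub_smul hn hn 2 rfl (m' := -n) (by rw [two_smul, sub_add_cancel_left])
  rwa [two_smul, sub_add_cancel_left] at this

/-- Reflect `ε_{i₀} - ε_j` in `ε_{i₀} - ε_i`. -/
theorem middle' (h : IsFramed D i₀) {i j : Fin l} (hij : i ≠ j) :
    D (Pi.single i 1 - Pi.single j 1) 0 := by
  by_cases hi : i = i₀
  · subst hi; exact h.middle j hij.symm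
  by_cases hj : j = i₀
  · subst hj; simpa using h.neg (h.middle i hij)
  · refine h.sub_smul_zero (h.middle i hi) (h.middle j hj) 1 ?_ ?_
    · simp [hi, hj, Ne.symm hi, hij.symm]
    · simp

theorem move_single (h : IsFramed D i₀) {i : Fin l} {c : ℤ} {q : ℤ × ℤ} (hD : D (Pi.single i c) q)
    (j : Fin l) : D (Pi.single j c) q := by
  by_cases hij : i = j
  · rwa [← hij]
  · refine h.sub_smul_zero (h.middle' hij) hD c ?_ ?_
    · simp [hij, Ne.symm hij]; ring
    · rw [smul_sub, ← Pi.single_smul', ← Pi.single_smul']; simp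

theorem short' (h : IsFramed D i₀) (i : Fin l) : D (Pi.single i 1) 0 := h.move_single h.short i

theorem flip_single (h : IsFramed D i₀) {i : Fin l} {c : ℤ} {q : ℤ × ℤ}
    (hD : D (Pi.single i c) q) : D (Pi.single i (-c)) q := by
  refine h.sub_smul_zero (h.short' i) hD (2 * c) (by simp) ?_
  rw [← Pi.single_smul', ← Pi.single_sub]
  congr 1
  simp; ring

theorem eq_single_of_short {n : Fin l → ℤ} (hn : n ⬝ᵥ n = 1) :
    ∃ i, n = Pi.single i 1 ∨ n = Pi.single i (-1) := by
  obtain ⟨i, -, h1, h0⟩ := exists_eq_of_sum_sq_eq_one (s := Finset.univ) (n := n) hn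
  have hn : n = Pi.single i (n i) := by
    ext j; by_cases hj : j = i
    · subst hj; simp
    · simp [hj, h0 j (Finset.mem_univ _) hj]
  exact ⟨i, h1.imp (fun h => by rw [← h]; exact hn) fun h => by rw [← h]; exact hn⟩

theorem short_transitive (h : IsFramed D i₀) {n m : Fin l → ℤ} (hn : n ⬝ᵥ n = 1) (hm : m ⬝ᵥ m = 1)
    {q : ℤ × ℤ} (hD : D n q) : D m q := by
  obtain ⟨i, rfl | rfl⟩ := eq_single_of_short hn <;> obtain ⟨j, rfl | rfl⟩ := eq_single_of_short hm
  · exact h.move_single hD j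
  · exact h.flip_single (h.move_single hD j)
  · exact neg_neg (1 : ℤ) ▸ h.flip_single (h.move_single hD j)
  · exact h.move_single hD j

theorem long_transitive (h : IsFramed D i₀) {n m : Fin l → ℤ} (hn : n ⬝ᵥ n = 1) (hm : m ⬝ᵥ m = 1)
    {q : ℤ × ℤ} (hD : D ((2 : ℤ) • n) q) : D ((2 : ℤ) • m) q := by
  obtain ⟨i, rfl | rfl⟩ := eq_single_of_short hn <;>
    obtain ⟨j, rfl | rfl⟩ := eq_single_of_short hm <;>
    rw [← Pi.single_smul'] at hD ⊢
  · exact h.move_single hD j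
  · exact h.flip_single (h.move_single hD j)
  · exact h.flip_single (h.move_single hD j)
  · exact h.move_single hD j

theorem move_pair (h : IsFramed D i₀) {i j j' : Fin l} (hij : i ≠ j) (hij' : i ≠ j') {c d : ℤ}
    {q : ℤ × ℤ} (hD : D (Pi.single i c + Pi.single j d) q) :
    D (Pi.single i c + Pi.single j' d) q := by
  by_cases hj : j = j'
  · rwa [← hj]
  · refine h.sub_smul_zero (h.middle' hj) hD d ?_ ?_
    · simp [hj, Ne.symm hj, hij, hij']; ring
    · rw [smul_sub, ← Pi.single_smul', ← Pi.single_smul']; simp; abel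

theorem flip_pair (h : IsFramed D i₀) {i j : Fin l} (hij : i ≠ j) {c d : ℤ}
    {q : ℤ × ℤ} (hD : D (Pi.single i c + Pi.single j d) q) :
    D (Pi.single i (-c) + Pi.single j d) q := by
  refine h.sub_smul_zero (h.short' i) hD (2 * c) ?_ ?_
  · simp [hij]
  · rw [← Pi.single_smul', add_sub_right_comm, ← Pi.single_sub]
    congr 2
    simp; ring

theorem flip_pair_of (h : IsFramed D i₀) {i j : Fin l} (hij : i ≠ j) {c d c' : ℤ}
    (hc : c = 1 ∨ c = -1) (hc' : c' = 1 ∨ c' = -1) {q : ℤ × ℤ}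
    (hD : D (Pi.single i c + Pi.single j d) q) : D (Pi.single i c' + Pi.single j d) q := by
  have : c' = c ∨ c' = -c := by omega
  rcases this with rfl | rfl
  · exact hD
  · exact h.flip_pair hij hD

theorem middle_transitive (h : IsFramed D i₀) {n m : Fin l → ℤ} (hn : n ⬝ᵥ n = 2)
    (hm : m ⬝ᵥ m = 2) {q : ℤ × ℤ} (hD : D n q) : D m q := by
  obtain ⟨i, j, hij, hi, hj, hn'⟩ := exists_of_dotProduct_self_eq_two hn
  obtain ⟨i', j', hij', hi', hj', hm'⟩ := exists_of_dotProduct_self_eq_two hm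
  rw [hn'] at hD
  rw [hm']
  have h1 : D (Pi.single i 1 + Pi.single j 1) q := by
    have := h.flip_pair_of hij.ne hi (Or.inl rfl) hD
    rw [add_comm] at this ⊢
    exact h.flip_pair_of hij.ne' hj (Or.inl rfl) this
  have h2 : D (Pi.single j' 1 + Pi.single i' 1) q := by
    by_cases hji : j' = i
    · subst hji
      exact h.move_pair hij.ne hij'.ne' h1
    · have := h.move_pair hij.ne (Ne.symm hji) h1
      rw [add_comm] at this
      exact h.move_pair hji hij'.ne' this
  have h3 := h.flip_pair_of hij'.ne' (Or.inl rfl) hj' h2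
  rw [add_comm] at h3
  exact h.flip_pair_of hij'.ne (Or.inl rfl) hi' h3

/-- The translations of the short roots. -/
def shortT (D : (Fin l → ℤ) → ℤ × ℤ → Prop) : Set (ℤ × ℤ) := {q | ∃ n, n ⬝ᵥ n = 1 ∧ D n q}

/-- The translations of the middle roots. -/
def middleT (D : (Fin l → ℤ) → ℤ × ℤ → Prop) : Set (ℤ × ℤ) := {q | ∃ n, n ⬝ᵥ n = 2 ∧ D n q}

/-- The translations of the long roots. -/
def longT (D : (Fin l → ℤ) → ℤ × ℤ → Prop) : Set (ℤ × ℤ) :=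
  {q | ∃ n, n ⬝ᵥ n = 1 ∧ D ((2 : ℤ) • n) q}

theorem mem_shortT (h : IsFramed D i₀) {n : Fin l → ℤ} (hn : n ⬝ᵥ n = 1) {q : ℤ × ℤ} :
    q ∈ shortT D ↔ D n q :=
  ⟨fun ⟨_, hm, hD⟩ => h.short_transitive hm hn hD, fun hD => ⟨n, hn, hD⟩⟩

theorem mem_middleT (h : IsFramed D i₀) {n : Fin l → ℤ} (hn : n ⬝ᵥ n = 2) {q : ℤ × ℤ} :
    q ∈ middleT D ↔ D n q :=
  ⟨fun ⟨_, hm, hD⟩ => h.middle_transitive hm hn hD, fun hD => ⟨n, hn, hD⟩⟩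

theorem mem_longT (h : IsFramed D i₀) {n : Fin l → ℤ} (hn : n ⬝ᵥ n = 1) {q : ℤ × ℤ} :
    q ∈ longT D ↔ D ((2 : ℤ) • n) q :=
  ⟨fun ⟨_, hm, hD⟩ => h.long_transitive hm hn hD, fun hD => ⟨n, hn, hD⟩⟩

theorem isIntRoot_iff (h : IsFramed D i₀) (n : Fin l → ℤ) (q : ℤ × ℤ) :
    D n q ↔ IsIntRoot (shortT D) (middleT D) (longT D) n q := by
  constructor
  · intro hD
    rcases h.isBCVec n q hD with hn | hn | ⟨m, rfl, hm⟩
    · exact Or.inl ⟨hn, (h.mem_shortT hn).2 hD⟩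
    · exact Or.inr (Or.inl ⟨hn, (h.mem_middleT hn).2 hD⟩)
    · exact Or.inr (Or.inr ⟨m, rfl, hm, (h.mem_longT hm).2 hD⟩)
  · rintro (⟨hn, hq⟩ | ⟨hn, hq⟩ | ⟨m, rfl, hm, hq⟩)
    · exact (h.mem_shortT hn).1 hq
    · exact (h.mem_middleT hn).1 hq
    · exact (h.mem_longT hm).1 hq

theorem exists_ne_of_middle {q : ℤ × ℤ} (hq : q ∈ middleT D) : ∃ i j : Fin l, i ≠ j :=
  let ⟨_, hn, _⟩ := hq
  let ⟨i, j, hij, _⟩ := exists_of_dotProduct_self_eq_two hn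
  ⟨i, j, hij.ne⟩

theorem single_sub_sq {i j : Fin l} (hij : i ≠ j) :
    (Pi.single i 1 - Pi.single j 1 : Fin l → ℤ) ⬝ᵥ (Pi.single i 1 - Pi.single j 1) = 2 := by
  simp [hij, hij.symm]

/-- By transitivity on each length every rule can be read off from a single reflection between
convenient representatives. -/
theorem reflClosed (h : IsFramed D i₀) : ReflClosed l (shortT D) (middleT D) (longT D) where
  neg_short := fun x ⟨n, hn, hD⟩ => ⟨-n, by simpa using hn, h.neg hD⟩
  neg_middle := fun x ⟨n, hn, hD⟩ => ⟨-n, by simpa using hn, h.neg hD⟩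
  neg_long := fun x ⟨n, hn, hD⟩ => ⟨-n, by simpa using hn, by rw [smul_neg]; exact h.neg hD⟩
  short_short := fun x ⟨n, hn, hD⟩ y hy =>
    ⟨-n, by simpa using hn, h.sub_smul hD ((h.mem_shortT hn).1 hy) 2 rfl (by
      rw [two_smul, sub_add_cancel_left])⟩
  middle_middle := fun x ⟨n, hn, hD⟩ y hy =>
    ⟨-n, by simpa using hn, h.sub_smul hD ((h.mem_middleT hn).1 hy) 2 rfl (by
      rw [two_smul, sub_add_cancel_left])⟩
  long_long := fun x ⟨n, hn, hD⟩ y hy =>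
    ⟨-n, by simpa using hn, h.sub_smul hD ((h.mem_longT hn).1 hy) 2 rfl (by
      module)⟩
  short_long := fun x ⟨n, hn, hD⟩ y hy =>
    ⟨-n, by simpa using hn, h.sub_smul hD ((h.mem_longT hn).1 hy) 4 (by
      rw [dotProduct_smul, smul_eq_mul]; ring) (by module)⟩
  long_short := fun x ⟨n, hn, hD⟩ y hy =>
    ⟨-n, by simpa using hn, by
      simpa using h.sub_smul hD ((h.mem_shortT hn).1 hy) 1 (m' := -n) (by
        simp only [dotProduct_smul, smul_dotProduct, smul_eq_mul]; ring) (by module)⟩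
  short_middle := fun x hx y hy => by
    obtain ⟨i, j, hij⟩ := exists_ne_of_middle hy
    rw [h.mem_middleT (single_sub_sq hij)] at hy
    rw [h.mem_shortT (n := Pi.single i 1) (by simp)] at hx
    exact ⟨-(Pi.single i 1 + Pi.single j 1), by simp [hij, hij.symm],
      h.sub_smul hx hy 2 (by simp [hij.symm]) (by module)⟩
  long_middle := fun x hx y hy => by
    obtain ⟨i, j, hij⟩ := exists_ne_of_middle hy
    rw [h.mem_middleT (single_sub_sq hij)] at hy
    rw [h.mem_longT (n := Pi.single i 1) (by simp)] at hx
    refine ⟨-(Pi.single i 1 + Pi.single j 1), by simp [hij, hij.symm], ?_⟩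
    have := h.sub_smul hx hy 1 (m' := -(Pi.single i 1 + Pi.single j 1))
      (by simp [hij.symm, -zsmul_eq_mul]) (by module)
    rwa [one_smul] at this
  middle_short := fun x hx y hy => by
    obtain ⟨i, j, hij⟩ := exists_ne_of_middle hx
    rw [h.mem_middleT (single_sub_sq hij)] at hx
    rw [h.mem_shortT (n := Pi.single i 1) (by simp)] at hy
    refine ⟨Pi.single j 1, by simp, ?_⟩
    simpa using h.sub_smul hx hy 1 (m' := Pi.single j 1) (by simp [hij, hij.symm]) (by module)
  middle_long := fun x hx y hy => by
    obtain ⟨i, j, hij⟩ := exists_ne_of_middle hx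
    rw [h.mem_middleT (single_sub_sq hij)] at hx
    rw [h.mem_longT (n := Pi.single i 1) (by simp)] at hy
    exact ⟨Pi.single j 1, by simp,
      h.sub_smul hx hy 2 (by simp [hij, hij.symm, -zsmul_eq_mul]) (by module)⟩
  middle_middle_sub := fun hl x hx y hy => by
    let i : Fin l := ⟨0, by omega⟩
    let j : Fin l := ⟨1, by omega⟩
    let k : Fin l := ⟨2, by omega⟩
    have hij : i ≠ j := by simp [i, j]
    have hik : i ≠ k := by simp [i, k]
    have hjk : j ≠ k := by simp [j, k]
    rw [h.mem_middleT (single_sub_sq hij)] at hx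
    rw [h.mem_middleT (single_sub_sq hik)] at hy
    refine ⟨Pi.single j 1 - Pi.single k 1, single_sub_sq hjk, ?_⟩
    simpa using h.sub_smul hx hy 1 (m' := Pi.single j 1 - Pi.single k 1)
      (by simp [hij, hij.symm, hik.symm, hjk.symm]) (by module)

theorem zero_mem_shortT (h : IsFramed D i₀) : 0 ∈ shortT D := ⟨_, by simp, h.short⟩

theorem zero_mem_longT (h : IsFramed D i₀) : 0 ∈ longT D := ⟨_, by simp, h.long⟩

theorem zero_mem_middleT (h : IsFramed D i₀) (hl : 2 ≤ l) : 0 ∈ middleT D :=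
  have hij : (⟨0, by omega⟩ : Fin l) ≠ ⟨1, by omega⟩ := by simp
  ⟨_, single_sub_sq hij, h.middle' hij⟩

/-- Reflecting `ε_i` in middle and long roots shows `M ⊂ S` and `E ⊂ S`. So the translation part of
any integral combination of roots lies in the group generated by `S`; apply this to `a` and `b`. -/
theorem closure_shortT (h : IsFramed D i₀)
    (ha : ((0, (1, 0)) : (Fin l → ℤ) × (ℤ × ℤ)) ∈ AddSubgroup.closure {x | D x.1 x.2})
    (hb : ((0, (0, 1)) : (Fin l → ℤ) × (ℤ × ℤ)) ∈ AddSubgroup.closure {x | D x.1 x.2}) :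
    AddSubgroup.closure (shortT D) = ⊤ := by
  have hr := h.reflClosed
  have hle : AddSubgroup.closure {x : (Fin l → ℤ) × (ℤ × ℤ) | D x.1 x.2} ≤
      (AddSubgroup.closure (shortT D)).comap (AddMonoidHom.snd _ _) := by
    rw [AddSubgroup.closure_le]
    rintro ⟨n, q⟩ hD
    refine AddSubgroup.subset_closure (k := shortT D) ?_
    change q ∈ shortT D
    rcases (h.isIntRoot_iff n q).1 hD with ⟨-, hq⟩ | ⟨-, hq⟩ | ⟨-, -, -, hq⟩
    · exact hq
    · simpa using hr.neg_short _ (hr.middle_short q hq 0 h.zero_mem_shortT)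
    · simpa using hr.neg_short _ (hr.long_short q hq 0 h.zero_mem_shortT)
  refine eq_top_iff.2 fun z _ => ?_
  have e : z = z.1 • (1, 0) + z.2 • (0, 1) := by ext <;> simp
  rw [e]
  exact add_mem (zsmul_mem (hle ha) _) (zsmul_mem (hle hb) _)

/-- The translation sets of a framed root system are, up to a change of frame, those of a type from
the list. -/
theorem exists_type (h : IsFramed D i₀)
    (ha : ((0, (1, 0)) : (Fin l → ℤ) × (ℤ × ℤ)) ∈ AddSubgroup.closure {x | D x.1 x.2})
    (hb : ((0, (0, 1)) : (Fin l → ℤ) × (ℤ × ℤ)) ∈ AddSubgroup.closure {x | D x.1 x.2}) :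
    ∃ t : EllipticType, t.Admissible l ∧ MarkedSimilar (form l)
      (rootsOf l (shortT D) (middleT D) (longT D)) (lineA l) (form l) (t.roots l) (lineA l) := by
  have hr := h.reflClosed
  have hfc : ∃ (t : EllipticType) (k : ℤ) (ξ : Fin l → ℤ × ℤ), t.Admissible l ∧
      FrameChange l k ξ (shortT D) (middleT D) (longT D) t.shortSet t.middleSet t.longSet := by
    rcases Nat.lt_or_ge l 2 with hl | hl
    · obtain rfl : l = 1 := by have := i₀.2; omega
      exact exists_frameChange_one h.zero_mem_shortT h.zero_mem_longT (h.closure_shortT ha hb)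
        hr.neg_short hr.neg_long hr.short_short hr.short_long hr.long_short hr.long_long _
    · exact exists_frameChange hl hr h.zero_mem_shortT (h.zero_mem_middleT hl) h.zero_mem_longT
        (h.closure_shortT ha hb)
  obtain ⟨t, k, ξ, ht, hf⟩ := hfc
  have ht' := EllipticType.reflClosed ht
  exact ⟨t, ht, hf.markedSimilar hr.neg_short hr.neg_middle hr.neg_long ht'.neg_short
    ht'.neg_middle ht'.neg_long⟩

end IsFramed
end MERS

namespace MERS

/-! ### Plane lattices -/

/-- A plane lattice has a basis whose first vector lies on a given rational line. -/
theorem exists_lattice_basis {W : Type*} [NormedAddCommGroup W] [NormedSpace ℝ W]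
    [FiniteDimensional ℝ W] (hW : Module.finrank ℝ W = 2) (L : Submodule ℤ W) [DiscreteTopology L]
    (hL : Submodule.span ℝ (L : Set W) = ⊤) {x : W} (hx : x ∈ L) (hx0 : x ≠ 0) :
    ∃ B : Module.Basis (Fin 2) ℝ W, (∃ c : ℝ, B 0 = c • x) ∧
      L = Submodule.span ℤ (Set.range B) := by
  have : IsZLattice ℝ L := ⟨hL⟩
  have hfin : Module.Finite ℤ L := ZLattice.module_finite ℝ L
  have hfree : Module.Free ℤ L := ZLattice.module_free ℝ L
  have hrank : Module.finrank ℤ L = 2 := (ZLattice.rank ℝ L).trans hW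
  let b := Module.finBasisOfFinrankEq ℤ L hrank
  let U : Module.Basis (Fin 2) ℝ W := b.ofZLatticeBasis ℝ L
  have hU : Submodule.span ℤ (Set.range U) = L := b.ofZLatticeBasis_span ℝ L
  have hmemL : ∀ y, y ∈ L ↔ ∃ m n : ℤ, y = m • U 0 + n • U 1 := by
    intro y
    have hrange : Set.range U = {U 0, U 1} := by
      ext z; simp [Fin.exists_fin_two, eq_comm]
    rw [← hU, hrange, Submodule.mem_span_pair]
    simp only [eq_comm]
  obtain ⟨p, q, hpq⟩ := (hmemL x).1 hx
  have hg : (Int.gcd p q : ℤ) ≠ 0 := fun h0 => by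
    have h0' : Int.gcd p q = 0 := by exact_mod_cast h0
    rw [Int.gcd_eq_zero_iff] at h0'
    exact hx0 (by rw [hpq, h0'.1, h0'.2]; simp)
  obtain ⟨p', hp'⟩ := Int.gcd_dvd_left p q
  obtain ⟨q', hq'⟩ := Int.gcd_dvd_right p q
  have hbez : p' * Int.gcdA p q + q' * Int.gcdB p q = 1 := by
    have := Int.gcd_eq_gcd_ab p q
    apply mul_left_cancel₀ hg
    linear_combination (-1) * this - Int.gcdA p q * hp' - Int.gcdB p q * hq'
  set r := Int.gcdA p q
  set s := Int.gcdB p q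
  -- Dividing `x` by the gcd of its coordinates makes it primitive; the Bézout coefficients complete
  -- it to a basis with determinant `p' r + q' s = 1`.
  let a : W := p' • U 0 + q' • U 1
  let c : W := (-s) • U 0 + r • U 1
  have hu : U 0 = r • a - q' • c := by
    have e : r • a - q' • c = (p' * r + q' * s) • U 0 + (r * q' - q' * r) • U 1 := by
      simp only [a, c]; module
    rw [e, hbez, mul_comm r, sub_self]; simp
  have hv : U 1 = s • a + p' • c := by
    have e : s • a + p' • c = (s * p' - p' * s) • U 0 + (p' * r + q' * s) • U 1 := by
      simp only [a, c]; module
    rw [e, hbez, mul_comm s, sub_self]; simp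
  have hcoe : ∀ (m : ℤ) (w : W), m • w = (m : ℝ) • w := fun m w => (Int.cast_smul_eq_zsmul ℝ m w).symm
  have hrange : Set.range ![a, c] = {a, c} := by
    ext z; simp [or_comm]
  have hspan : ⊤ ≤ Submodule.span ℝ (Set.range ![a, c]) := by
    rw [← U.span_eq, Submodule.span_le, hrange]
    have ha : a ∈ Submodule.span ℝ {a, c} := Submodule.subset_span (by simp)
    have hc : c ∈ Submodule.span ℝ {a, c} := Submodule.subset_span (by simp)
    rintro _ ⟨i, rfl⟩
    fin_cases i
    · change U 0 ∈ _
      rw [hu, hcoe, hcoe]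
      exact Submodule.sub_mem _ (Submodule.smul_mem _ _ ha) (Submodule.smul_mem _ _ hc)
    · change U 1 ∈ _
      rw [hv, hcoe, hcoe]
      exact Submodule.add_mem _ (Submodule.smul_mem _ _ ha) (Submodule.smul_mem _ _ hc)
  let B := basisOfTopLeSpanOfCardEqFinrank ![a, c] hspan (by simp [hW])
  have hB : ⇑B = ![a, c] := coe_basisOfTopLeSpanOfCardEqFinrank _ _ _
  refine ⟨B, ⟨((Int.gcd p q : ℤ) : ℝ)⁻¹, ?_⟩, ?_⟩
  · have e : x = (Int.gcd p q : ℤ) • a := by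
      simp only [a, smul_add, smul_smul]
      rw [← hp', ← hq', hpq]
    have hg' : ((Int.gcd p q : ℤ) : ℝ) ≠ 0 := by exact_mod_cast hg
    rw [hB, e, hcoe, smul_smul, inv_mul_cancel₀ hg', one_smul]
    rfl
  · rw [hB, hrange]
    refine le_antisymm ?_ ?_
    · rw [← hU, Submodule.span_le]
      have ha : a ∈ Submodule.span ℤ {a, c} := Submodule.subset_span (by simp)
      have hc : c ∈ Submodule.span ℤ {a, c} := Submodule.subset_span (by simp)
      rintro _ ⟨i, rfl⟩
      fin_cases i
      · change U 0 ∈ _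
        rw [hu]
        exact Submodule.sub_mem _ (Submodule.smul_mem _ _ ha) (Submodule.smul_mem _ _ hc)
      · change U 1 ∈ _
        rw [hv]
        exact Submodule.add_mem _ (Submodule.smul_mem _ _ ha) (Submodule.smul_mem _ _ hc)
    · rw [Submodule.span_le]
      rintro _ (rfl | rfl)
      · exact (hmemL _).2 ⟨_, _, rfl⟩
      · exact (hmemL _).2 ⟨_, _, rfl⟩

/-! ### Forms of signature `(l, 2, 0)` -/

/-- As there are no negative squares, `F` modulo the radical is Euclidean `l`-space, and `I` is the
pullback of its scalar product. -/
theorem HasSignature.exists_projection {F : Type*} [NormedAddCommGroup F] [NormedSpace ℝ F]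
    {I : LinearMap.BilinForm ℝ F} {l : ℕ} (h : HasSignature I l 2 0) :
    FiniteDimensional ℝ F ∧ Module.finrank ℝ F = l + 2 ∧
    ∃ p : F →ₗ[ℝ] (Fin l → ℝ), Function.Surjective p ∧ ∀ x y, I x y = p x ⬝ᵥ p y := by
  obtain ⟨ε, hoff, hone, hzero, -⟩ := h
  have hfd : FiniteDimensional ℝ F := Module.Basis.finiteDimensional_of_finite ε
  refine ⟨hfd, by simp [Module.finrank_eq_card_basis ε], ?_⟩
  let p : F →ₗ[ℝ] (Fin l → ℝ) := LinearMap.pi fun i => ε.coord (Sum.inl i)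
  have hp : ∀ x i, p x i = ε.repr x (Sum.inl i) := fun _ _ => rfl
  have hpe : ∀ i, p (ε (Sum.inl i)) = Pi.single i 1 := fun i => by
    ext j; rw [hp, ε.repr_self, Finsupp.single_apply, Pi.single_apply]; simp [eq_comm]
  have hpe' : ∀ i, p (ε (Sum.inr i)) = 0 := fun i => by
    ext j; rw [hp, ε.repr_self, Finsupp.single_apply]; simp
  refine ⟨p, fun v => ⟨∑ i, v i • ε (Sum.inl i), ?_⟩, ?_⟩
  · simp only [map_sum, map_smul, hpe]
    ext j; simp [Finset.sum_apply, Pi.single_apply]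
  · let J : LinearMap.BilinForm ℝ F := LinearMap.mk₂ ℝ (fun x y => p x ⬝ᵥ p y)
      (by simp) (by simp) (by simp) (by simp)
    have hJ : I = J := by
      refine LinearMap.BilinForm.ext_basis ε fun i j => ?_
      change _ = p (ε i) ⬝ᵥ p (ε j)
      by_cases hij : i = j
      · subst hij
        rcases i with i | i | i
        · rw [hone, hpe]; simp
        · rw [hzero, hpe']; simp
        · exact i.elim0
      · rw [hoff i j hij]
        rcases i with i | i <;> rcases j with j | j
        · have : i ≠ j := fun h => hij (by rw [h])
          simp [hpe, this]
        all_goals simp [hpe']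
    intro x y
    rw [hJ]; rfl

end MERS

namespace MERS

/-! ### Existence -/

section

variable {F F' F'' : Type*} [NormedAddCommGroup F] [NormedSpace ℝ F] [NormedAddCommGroup F']
  [NormedSpace ℝ F'] [NormedAddCommGroup F''] [NormedSpace ℝ F'']

theorem MarkedSimilar.trans {I : LinearMap.BilinForm ℝ F} {R : Set F} {G : Submodule ℝ F}
    {I' : LinearMap.BilinForm ℝ F'} {R' : Set F'} {G' : Submodule ℝ F'}
    {I'' : LinearMap.BilinForm ℝ F''} {R'' : Set F''} {G'' : Submodule ℝ F''}
    (h : MarkedSimilar I R G I' R' G') (h' : MarkedSimilar I' R' G' I'' R'' G'') :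
    MarkedSimilar I R G I'' R'' G'' := by
  obtain ⟨e, hR, hG, c, hc, hI⟩ := h
  obtain ⟨e', hR', hG', c', hc', hI'⟩ := h'
  refine ⟨e.trans e', ?_, ?_, c' * c, mul_pos hc' hc, fun x y => ?_⟩
  · rw [← hR', ← hR, Set.image_image]; rfl
  · rw [← hG', ← hG, Set.image_image]; rfl
  · rw [LinearEquiv.trans_apply, LinearEquiv.trans_apply, hI', hI, mul_assoc]

theorem MarkedSimilar.markedIso {I : LinearMap.BilinForm ℝ F} {R : Set F} {G : Submodule ℝ F}
    {I' : LinearMap.BilinForm ℝ F'} {R' : Set F'} {G' : Submodule ℝ F'}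
    (h : MarkedSimilar I R G I' R' G') : MarkedIso R G R' G' :=
  let ⟨e, hR, hG, _⟩ := h; ⟨e, hR, hG⟩

theorem MarkedIso.symm {R : Set F} {G : Submodule ℝ F} {R' : Set F'} {G' : Submodule ℝ F'}
    (h : MarkedIso R G R' G') : MarkedIso R' G' R G := by
  obtain ⟨e, hR, hG⟩ := h
  refine ⟨e.symm, ?_, ?_⟩
  · rw [← hR, Set.image_image]; simp
  · rw [← hG, Set.image_image]; simp

theorem MarkedIso.trans {R : Set F} {G : Submodule ℝ F} {R' : Set F'} {G' : Submodule ℝ F'}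
    {R'' : Set F''} {G'' : Submodule ℝ F''} (h : MarkedIso R G R' G')
    (h' : MarkedIso R' G' R'' G'') : MarkedIso R G R'' G'' := by
  obtain ⟨e, hR, hG⟩ := h
  obtain ⟨e', hR', hG'⟩ := h'
  refine ⟨e.trans e', ?_, ?_⟩
  · rw [← hR', ← hR, Set.image_image]; rfl
  · rw [← hG', ← hG, Set.image_image]; rfl

/-- An isomorphism of pairs induces an isomorphism of the quotients. -/
theorem MarkedIso.exists_quotient {R : Set F} {G : Submodule ℝ F} {R' : Set F'}
    {G' : Submodule ℝ F'} (h : MarkedIso R G R' G') :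
    ∃ e : (F ⧸ G) ≃ₗ[ℝ] (F' ⧸ G'), e '' quotientRoots R G = quotientRoots R' G' := by
  obtain ⟨e, hR, hG⟩ := h
  have hG' : G.map (e : F →ₗ[ℝ] F') = G' := SetLike.coe_injective (by simpa using hG)
  refine ⟨Submodule.Quotient.equiv G G' e hG', ?_⟩
  rw [quotientRoots, quotientRoots, ← hR, Set.image_image, Set.image_image]
  rfl

theorem IsGeneralizedRootSystem.exists_refl {I : LinearMap.BilinForm ℝ F} {R : Set F}
    (hI : ∀ x y, I x y = I y x) (h : IsGeneralizedRootSystem I R) {α β : F} (hα : α ∈ R)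
    (hβ : β ∈ R) : ∃ k : ℤ, 2 * I α β = k * I α α ∧ β - (k : ℝ) • α ∈ R := by
  obtain ⟨k, hk⟩ := h.integral α hα β hβ
  have hk' := (coroot_apply_eq_iff (h.nonisotropic α hα) _).1 hk
  refine ⟨k, hk', ?_⟩
  rw [← refl_eq hI (h.nonisotropic α hα) hk', ← h.refl_image α hα]
  exact ⟨β, hβ, rfl⟩

end

variable {l : ℕ} {F : Type*} [NormedAddCommGroup F] [NormedSpace ℝ F]
  {I : LinearMap.BilinForm ℝ F} {R : Set F} {G : Submodule ℝ F}

theorem exists_two_smul_mem_of_not_isReduced (h : ¬ IsReduced R) :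
    ∃ α ∈ R, (2 : ℝ) • α ∈ R := by
  simp only [IsReduced, not_forall, not_and_or, not_not] at h
  obtain ⟨α, hα, h | h⟩ := h
  · exact ⟨α, hα, h⟩
  · exact ⟨_, h, by simpa [smul_smul] using hα⟩

theorem IsMarkedElliptic.span_eq_top (h : IsMarkedElliptic l I R G) :
    Submodule.span ℝ R = ⊤ := by
  rw [eq_top_iff, ← h.rootSystem.lattice_full, Submodule.span_le]
  exact fun x hx => Submodule.span_subset_span ℤ ℝ R hx

/-- The image of the roots modulo the radical. -/
theorem IsMarkedElliptic.isCrystallographic_image (h : IsMarkedElliptic l I R G)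
    {p : F →ₗ[ℝ] (Fin l → ℝ)} (hp : ∀ x y, I x y = p x ⬝ᵥ p y) :
    IsCrystallographic (p '' R) where
  ne_zero := by
    rintro _ ⟨x, hx, rfl⟩ h0
    exact h.rootSystem.nonisotropic x hx (by rw [hp, h0]; simp)
  refl := by
    rintro _ ⟨x, hx, rfl⟩ _ ⟨y, hy, rfl⟩
    obtain ⟨k, hk, hmem⟩ := h.rootSystem.exists_refl h.symm hx hy
    exact ⟨k, by rw [← hp, ← hp]; exact hk, _, hmem, by simp⟩

theorem IsMarkedElliptic.irreducible_image (h : IsMarkedElliptic l I R G)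
    {p : F →ₗ[ℝ] (Fin l → ℝ)} (hp : ∀ x y, I x y = p x ⬝ᵥ p y) (P : (Fin l → ℝ) → Prop)
    (hP : ∀ α ∈ p '' R, ∀ β ∈ p '' R, P α → ¬ P β → α ⬝ᵥ β = 0) (hne : ∃ α ∈ p '' R, P α) :
    ∀ α ∈ p '' R, P α := by
  obtain ⟨_, ⟨x, hx, rfl⟩, hPx⟩ := hne
  rintro _ ⟨y, hy, rfl⟩
  by_contra hPy
  have := h.rootSystem.irreducible {z ∈ R | P (p z)} {z ∈ R | ¬ P (p z)}
    (by ext z; simp only [Set.mem_union, Set.mem_ofPred_eq]; tauto)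
    (fun α hα β hβ => by
      rw [hp]; exact hP _ ⟨α, hα.1, rfl⟩ _ ⟨β, hβ.1, rfl⟩ hα.2 hβ.2)
  rcases this with h' | h'
  · exact (h' ▸ (⟨hx, hPx⟩ : x ∈ {z ∈ R | P (p z)}) : x ∈ (∅ : Set F))
  · exact (h' ▸ (⟨hy, hPy⟩ : y ∈ {z ∈ R | ¬ P (p z)}) : y ∈ (∅ : Set F))

theorem realPt_add (n m : Fin l → ℤ) (p q : ℤ × ℤ) :
    realPt (n + m) (p + q) = realPt n p + realPt m q := by
  simp [realPt, realVec_add]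

/-- Every non-reduced marked elliptic root system is isomorphic to one from the list. -/
theorem IsMarkedElliptic.exists_type (h : IsMarkedElliptic l I R G) (hnr : ¬ IsReduced R) :
    ∃ t : EllipticType, t.Admissible l ∧
      MarkedSimilar I R G (form l) (t.roots l) (lineA l) := by
  obtain ⟨hfd, hdim, p, hpsurj, hp⟩ := h.signature.exists_projection
  obtain ⟨α₀, hα₀, hα₀'⟩ := exists_two_smul_mem_of_not_isReduced hnr
  have hcr := h.isCrystallographic_image hp
  obtain ⟨e, i₀, he₀, heN, horth, hmid, hcomb⟩ := hcr.exists_frame (h.irreducible_image hp)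
    (by rw [Submodule.span_image, h.span_eq_top, Submodule.map_top, LinearMap.range_eq_top.2 hpsurj])
    (α₀ := p α₀) ⟨⟨α₀, hα₀, rfl⟩, ⟨_, hα₀', by simp⟩⟩
  set N := p α₀ ⬝ᵥ p α₀ with hN
  have hNpos : 0 < N := dotProduct_self_pos (hcr.ne_zero _ ⟨α₀, hα₀, rfl⟩)
  -- lifts of the frame
  have hlift : ∀ i, ∃ x : F, p x = e i ∧ (i = i₀ → x = α₀) ∧ (i ≠ i₀ → α₀ - x ∈ R) := by
    intro i
    by_cases hi : i = i₀
    · exact ⟨α₀, by rw [hi, he₀], fun _ => rfl, fun h' => absurd hi h'⟩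
    · obtain ⟨β, hβ, hβ'⟩ := hmid i hi
      -- Taking `α₀ - β`, with `β` a root over `α₀ - e i`, makes the frame root `ε_{i₀} - ε_i` a
      -- root with translation zero.
      exact ⟨α₀ - β, by rw [map_sub, hβ']; abel, fun h' => absurd h' hi, fun _ => by simpa using hβ⟩
  choose f hf hf₀ hf₁ using hlift
  have hf₀ := hf₀ i₀ rfl
  have hRQ : ∀ x ∈ R, x ∈ rootLattice R := fun x hx => Submodule.subset_span hx
  have hfQ : ∀ i, f i ∈ rootLattice R := by
    intro i
    by_cases hi : i = i₀
    · rw [hi, hf₀]; exact hRQ _ hα₀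
    · have := Submodule.sub_mem _ (hRQ _ hα₀) (hRQ _ (hf₁ i hi))
      simpa using this
  have hfsum : ∀ c : Fin l → ℝ, p (∑ i, c i • f i) = ∑ i, c i • e i := fun c => by
    simp [hf]
  have hrootQ : ∀ x ∈ R, ∃ n : Fin l → ℤ, IsBCVec n ∧ p x = ∑ i, (n i : ℝ) • e i ∧
      x - ∑ i, (n i : ℝ) • f i ∈ rootLattice R := by
    intro x hx
    obtain ⟨n, hn, hn'⟩ := hcomb _ ⟨x, hx, rfl⟩
    refine ⟨n, hn', hn, Submodule.sub_mem _ (hRQ _ hx) (Submodule.sum_mem _ fun i _ => ?_)⟩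
    rw [Int.cast_smul_eq_zsmul]
    exact Submodule.smul_mem _ _ (hfQ i)
  -- the radical
  let W : Submodule ℝ F := LinearMap.ker p
  have hGW : G ≤ W := fun x hx => by
    have hx0 : I x = 0 := h.marking.le_rad hx
    have : p x ⬝ᵥ p x = 0 := by rw [← hp, hx0]; rfl
    exact dotProduct_self_eq_zero.1 this
  have hW2 : Module.finrank ℝ W = 2 := by
    have := LinearMap.finrank_range_add_finrank_ker p
    rw [LinearMap.range_eq_top.2 hpsurj, finrank_top, Module.finrank_fin_fun, hdim] at this
    change Module.finrank ℝ (LinearMap.ker p) = 2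
    omega
  have hdisc := h.rootSystem.lattice_discrete
  let L : Submodule ℤ W := ZLattice.comap ℝ (rootLattice R) W.subtype
  have hLdisc : DiscreteTopology L := ZLattice.comap_discreteTopology ℝ (rootLattice R)
    continuous_subtype_val Subtype.val_injective
  have hmemL : ∀ x : W, x ∈ L ↔ (x : F) ∈ rootLattice R := fun _ => Iff.rfl
  let s : (Fin l → ℝ) →ₗ[ℝ] F := e.constr ℝ f
  have hs : ∀ c : Fin l → ℝ, s (∑ i, c i • e i) = ∑ i, c i • f i := fun c => by
    simp [s]
  -- The projection `x ↦ x - s (p x)` onto the radical is the identity there and maps roots into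
  -- `L`. As the roots span `F`, the lattice `L` spans the radical.
  have hLspan : Submodule.span ℝ (L : Set W) = ⊤ := by
    have hle : Submodule.span ℝ R ≤ ((Submodule.span ℝ (L : Set W)).map W.subtype).comap
        (LinearMap.id - s ∘ₗ p) := by
      rw [Submodule.span_le]
      intro x hx
      obtain ⟨n, -, hn, hQ⟩ := hrootQ x hx
      have hker : x - ∑ i, (n i : ℝ) • f i ∈ W := by
        change p _ = 0
        rw [map_sub, hfsum, hn, sub_self]
      refine ⟨⟨_, hker⟩, Submodule.subset_span ((hmemL _).2 hQ), ?_⟩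
      simp [hn, hs]
    rw [h.span_eq_top] at hle
    refine eq_top_iff.2 fun x _ => ?_
    obtain ⟨y, hy, hyx⟩ := hle (Submodule.mem_top (x := (x : F)))
    have hx0 : p (x : F) = 0 := x.2
    have : y = x := Subtype.ext (by simpa [hx0] using hyx)
    rwa [← this]
  -- a lattice basis adapted to the marking
  obtain ⟨x₀, hx₀G, hx₀Q, hx₀⟩ : ∃ x ∈ G, x ∈ rootLattice R ∧ x ≠ 0 := by
    by_contra! hcon
    have hbot : G = ⊥ := by
      rw [← h.marking.full, Submodule.span_eq_bot]
      exact fun x hx => hcon x hx.1 hx.2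
    have := h.marking.finrank_eq
    rw [hbot, finrank_bot] at this
    exact zero_ne_one this
  obtain ⟨B, ⟨c, hBc⟩, hBL⟩ := exists_lattice_basis hW2 L hLspan
    (x := ⟨x₀, hGW hx₀G⟩) ((hmemL _).2 hx₀Q) (fun h0 => hx₀ (congrArg Subtype.val h0))
  set a : F := (B 0 : F) with ha
  set b : F := (B 1 : F) with hb
  have haG : a ∈ G := by
    rw [ha, hBc]; exact Submodule.smul_mem _ _ hx₀G
  have hpa : p a = 0 := (B 0).2
  have hpb : p b = 0 := (B 1).2
  have hab : ∀ x y : ℝ, x • a + y • b = 0 → x = 0 ∧ y = 0 := by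
    intro x y hxy
    have := Fintype.linearIndependent_iff.1 B.linearIndependent ![x, y] (by
      rw [Fin.sum_univ_two]; exact Subtype.ext hxy)
    exact ⟨this 0, this 1⟩
  have hWab : ∀ x ∈ W, ∃ y z : ℝ, x = y • a + z • b := by
    intro x hx
    have := B.sum_repr ⟨x, hx⟩
    rw [Fin.sum_univ_two] at this
    exact ⟨_, _, (congrArg Subtype.val this).symm⟩
  have hLab : ∀ x ∈ W, x ∈ rootLattice R → ∃ m n : ℤ, x = (m : ℝ) • a + (n : ℝ) • b := by
    intro x hx hxQ
    have hmem : (⟨x, hx⟩ : W) ∈ L := hxQ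
    have hrange : Set.range B = {B 0, B 1} := by
      ext z; simp [Fin.exists_fin_two, eq_comm]
    rw [hBL, hrange, Submodule.mem_span_pair] at hmem
    obtain ⟨m, n, hmn⟩ := hmem
    refine ⟨m, n, ?_⟩
    rw [Int.cast_smul_eq_zsmul, Int.cast_smul_eq_zsmul]
    exact (congrArg Subtype.val hmn).symm
  -- coordinates
  let T₀ : Space l →ₗ[ℝ] F :=
    { toFun := fun w => ∑ i, w.1 i • f i + (w.2.1 • a + w.2.2 • b)
      map_add' := fun v w => by
        simp only [Prod.fst_add, Prod.snd_add, Pi.add_apply, add_smul, Finset.sum_add_distrib]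
        abel
      map_smul' := fun r w => by
        simp only [Prod.smul_fst, Prod.smul_snd, Pi.smul_apply, smul_eq_mul, mul_smul, smul_add,
          Finset.smul_sum, RingHom.id_apply] }
  have hT₀ : ∀ w, T₀ w = ∑ i, w.1 i • f i + (w.2.1 • a + w.2.2 • b) := fun _ => rfl
  have hpT : ∀ w, p (T₀ w) = ∑ i, w.1 i • e i := fun w => by
    rw [hT₀, map_add, hfsum]; simp [hpa, hpb]
  have hinj : Function.Injective T₀ := by
    refine (injective_iff_map_eq_zero T₀).2 fun w hw => ?_
    have h1 : w.1 = 0 := by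
      have := hpT w
      rw [hw, map_zero] at this
      ext i
      exact Fintype.linearIndependent_iff.1 e.linearIndependent w.1 this.symm i
    have h2 : w.2.1 • a + w.2.2 • b = 0 := by
      rw [hT₀, h1] at hw; simpa using hw
    exact Prod.ext h1 (Prod.ext (hab _ _ h2).1 (hab _ _ h2).2)
  have hsurj : Function.Surjective T₀ := by
    intro x
    have hx : x - ∑ i, e.repr (p x) i • f i ∈ W := by
      change p _ = 0
      rw [map_sub, hfsum, e.sum_repr, sub_self]
    obtain ⟨y, z, hyz⟩ := hWab _ hx
    exact ⟨(e.repr (p x), (y, z)), by rw [hT₀, ← hyz]; simp⟩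
  let T : Space l ≃ₗ[ℝ] F := LinearEquiv.ofBijective T₀ ⟨hinj, hsurj⟩
  have hT : ∀ w, T w = ∑ i, w.1 i • f i + (w.2.1 • a + w.2.2 • b) := fun _ => rfl
  have hTI : ∀ v w, I (T v) (T w) = N * form l v w := by
    intro v w
    rw [hp, form_apply]
    change p (T₀ v) ⬝ᵥ p (T₀ w) = _
    rw [hpT, hpT, sum_dotProduct, dotProduct, Finset.mul_sum]
    refine Finset.sum_congr rfl fun i _ => ?_
    rw [dotProduct_sum, Finset.sum_eq_single_of_mem i (Finset.mem_univ _) fun j _ hj => by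
      rw [smul_dotProduct, dotProduct_smul, horth i j hj.symm, smul_zero, smul_zero]]
    rw [smul_dotProduct, dotProduct_smul, heN, smul_eq_mul, smul_eq_mul]
    ring
  -- A root minus the corresponding integral combination of lifted frame vectors lies in the radical
  -- and in the root lattice, so its coordinates in `a, b` are integers.
  have hTint : ∀ w, T w ∈ R → ∃ n q, w = realPt n q ∧ IsBCVec n := by
    intro w hw
    obtain ⟨n, hn, hpn, hQ⟩ := hrootQ _ hw
    have h1 : w.1 = realVec n := by
      have hpw : p (T w) = ∑ i, w.1 i • e i := hpT w
      rw [hpw] at hpn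
      have := congrArg e.repr hpn
      ext i
      have := congrArg (fun g => g i) this
      change w.1 i = (n i : ℝ)
      simpa [Finsupp.single_apply] using this
    have h2 : T w - ∑ i, (n i : ℝ) • f i = w.2.1 • a + w.2.2 • b := by
      rw [hT, h1]; simp [realVec]
    rw [h2] at hQ
    obtain ⟨m, k, hmk⟩ := hLab _ (by change p _ = 0; simp [hpa, hpb]) hQ
    have h3 := hab (w.2.1 - m) (w.2.2 - k) (by
      rw [sub_smul, sub_smul, sub_add_sub_comm, hmk, sub_self])
    exact ⟨n, (m, k), Prod.ext h1 (Prod.ext (sub_eq_zero.1 h3.1) (sub_eq_zero.1 h3.2)), hn⟩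
  -- the root system in integer coordinates
  let D : (Fin l → ℤ) → ℤ × ℤ → Prop := fun n q => T (realPt n q) ∈ R
  have hTf : ∀ n : Fin l → ℤ, T (realPt n 0) = ∑ i, (n i : ℝ) • f i := fun n => by
    rw [hT]; simp [realPt, realVec]
  have hTsingle : ∀ (i : Fin l) , T (realPt (Pi.single i 1) 0) = f i := fun i => by
    rw [hTf, Finset.sum_eq_single_of_mem i (Finset.mem_univ _) fun j _ hj => by simp [hj]]
    simp
  have hD : IsFramed D i₀ := by
    refine ⟨fun n q hnq => ?_, fun n q m r hn hm => ?_, ?_, ?_, fun i hi => ?_⟩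
    · obtain ⟨n', q', h1, h2⟩ := hTint _ hnq
      rwa [(realPt_injective h1).1]
    · obtain ⟨k, hk, hmem⟩ := h.rootSystem.exists_refl h.symm hn hm
      refine ⟨k, ?_, ?_⟩
      · rw [hTI, hTI, form_realPt, form_realPt] at hk
        have : (2 : ℝ) * ((n ⬝ᵥ m : ℤ) : ℝ) = k * ((n ⬝ᵥ n : ℤ) : ℝ) :=
          mul_left_cancel₀ hNpos.ne' (by linarith)
        exact_mod_cast this
      · change T _ ∈ R
        rwa [realPt_sub_smul, map_sub, map_smul]
    · change T _ ∈ R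
      rwa [hTsingle, hf₀]
    · change T _ ∈ R
      have e₁ : realPt ((2 : ℤ) • Pi.single i₀ 1) 0 = (2 : ℝ) • realPt (Pi.single i₀ 1) 0 := by
        simp [realPt, realVec_smul, -zsmul_eq_mul]
      rwa [e₁, map_smul, hTsingle, hf₀]
    · change T _ ∈ R
      have e₁ : realPt (Pi.single i₀ 1 - Pi.single i 1) 0 =
          realPt (Pi.single i₀ 1) 0 - realPt (Pi.single i 1) 0 := by
        simp [realPt, realVec_sub]
      rw [e₁, map_sub, hTsingle, hTsingle, hf₀]
      exact hf₁ i hi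
  let ψ : (Fin l → ℤ) × (ℤ × ℤ) →+ F :=
    AddMonoidHom.mk' (fun x => T (realPt x.1 x.2)) fun x y => by
      rw [Prod.fst_add, Prod.snd_add, realPt_add, map_add]
  have hψ : ∀ x, ψ x = T (realPt x.1 x.2) := fun _ => rfl
  have hψinj : Function.Injective ψ := fun x y hxy => by
    have := realPt_injective (T.injective hxy)
    exact Prod.ext this.1 this.2
  -- Roots have integral coordinates and `ψ` is injective, so membership in the root lattice can be
  -- tested in `ℤ^l × Λ`. This transfers `a, b ∈ Q(R)`, which is what forces `S` to generate `Λ`.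
  have hclosure : ∀ x, ψ x ∈ rootLattice R → x ∈ AddSubgroup.closure {x | D x.1 x.2} := by
    have hle : rootLattice R ≤
        AddSubgroup.toIntSubmodule ((AddSubgroup.closure {x | D x.1 x.2}).map ψ) := by
      refine Submodule.span_le.2 fun y hy => ?_
      obtain ⟨w, rfl⟩ := T.surjective y
      obtain ⟨n, q, rfl, -⟩ := hTint w hy
      exact ⟨(n, q), AddSubgroup.subset_closure hy, rfl⟩
    intro x hx
    obtain ⟨y, hy, hyx⟩ := hle hx
    rwa [← hψinj hyx]
  have hBQ : ∀ i, (B i : F) ∈ rootLattice R := fun i => by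
    rw [← hmemL, hBL]; exact Submodule.subset_span ⟨i, rfl⟩
  obtain ⟨t, ht, hsim⟩ := hD.exists_type
    (hclosure _ (by
      have : ψ (0, (1, 0)) = a := by rw [hψ, hT]; simp [realPt, realVec]
      rw [this]; exact hBQ 0))
    (hclosure _ (by
      have : ψ (0, (0, 1)) = b := by rw [hψ, hT]; simp [realPt, realVec]
      rw [this]; exact hBQ 1))
  refine ⟨t, ht, MarkedSimilar.trans ⟨T.symm, ?_, ?_, N⁻¹, inv_pos.2 hNpos, fun x y => ?_⟩ hsim⟩
  · ext w
    rw [LinearEquiv.image_symm_eq_preimage, Set.mem_preimage, mem_rootsOf_iff]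
    constructor
    · intro hw
      obtain ⟨n, q, rfl, -⟩ := hTint w hw
      exact ⟨n, q, rfl, (hD.isIntRoot_iff n q).1 hw⟩
    · rintro ⟨n, q, rfl, hn⟩
      exact (hD.isIntRoot_iff n q).2 hn
  · have hTa : T (vecA l) = a := by rw [hT]; simp [vecA]
    have hGa : (lineA l).map (T : Space l →ₗ[ℝ] F) = G := by
      rw [lineA, Submodule.map_span, Set.image_singleton]
      change Submodule.span ℝ {T (vecA l)} = G
      rw [hTa]
      refine Submodule.eq_of_le_of_finrank_eq
        ((Submodule.span_singleton_le_iff_mem _ _).2 haG) ?_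
      rw [h.marking.finrank_eq]
      refine finrank_span_singleton fun h0 => ?_
      have := hab 1 0 (by simp [h0])
      exact one_ne_zero this.1
    rw [← hGa, Submodule.map_coe, Set.image_image]
    simp
  · have := hTI (T.symm x) (T.symm y)
    rw [T.apply_symm_apply, T.apply_symm_apply] at this
    rw [this, ← mul_assoc, inv_mul_cancel₀ hNpos.ne', one_mul]

end MERS

theorem mainTheorem1 :
    Nat.card MERS.EllipticType = 35 ∧
    -- every entry of the list is a non-reduced marked elliptic root system with the stated quotient
    (∀ (l : ℕ) (t : MERS.EllipticType), t.Admissible l →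
      MERS.IsMarkedElliptic l (MERS.form l) (t.roots l) (MERS.lineA l) ∧
      ¬ MERS.IsReduced (t.roots l) ∧
      ∃ e : (MERS.Space l ⧸ MERS.lineA l) ≃ₗ[ℝ] (Fin l → ℝ) × ℝ,
        e '' MERS.quotientRoots (t.roots l) (MERS.lineA l) = t.quotient.roots l) ∧
    -- every non-reduced marked elliptic root system is isomorphic to exactly one entry
    (∀ (l : ℕ) (F : Type*) [NormedAddCommGroup F] [NormedSpace ℝ F]
      (I : LinearMap.BilinForm ℝ F) (R : Set F) (G : Submodule ℝ F),
      MERS.IsMarkedElliptic l I R G → ¬ MERS.IsReduced R →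
      ∃ t : MERS.EllipticType, t.Admissible l ∧
        MERS.MarkedSimilar I R G (MERS.form l) (t.roots l) (MERS.lineA l) ∧
        (∃ e : (F ⧸ G) ≃ₗ[ℝ] (Fin l → ℝ) × ℝ,
          e '' MERS.quotientRoots R G = t.quotient.roots l) ∧
        ∀ t' : MERS.EllipticType, t'.Admissible l →
          MERS.MarkedIso R G (t'.roots l) (MERS.lineA l) → t' = t) := by
  refine ⟨MERS.EllipticType.natCard_eq, fun l t ht => ⟨MERS.EllipticType.isMarkedElliptic_roots ht,
    MERS.EllipticType.not_isReduced_roots ht, MERS.quotientEquiv l, t.quotientEquiv_image l⟩, ?_⟩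
  intro l F _ _ I R G h hnr
  obtain ⟨t, ht, hsim⟩ := h.exists_type hnr
  obtain ⟨e, he⟩ := hsim.markedIso.exists_quotient
  refine ⟨t, ht, hsim, ⟨e.trans (MERS.quotientEquiv l), ?_⟩, fun t' ht' hiso => ?_⟩
  · rw [← t.quotientEquiv_image l, ← he, Set.image_image]
    rfl
  · exact MERS.EllipticType.eq_of_markedIso ht' ht (hiso.symm.trans hsim.markedIso)
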